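/- Let $a>0$, $b>0$ and $0<t<1$. Let $\rho_1$ and $\rho_3$ be the measures on $\mathbb{R}^-=(-\infty,0]$ with densities $$\frac{d\rho_1}{dx}=\frac{\sqrt a}{\pi t}|x|^{-1/2},\qquad \frac{d\rho_3}{dx}=\frac{\sqrt b}{\pi(1-t)}|x|^{-1/2},$$ let $V(x)=\frac{x}{t(1-t)}-\frac{2\sqrt{ax}}{t}-\frac{2\sqrt{bx}}{1-t}$ for $x\ge 0$, and write $I(\mu,\nu)=\iint\log\frac{1}{|x-y|}\,d\mu(x)\,d\nu(y)$, $I(\mu)=I(\mu,\mu)$. Let $(\mu_1,\mu_2,\mu_3)$ be the minimizer of $$E(\nu_1,\nu_2,\nu_3)=\sum_{j=1}^{3}I(\nu_j)-\sum_{j=1}^{2}I(\nu_j,\nu_{j+1})+\int V\,d\nu_2$$ among all triples of positive measures, with all terms of $E$ finite (absolutely convergent integrals), such that $\nu_1$ and $\nu_3$ live on $\mathbb{R}^-$, have total mass $1/2$ and satisfy $\nu_1\le\rho_1$, $\nu_3\le\rho_3$, and $\nu_2$ lives on $[0,\infty)$ and has total mass $1$. The minimizer is said to be in Case I if $\operatorname{supp}(\rho_1-\mu_1)=\operatorname{supp}(\rho_3-\mu_3)=(-\infty,0]$,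 $\operatorname{supp}(\mu_2)=[p,q]$ for some $0<p<q$, and the measures $\rho_1-\mu_1$ and $\rho_3-\mu_3$ have densities that blow up like an inverse square root at $0$, that is, each density is asymptotic to $C|x|^{-1/2}$ as $x\to0^-$ for some constant $C>0$ (which may differ for the two measures). Then the minimizer is in Case I if and only if $ab>1/4$. -/

import Mathlib

open MeasureTheory Set Filter Topology

noncomputable section

namespace VectorEquilibrium

/-- The measure on `(-∞, 0]` with density `√c / (π s) * |x| ^ (-1/2)`.
With `(c, s) = (a, t)` it is the first upper constraint `ρ₁`, with `(c, s) = (b, 1 - t)`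
the second upper constraint `ρ₃`. -/
def constraint (c s : ℝ) : Measure ℝ :=
  (volume.restrict (Iic 0)).withDensity
    fun x => ENNReal.ofReal (√c / (Real.pi * s) / √|x|)

/-- The external field acting on the second measure. -/
def externalField (a b t x : ℝ) : ℝ :=
  x / (t * (1 - t)) - 2 * √(a * x) / t - 2 * √(b * x) / (1 - t)

/-- The mutual logarithmic energy `I(μ, ν) = ∬ log (1 / |x - y|) dμ(x) dν(y)`.
It is used only for pairs with `FiniteEnergy μ ν`. -/
def mutualEnergy (μ ν : Measure ℝ) : ℝ :=
  ∫ z, Real.log (1 / |z.1 - z.2|) ∂(μ.prod ν)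

/-- The double integral defining `I(μ, ν)` converges absolutely. The kernel
`log (1 / |x - y|)` is `+∞` on the diagonal (where `Real.log` has the value `0`), so the
diagonal must be a null set; for `μ = ν` this says that `μ` has no atoms. -/
def FiniteEnergy (μ ν : Measure ℝ) : Prop :=
  (μ.prod ν) {z | z.1 = z.2} = 0 ∧
    Integrable (fun z : ℝ × ℝ => Real.log (1 / |z.1 - z.2|)) (μ.prod ν)

/-- The energy functional `E(ν₁, ν₂, ν₃)`. -/
def energy (a b t : ℝ) (ν₁ ν₂ ν₃ : Measure ℝ) : ℝ :=
  mutualEnergy ν₁ ν₁ + mutualEnergy ν₂ ν₂ + mutualEnergy ν₃ ν₃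
    - mutualEnergy ν₁ ν₂ - mutualEnergy ν₂ ν₃ + ∫ x, externalField a b t x ∂ν₂

/-- The competitors of the vector equilibrium problem: positive measures with the prescribed
supports, total masses and upper constraints, for which every term of the energy functional
is finite. -/
structure Admissible (a b t : ℝ) (ν₁ ν₂ ν₃ : Measure ℝ) : Prop where
  carrier₁ : ν₁ (Iic 0)ᶜ = 0
  mass₁ : ν₁ univ = 1 / 2
  le₁ : ν₁ ≤ constraint a t
  carrier₂ : ν₂ (Ici 0)ᶜ = 0
  mass₂ : ν₂ univ = 1
  carrier₃ : ν₃ (Iic 0)ᶜ = 0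
  mass₃ : ν₃ univ = 1 / 2
  le₃ : ν₃ ≤ constraint b (1 - t)
  finite₁₁ : FiniteEnergy ν₁ ν₁
  finite₂₂ : FiniteEnergy ν₂ ν₂
  finite₃₃ : FiniteEnergy ν₃ ν₃
  finite₁₂ : FiniteEnergy ν₁ ν₂
  finite₂₃ : FiniteEnergy ν₂ ν₃
  finite_field : Integrable (externalField a b t) ν₂

/-- `(μ₁, μ₂, μ₃)` minimizes the energy functional among all competitors. -/
def IsMinimizer (a b t : ℝ) (μ₁ μ₂ μ₃ : Measure ℝ) : Prop :=
  Admissible a b t μ₁ μ₂ μ₃ ∧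
    ∀ ν₁ ν₂ ν₃ : Measure ℝ, Admissible a b t ν₁ ν₂ ν₃ →
      energy a b t μ₁ μ₂ μ₃ ≤ energy a b t ν₁ ν₂ ν₃

/-- The measure `σ` on `(-∞, 0]` has a density that blows up like an inverse square root
at `0`, i.e. that behaves like `C |x| ^ (-1/2)` with `C > 0` as `x → 0-`. -/
def InvSqrtBlowup (σ : Measure ℝ) : Prop :=
  ∃ h : ℝ → ℝ, Measurable h ∧ (∀ x, 0 ≤ h x) ∧
    σ = (volume.restrict (Iic 0)).withDensity (fun x => ENNReal.ofReal (h x)) ∧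
    ∃ C : ℝ, 0 < C ∧ Tendsto (fun x => √|x| * h x) (𝓝[<] 0) (𝓝 C)

/-- Case I: `supp (ρ₁ - μ₁) = (-∞, -r₁]`, `supp μ₂ = [p, q]`, `supp (ρ₃ - μ₃) = (-∞, -r₃]`
with `r₁ = r₃ = 0` and `p > 0`, and the densities of `ρ₁ - μ₁` and `ρ₃ - μ₃` blow up like an
inverse square root at `0`. -/
def IsCaseI (a b t : ℝ) (μ₁ μ₂ μ₃ : Measure ℝ) : Prop :=
  (constraint a t - μ₁).support = Iic 0 ∧
  (constraint b (1 - t) - μ₃).support = Iic 0 ∧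
  (∃ p q : ℝ, 0 < p ∧ p < q ∧ μ₂.support = Icc p q) ∧
  InvSqrtBlowup (constraint a t - μ₁) ∧
  InvSqrtBlowup (constraint b (1 - t) - μ₃)

end VectorEquilibrium

end

/-! Write `μ₂` as the image of a measure `σ` under `u ↦ u²`. Where the upper constraints are
inactive, the Euler–Lagrange condition for an outer measure is `2 U^{μ₁} = U^{μ₂}` on `(-∞, 0]`,
which makes both outer measures equal to half the balayage of `μ₂`. At `y²` the potential of the
balayage is `-2 ∫ log (y + u) dσ(u)`, and this cancels exactly the second term of `log |y² - u²| =
log |y - u| + log (y + u)`. Moreover `V(y²)` is `2 (y - m)² / R²` up to a constant, with `m = (1 -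
t)√a + t√b` and `R² = 2t(1 - t)`. What remains is the scalar equilibrium problem in a quadratic
field, whose solution is the semicircle law on `[m - R, m + R]` (`extremal`).

The half balayage has density `balFactor σ x / (2π√|x|)`, and the numerator is largest at `x = 0`,
where it is `∫ u⁻¹ dσ = (2/R²)(m - √(m² - R²))`. Staying strictly below both constraints means `|t√b
- (1 - t)√a| < √(m² - R²)`. The difference of the squares is `4t(1 - t)(√(ab) - 1/2)`, so the
condition is `ab > 1/4` (`phase_condition`).

If `ab > 1/4`, the explicit triple is admissible. The energy difference to another competitor is a
linear term, nonnegative by the Euler–Lagrange conditions, plus `I(δ₁ - δ₂/2) + I(δ₃ - δ₂/2) +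
I(δ₂)/2`, where `δᵢ` are the differences of the measures. Positive definiteness of the logarithmic
energy on neutral combinations (`sum_mutualEnergy_nonneg`) then identifies every minimizer
(`eq_extremal_of_isMinimizer`).

Conversely, in Case I the full support of `ρ₁ - μ₁` and `ρ₃ - μ₃` permits adding mass anywhere on
`(-∞, 0]`, which forces the half balayages (`IsOuterMinimizer.eq_halfBal`). Then `σ` satisfies the
scalar variational inequality on `[0, ∞)`. It must be compared with a semicircle that might reach
below `0`; convexity of the field to the left of the support carries the inequality to the negative
axis (`le_lineField_of_neg`), and `σ` is the semicircle law (`eq_extremal`). Positivity of `p` gives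
`R < m`, the positive blow-up constants give the strict inequalities at `0`, and `phase_condition`
concludes. -/

noncomputable section

namespace VectorEquilibrium

section

/-! ### Positive definiteness of the logarithmic energy -/

/-- The difference of exponentials is at most `s` times the difference of rates times the slower
exponential. The factor `s` cancels the singularity at `0`, and exponential decay is left at
infinity. -/
lemma abs_exp_sub_exp_le {c s : ℝ} (hs : 0 < s) :
    |s⁻¹ * (Real.exp (-(c * s)) - Real.exp (-s))| ≤ |c - 1| * Real.exp (-(min c 1) * s) := by
  have key : ∀ p q : ℝ, p ≤ q →
      |Real.exp (-(p * s)) - Real.exp (-(q * s))| ≤ s * ((q - p) * Real.exp (-(p * s))) := by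
    intro p q hpq
    have h1 : Real.exp (-(q * s)) ≤ Real.exp (-(p * s)) := Real.exp_le_exp.2 (by nlinarith)
    have h2 : Real.exp (-(q * s)) = Real.exp (-(p * s)) * Real.exp (-((q - p) * s)) := by
      rw [← Real.exp_add]; congr 1; ring
    have h3 := Real.add_one_le_exp (-((q - p) * s))
    have h4 := Real.exp_pos (-(p * s))
    rw [abs_of_nonneg (by linarith), h2]
    nlinarith
  rw [abs_mul, abs_of_pos (inv_pos.2 hs), inv_mul_le_iff₀ hs]
  rcases le_total c 1 with h | h
  · have := key c 1 h
    rw [one_mul] at this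
    rw [min_eq_left h, abs_sub_comm c 1, abs_of_nonneg (sub_nonneg.2 h), neg_mul]
    exact this
  · have := key 1 c h
    rw [one_mul, abs_sub_comm] at this
    rw [min_eq_right h, abs_of_nonneg (sub_nonneg.2 h), neg_mul, one_mul]
    exact this

lemma integrableOn_frullani_exp {c : ℝ} (hc : 0 < c) :
    IntegrableOn (fun s : ℝ => s⁻¹ * (Real.exp (-(c * s)) - Real.exp (-s))) (Ioi 0) := by
  have hm : 0 < min c 1 := lt_min hc one_pos
  refine Integrable.mono' (g := fun s => |c - 1| * Real.exp (-(min c 1) * s))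
    ((exp_neg_integrableOn_Ioi 0 hm).const_mul _) ?_ ?_
  · exact (by fun_prop : Measurable fun s : ℝ =>
      s⁻¹ * (Real.exp (-(c * s)) - Real.exp (-s))).aestronglyMeasurable
  · filter_upwards [ae_restrict_mem measurableSet_Ioi] with s hs
    exact abs_exp_sub_exp_le hs

lemma integral_frullani_exp {c : ℝ} (hc : 0 < c) :
    ∫ s in Ioi (0 : ℝ), s⁻¹ * (Real.exp (-(c * s)) - Real.exp (-s)) = -Real.log c := by
  have := Frullani.integral_Ioi_eq (f := fun x : ℝ => Real.exp (-x)) (a := c) (b := 1) (L := 1)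
    (R := 0) ((by fun_prop : Continuous fun x : ℝ => Real.exp (-x)).locallyIntegrable.locallyIntegrableOn _) hc one_pos ?_ ?_ ?_
  · simpa using this
  · have : Tendsto (fun x : ℝ => Real.exp (-x)) (𝓝 0) (𝓝 (Real.exp (-0))) :=
      (by fun_prop : Continuous fun x : ℝ => Real.exp (-x)).tendsto 0
    simp only [neg_zero, Real.exp_zero] at this
    exact this.mono_left nhdsWithin_le_nhds
  · exact Real.tendsto_exp_neg_atTop_nhds_zero
  · simpa using integrableOn_frullani_exp hc

/-- The integrand has constant sign, determined by whether `c ≤ 1`. Hence absolute convergence of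
the energy is exactly what Fubini needs later. -/
lemma integral_abs_frullani_exp {c : ℝ} (hc : 0 < c) :
    ∫ s in Ioi (0 : ℝ), |s⁻¹ * (Real.exp (-(c * s)) - Real.exp (-s))| = |Real.log c| := by
  rcases le_total c 1 with h | h
  · rw [abs_of_nonpos (Real.log_nonpos hc.le h), ← integral_frullani_exp hc]
    refine setIntegral_congr_fun measurableSet_Ioi fun s (hs : 0 < s) => ?_
    refine abs_of_nonneg (mul_nonneg (inv_pos.2 hs).le (sub_nonneg.2 (Real.exp_le_exp.2 ?_)))
    nlinarith
  · rw [abs_of_nonneg (Real.log_nonneg h), ← neg_neg (Real.log c), ← integral_frullani_exp hc,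
      ← integral_neg]
    refine setIntegral_congr_fun measurableSet_Ioi fun s (hs : 0 < s) => ?_
    refine abs_of_nonpos
      (mul_nonpos_of_nonneg_of_nonpos (inv_pos.2 hs).le (sub_nonpos.2 (Real.exp_le_exp.2 ?_)))
    nlinarith

/-- The Gaussian energy of a pair of measures. -/
def gaussEnergy (s : ℝ) (μ ν : Measure ℝ) : ℝ :=
  ∫ z, Real.exp (-((z.1 - z.2) ^ 2 * s)) ∂(μ.prod ν)

lemma integrable_gaussKernel {s : ℝ} (hs : 0 ≤ s) {P : Measure (ℝ × ℝ)} [IsFiniteMeasure P] :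
    Integrable (fun z : ℝ × ℝ => Real.exp (-((z.1 - z.2) ^ 2 * s))) P := by
  refine Integrable.of_bound (by fun_prop : Measurable fun z : ℝ × ℝ =>
    Real.exp (-((z.1 - z.2) ^ 2 * s))).aestronglyMeasurable 1 (ae_of_all _ fun z => ?_)
  rw [Real.norm_eq_abs, Real.abs_exp, Real.exp_le_one_iff]
  have := mul_nonneg (sq_nonneg (z.1 - z.2)) hs
  linarith

lemma log_one_div_abs (x : ℝ) : Real.log (1 / |x|) = -Real.log |x| := by
  rw [one_div, Real.log_inv]

/-- Frullani's integral with `c = (x - y)²` writes `2 log (1/|x - y|)` as a superposition of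
Gaussian kernels, renormalized by `e^{-s}`; Fubini then moves the `s`-integral outside. -/
lemma mutualEnergy_eq_integral_gaussEnergy {μ ν : Measure ℝ} [IsFiniteMeasure μ]
    [IsFiniteMeasure ν] (h : FiniteEnergy μ ν) :
    IntegrableOn (fun s => s⁻¹ * (gaussEnergy s μ ν - Real.exp (-s) * (μ.real univ * ν.real univ)))
      (Ioi 0) ∧
    mutualEnergy μ ν = 2⁻¹ * ∫ s in Ioi (0 : ℝ),
      s⁻¹ * (gaussEnergy s μ ν - Real.exp (-s) * (μ.real univ * ν.real univ)) := by
  set P := μ.prod ν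
  let K : (ℝ × ℝ) → ℝ → ℝ := fun z s =>
    s⁻¹ * (Real.exp (-((z.1 - z.2) ^ 2 * s)) - Real.exp (-s))
  have hne : ∀ᵐ z ∂P, z.1 ≠ z.2 := by
    rw [ae_iff]; simpa using h.1
  have hpos : ∀ᵐ z ∂P, 0 < (z.1 - z.2) ^ 2 := by
    filter_upwards [hne] with z hz
    exact sq_pos_of_ne_zero (sub_ne_zero.2 hz)
  have hlog : ∀ z : ℝ × ℝ, Real.log ((z.1 - z.2) ^ 2) = -(2 * Real.log (1 / |z.1 - z.2|)) := by
    intro z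
    rw [log_one_div_abs, ← sq_abs, Real.log_pow]; push_cast; ring
  have hint : Integrable (Function.uncurry K) (P.prod (volume.restrict (Ioi 0))) := by
    have hmeas : Measurable (Function.uncurry K) := by
      unfold K Function.uncurry; fun_prop
    rw [integrable_prod_iff hmeas.aestronglyMeasurable]
    constructor
    · filter_upwards [hpos] with z hz
      exact integrableOn_frullani_exp hz
    · refine (h.2.norm.const_mul 2).congr ?_
      filter_upwards [hpos] with z hz
      change 2 * ‖_‖ = ∫ s in Ioi (0:ℝ), |K z s|
      rw [integral_abs_frullani_exp hz, hlog, abs_neg, abs_mul, Real.norm_eq_abs]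
      norm_num
  have hswap := integral_integral_swap (f := K) hint
  have hin : ∀ s ∈ Ioi (0 : ℝ), ∫ z, K z s ∂P =
      s⁻¹ * (gaussEnergy s μ ν - Real.exp (-s) * (μ.real univ * ν.real univ)) := by
    intro s hs
    have hg : Integrable (fun z : ℝ × ℝ => Real.exp (-((z.1 - z.2) ^ 2 * s))) P :=
      integrable_gaussKernel hs.le
    have hK : ∀ z, K z s = s⁻¹ * (Real.exp (-((z.1 - z.2) ^ 2 * s)) - Real.exp (-s)) :=
      fun _ => rfl
    have hP : P.real univ = μ.real univ * ν.real univ := by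
      simp [P, measureReal_def, ← Set.univ_prod_univ, Measure.prod_prod]
    simp_rw [hK]
    rw [integral_const_mul, integral_sub hg (integrable_const _), integral_const, hP, smul_eq_mul,
      mul_comm (_ * _) (Real.exp (-s)), gaussEnergy]
  have hleft : ∫ z, (∫ s in Ioi (0:ℝ), K z s) ∂P = 2 * mutualEnergy μ ν := by
    rw [mutualEnergy, ← integral_const_mul]
    refine integral_congr_ae ?_
    filter_upwards [hpos] with z hz
    rw [integral_frullani_exp hz, hlog, neg_neg]
  constructor
  · refine hint.integral_prod_right.congr ?_
    filter_upwards [ae_restrict_mem measurableSet_Ioi] with s hs using hin s hs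
  · rw [hleft, setIntegral_congr_fun measurableSet_Ioi hin] at hswap
    linarith

/-- `exp(-d² s)` is the characteristic function at `d` of the centered Gaussian of variance `2s`;
this is what makes the Gaussian kernel positive definite. -/
lemma gaussEnergy_eq_integral_charFun {s : ℝ} (hs : 0 < s) (μ ν : Measure ℝ) [IsFiniteMeasure μ]
    [IsFiniteMeasure ν] :
    (gaussEnergy s μ ν : ℂ) = ∫ ξ, charFun μ ξ * (starRingEnd ℂ) (charFun ν ξ)
      ∂(ProbabilityTheory.gaussianReal 0 (2 * s).toNNReal) := by
  set γ := ProbabilityTheory.gaussianReal 0 (2 * s).toNNReal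
  have hv : ((2 * s).toNNReal : ℝ) = 2 * s := Real.coe_toNNReal _ (by linarith)
  have h1 : ∀ z : ℝ × ℝ, (Real.exp (-((z.1 - z.2) ^ 2 * s)) : ℂ) =
      ∫ ξ : ℝ, Complex.exp ((z.1 - z.2 : ℝ) * ξ * Complex.I) ∂γ := by
    intro z
    rw [← charFun_apply_real, ProbabilityTheory.charFun_gaussianReal]
    have : (((2 * s).toNNReal : ℝ) : ℂ) = 2 * s := by rw [hv]; push_cast; rfl
    rw [show (((2 * s).toNNReal : NNReal) : ℂ) = 2 * s from this]
    push_cast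
    congr 1; ring
  have h2 : ∀ ξ : ℝ, charFun μ ξ * (starRingEnd ℂ) (charFun ν ξ) =
      ∫ z : ℝ × ℝ, Complex.exp ((z.1 - z.2 : ℝ) * ξ * Complex.I) ∂(μ.prod ν) := by
    intro ξ
    rw [← charFun_neg, charFun_apply_real, charFun_apply_real, ← integral_prod_mul]
    refine integral_congr_ae (ae_of_all _ fun z => ?_)
    simp only
    rw [← Complex.exp_add]
    congr 1; push_cast; ring
  simp_rw [h2]
  rw [integral_integral_swap, gaussEnergy, ← integral_complex_ofReal]
  · exact integral_congr_ae (ae_of_all _ h1)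
  · refine Integrable.of_bound (C := 1) (Measurable.aestronglyMeasurable ?_) (ae_of_all _ fun p => ?_)
    · unfold Function.uncurry; fun_prop
    · rw [Function.uncurry, show (((p.2.1 - p.2.2 : ℝ) : ℂ) * (p.1 : ℂ) * Complex.I) =
        (((p.2.1 - p.2.2) * p.1 : ℝ) : ℂ) * Complex.I by push_cast; ring]
      rw [Complex.norm_exp_ofReal_mul_I]

variable {ι : Type*} [Fintype ι]

lemma sum_gaussEnergy {s : ℝ} (hs : 0 < s) (μ : ι → Measure ℝ)
    [∀ i, IsFiniteMeasure (μ i)] (c : ι → ℝ) :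
    ∑ i, ∑ j, c i * c j * gaussEnergy s (μ i) (μ j) =
      ∫ ξ, ‖∑ i, (c i : ℂ) * charFun (μ i) ξ‖ ^ 2
        ∂(ProbabilityTheory.gaussianReal 0 (2 * s).toNNReal) := by
  have hint : ∀ i j, Integrable (fun ξ => charFun (μ i) ξ * (starRingEnd ℂ) (charFun (μ j) ξ))
      (ProbabilityTheory.gaussianReal 0 (2 * s).toNNReal) := by
    intro i j
    refine Integrable.of_bound (C := (μ i).real univ * (μ j).real univ)
      (Continuous.aestronglyMeasurable
        (continuous_charFun.mul (Complex.continuous_conj.comp continuous_charFun)))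
      (ae_of_all _ fun ξ => ?_)
    rw [norm_mul, RCLike.norm_conj]
    exact mul_le_mul (norm_charFun_le ξ) (norm_charFun_le ξ) (norm_nonneg _) (by positivity)
  apply Complex.ofReal_injective
  rw [← integral_complex_ofReal]
  have hsq : ∀ ξ, ((‖∑ i, (c i : ℂ) * charFun (μ i) ξ‖ ^ 2 : ℝ) : ℂ) =
      ∑ i, ∑ j, (c i : ℂ) * c j * (charFun (μ i) ξ * (starRingEnd ℂ) (charFun (μ j) ξ)) := by
    intro ξ
    push_cast
    rw [← Complex.mul_conj', map_sum, Finset.sum_mul_sum]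
    refine Finset.sum_congr rfl fun i _ => Finset.sum_congr rfl fun j _ => ?_
    rw [map_mul, Complex.conj_ofReal]
    ring
  simp_rw [hsq]
  rw [integral_finsetSum _ fun i _ => integrable_finsetSum _ fun j _ => (hint i j).const_mul _]
  push_cast
  refine Finset.sum_congr rfl fun i _ => ?_
  rw [integral_finsetSum _ fun j _ => (hint i j).const_mul _]
  refine Finset.sum_congr rfl fun j _ => ?_
  rw [integral_const_mul, gaussEnergy_eq_integral_charFun hs]

/-- Positive definiteness of the logarithmic energy on neutral combinations of measures. -/
theorem sum_mutualEnergy_nonneg (μ : ι → Measure ℝ) [∀ i, IsFiniteMeasure (μ i)] (c : ι → ℝ)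
    (h0 : ∑ i, c i * (μ i).real univ = 0) (hF : ∀ i j, FiniteEnergy (μ i) (μ j)) :
    0 ≤ ∑ i, ∑ j, c i * c j * mutualEnergy (μ i) (μ j) ∧
    (∑ i, ∑ j, c i * c j * mutualEnergy (μ i) (μ j) = 0 →
      ∀ ξ, ∑ i, (c i : ℂ) * charFun (μ i) ξ = 0) := by
  let G : ι → ι → ℝ → ℝ := fun i j s =>
    s⁻¹ * (gaussEnergy s (μ i) (μ j) - Real.exp (-s) * ((μ i).real univ * (μ j).real univ))
  have hG : ∀ i j, IntegrableOn (fun s => c i * c j * G i j s) (Ioi 0) := fun i j =>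
    (mutualEnergy_eq_integral_gaussEnergy (hF i j)).1.const_mul _
  -- The renormalizing term factors into a product of two total charges, so neutrality removes it.
  have hsum : ∀ s, ∑ i, ∑ j, c i * c j * G i j s =
      s⁻¹ * ∑ i, ∑ j, c i * c j * gaussEnergy s (μ i) (μ j) := by
    intro s
    have : ∑ i, ∑ j, c i * c j * G i j s =
        s⁻¹ * ∑ i, ∑ j, c i * c j * gaussEnergy s (μ i) (μ j) -
        s⁻¹ * Real.exp (-s) *
          ((∑ i, c i * (μ i).real univ) * (∑ j, c j * (μ j).real univ)) := by
      rw [Finset.sum_mul_sum]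
      simp only [Finset.mul_sum, ← Finset.sum_sub_distrib, G]
      refine Finset.sum_congr rfl fun i _ => Finset.sum_congr rfl fun j _ => ?_
      ring
    rw [this, h0]; ring
  have hE : ∑ i, ∑ j, c i * c j * mutualEnergy (μ i) (μ j) =
      2⁻¹ * ∫ s in Ioi (0 : ℝ), s⁻¹ * ∑ i, ∑ j, c i * c j * gaussEnergy s (μ i) (μ j) := by
    simp_rw [← hsum]
    rw [integral_finsetSum _ fun i _ => integrable_finsetSum _ fun j _ => hG i j, Finset.mul_sum]
    refine Finset.sum_congr rfl fun i _ => ?_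
    rw [integral_finsetSum _ fun j _ => hG i j, Finset.mul_sum]
    refine Finset.sum_congr rfl fun j _ => ?_
    rw [(mutualEnergy_eq_integral_gaussEnergy (hF i j)).2, integral_const_mul]
    ring
  have hnn : ∀ s ∈ Ioi (0 : ℝ), 0 ≤ s⁻¹ * ∑ i, ∑ j, c i * c j * gaussEnergy s (μ i) (μ j) := by
    intro s hs
    rw [sum_gaussEnergy hs]
    exact mul_nonneg (inv_pos.2 hs).le (integral_nonneg fun ξ => by positivity)
  refine ⟨?_, fun h => ?_⟩
  · rw [hE]
    exact mul_nonneg (by norm_num) (setIntegral_nonneg measurableSet_Ioi hnn)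
  · rw [hE] at h
    have hI : IntegrableOn (fun s => s⁻¹ * ∑ i, ∑ j, c i * c j * gaussEnergy s (μ i) (μ j))
        (Ioi (0 : ℝ)) := by
      simp_rw [← hsum]
      exact integrable_finsetSum _ fun i _ => integrable_finsetSum _ fun j _ => hG i j
    have h' : ∫ s in Ioi (0 : ℝ), s⁻¹ * ∑ i, ∑ j, c i * c j * gaussEnergy s (μ i) (μ j) = 0 := by
      linarith
    rw [setIntegral_eq_zero_iff_of_nonneg_ae
      ((ae_restrict_mem measurableSet_Ioi).mono hnn) hI] at h'
    -- A single `s` suffices: a nondegenerate Gaussian has the null sets of Lebesgue measure, and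
    -- the combination of characteristic functions is continuous, so it vanishes everywhere.
    obtain ⟨s, hs, hs0⟩ : ∃ s ∈ Ioi (0 : ℝ),
        s⁻¹ * ∑ i, ∑ j, c i * c j * gaussEnergy s (μ i) (μ j) = 0 := by
      have h2 : ∀ᵐ s ∂(volume.restrict (Ioi (0 : ℝ))), s ∈ Ioi (0 : ℝ) ∧
          s⁻¹ * ∑ i, ∑ j, c i * c j * gaussEnergy s (μ i) (μ j) = 0 :=
        (ae_restrict_mem measurableSet_Ioi).and h'
      have : (ae (volume.restrict (Ioi (0 : ℝ)))).NeBot := by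
        rw [ae_neBot]
        simp
      exact h2.exists
    have hs' : (0 : ℝ) < s := hs
    rw [mul_eq_zero, or_iff_right (inv_pos.2 hs').ne', sum_gaussEnergy hs'] at hs0
    have hcont : Continuous fun ξ => ∑ i, (c i : ℂ) * charFun (μ i) ξ :=
      continuous_finsetSum _ fun i _ => continuous_const.mul continuous_charFun
    have hv : (2 * s).toNNReal ≠ 0 := by
      rw [Ne, Real.toNNReal_eq_zero]; linarith
    rw [integral_eq_zero_iff_of_nonneg (fun ξ => by positivity)] at hs0
    · have hae : ∀ᵐ ξ ∂(volume : Measure ℝ), ∑ i, (c i : ℂ) * charFun (μ i) ξ = 0 := by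
        filter_upwards [(ProbabilityTheory.gaussianReal_absolutelyContinuous' 0 hv).ae_le hs0]
          with ξ hξ
        simpa using hξ
      exact congrFun ((hcont.ae_eq_iff_eq volume continuous_const).1 hae)
    · refine Integrable.of_bound (C := (∑ i, |c i| * (μ i).real univ) ^ 2)
        (hcont.norm.pow 2).aestronglyMeasurable (ae_of_all _ fun ξ => ?_)
      rw [norm_pow, norm_norm]
      refine pow_le_pow_left₀ (norm_nonneg _) ((norm_sum_le _ _).trans ?_) 2
      refine Finset.sum_le_sum fun i _ => ?_
      rw [norm_mul, Complex.norm_real, Real.norm_eq_abs]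
      exact mul_le_mul_of_nonneg_left (norm_charFun_le ξ) (abs_nonneg _)

end

section

/-! ### Logarithmic potentials and mutual energies -/

/-- The logarithmic potential of a measure. -/
def potential (μ : Measure ℝ) (x : ℝ) : ℝ := ∫ y, -Real.log |x - y| ∂μ

/-- The measure has no atoms and the positive part of the logarithmic kernel has a bounded
potential. -/
structure LogRegular (μ : Measure ℝ) : Prop where
  noAtoms : NullSingletonClass μ
  bound : ∃ C : NNReal, ∀ x, ∫⁻ y, ENNReal.ofReal (-Real.log |x - y|) ∂μ ≤ C

/-- Finite logarithmic moment. -/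
def LogMoment (μ : Measure ℝ) : Prop := Integrable (fun y => Real.log (1 + |y|)) μ

lemma log_one_add_abs_nonneg (y : ℝ) : 0 ≤ Real.log (1 + |y|) :=
  Real.log_nonneg (by linarith [abs_nonneg y])

lemma log_abs_sub_le (x y : ℝ) :
    Real.log |x - y| ≤ Real.log (1 + |x|) + Real.log (1 + |y|) := by
  have hx := abs_nonneg x
  have hy := abs_nonneg y
  rcases eq_or_ne (x - y) 0 with h | h
  · rw [h]; simp only [abs_zero, Real.log_zero]
    exact add_nonneg (log_one_add_abs_nonneg x) (log_one_add_abs_nonneg y)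
  · rw [← Real.log_mul (by positivity) (by positivity)]
    refine Real.log_le_log (abs_pos.2 h) ?_
    have := abs_sub x y
    nlinarith

/-- Lets a logarithmic moment be recovered from absolute convergence of the potential at one point.
-/
lemma log_one_add_abs_le (x y : ℝ) :
    Real.log (1 + |y|) ≤ Real.log (1 + |x|) + Real.log 2 + |Real.log (|x - y|)| := by
  have hx := abs_nonneg x
  have hy := abs_nonneg y
  have h1 : |y| ≤ |x| + |x - y| := by
    have := abs_sub_abs_le_abs_sub y x
    rw [abs_sub_comm y x] at this; linarith
  rcases le_total |x - y| 1 with h | h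
  · rw [← Real.log_mul (by positivity) (by positivity)]
    have : Real.log (1 + |y|) ≤ Real.log ((1 + |x|) * 2) :=
      Real.log_le_log (by positivity) (by nlinarith)
    linarith [abs_nonneg (Real.log (|x - y|))]
  · rw [abs_of_nonneg (Real.log_nonneg h), ← Real.log_mul (by positivity) (by positivity),
      ← Real.log_mul (by positivity) (by positivity)]
    exact Real.log_le_log (by positivity) (by nlinarith)

/-- Separates the singularity, controlled by `LogRegular`, from the growth at infinity, controlled
by `LogMoment`. -/
lemma enorm_log_le (x y : ℝ) : ‖-Real.log |x - y|‖ₑ ≤ ENNReal.ofReal (-Real.log |x - y|) +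
    (ENNReal.ofReal (Real.log (1 + |x|)) + ENNReal.ofReal (Real.log (1 + |y|))) := by
  rw [Real.enorm_eq_ofReal_abs, ← ENNReal.ofReal_add (log_one_add_abs_nonneg x)
    (log_one_add_abs_nonneg y)]
  rcases le_total (Real.log |x - y|) 0 with h | h
  · rw [abs_of_nonneg (by linarith)]
    exact le_self_add
  · rw [abs_of_nonpos (by linarith), neg_neg]
    exact (ENNReal.ofReal_le_ofReal (log_abs_sub_le x y)).trans le_add_self

lemma measurable_logKernel : Measurable fun z : ℝ × ℝ => -Real.log |z.1 - z.2| := by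
  fun_prop

lemma measurable_logKernel_left (x : ℝ) : Measurable fun y : ℝ => -Real.log |x - y| := by
  fun_prop

variable {μ ν l : Measure ℝ}

lemma LogRegular.mono (h : LogRegular ν) (hle : μ ≤ ν) : LogRegular μ where
  noAtoms := ⟨fun x => le_antisymm ((hle {x}).trans (h.noAtoms.measure_singleton x).le) (zero_le)⟩
  bound := by
    obtain ⟨C, hC⟩ := h.bound
    exact ⟨C, fun x => (lintegral_mono' hle le_rfl).trans (hC x)⟩

lemma LogMoment.smul (h : LogMoment μ) (c : NNReal) : LogMoment (c • μ) :=
  Integrable.smul_measure_nnreal h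

lemma LogMoment.lintegral_lt_top (h : LogMoment μ) :
    ∫⁻ y, ENNReal.ofReal (Real.log (1 + |y|)) ∂μ < ⊤ := by
  have := h.2
  rwa [hasFiniteIntegral_iff_ofReal (ae_of_all _ log_one_add_abs_nonneg)] at this

lemma LogRegular.integrable_log [IsFiniteMeasure μ] (h : LogRegular μ) (hm : LogMoment μ) (x : ℝ) :
    Integrable (fun y => -Real.log |x - y|) μ := by
  refine ⟨(measurable_logKernel_left x).aestronglyMeasurable, ?_⟩
  obtain ⟨C, hC⟩ := h.bound
  refine (lintegral_mono (enorm_log_le x)).trans_lt ?_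
  rw [lintegral_add_left (by fun_prop), lintegral_add_left (by fun_prop), lintegral_const]
  exact ENNReal.add_lt_top.2 ⟨(hC x).trans_lt ENNReal.coe_lt_top,
    ENNReal.add_lt_top.2 ⟨ENNReal.mul_lt_top ENNReal.ofReal_lt_top (measure_lt_top _ _),
      hm.lintegral_lt_top⟩⟩

lemma FiniteEnergy.symm [IsFiniteMeasure μ] [IsFiniteMeasure ν] (h : FiniteEnergy μ ν) :
    FiniteEnergy ν μ := by
  constructor
  · rw [← Measure.prod_swap, Measure.map_apply measurable_swap
      (measurableSet_eq_fun measurable_fst measurable_snd)]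
    convert h.1 using 2
    ext z; exact eq_comm
  · refine h.2.swap.congr (ae_of_all _ fun z => ?_)
    simp [Function.comp, abs_sub_comm]

lemma mutualEnergy_comm (μ ν : Measure ℝ) [IsFiniteMeasure μ] [IsFiniteMeasure ν] :
    mutualEnergy μ ν = mutualEnergy ν μ := by
  unfold mutualEnergy
  rw [← integral_prod_swap]
  simp [abs_sub_comm]

/-- Only one of the two measures has to be regular, so explicit measures can be paired with
arbitrary competitors. -/
lemma LogRegular.finiteEnergy [IsFiniteMeasure μ] [IsFiniteMeasure ν] (h : LogRegular ν)
    (hμ : LogMoment μ) (hν : LogMoment ν) : FiniteEnergy μ ν := by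
  constructor
  · rw [Measure.measure_prod_null (measurableSet_eq_fun measurable_fst measurable_snd)]
    refine ae_of_all _ fun x => ?_
    have : (Prod.mk x ⁻¹' {z : ℝ × ℝ | z.1 = z.2}) = {x} := by
      ext y; simp [eq_comm]
    change ν (Prod.mk x ⁻¹' {z : ℝ × ℝ | z.1 = z.2}) = 0
    rw [this]
    exact h.noAtoms.measure_singleton x
  · simp_rw [log_one_div_abs]
    refine ⟨measurable_logKernel.aestronglyMeasurable, ?_⟩
    obtain ⟨C, hC⟩ := h.bound
    rw [HasFiniteIntegral, lintegral_prod _ (by fun_prop)]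
    calc ∫⁻ x, ∫⁻ y, ‖-Real.log |x - y|‖ₑ ∂ν ∂μ
        ≤ ∫⁻ x, (C + (ENNReal.ofReal (Real.log (1 + |x|)) * ν univ +
          ∫⁻ y, ENNReal.ofReal (Real.log (1 + |y|)) ∂ν)) ∂μ := by
          refine lintegral_mono fun x => (lintegral_mono (enorm_log_le x)).trans ?_
          rw [lintegral_add_left (by fun_prop), lintegral_add_left (by fun_prop), lintegral_const]
          exact add_le_add (hC x) le_rfl
      _ < ⊤ := by
          rw [lintegral_add_left measurable_const, lintegral_add_left (by fun_prop), lintegral_const,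
            lintegral_const, lintegral_mul_const _ (by fun_prop)]
          have h1 := hν.lintegral_lt_top
          have h2 := hμ.lintegral_lt_top
          exact ENNReal.add_lt_top.2 ⟨ENNReal.mul_lt_top ENNReal.coe_lt_top (measure_lt_top _ _),
            ENNReal.add_lt_top.2 ⟨ENNReal.mul_lt_top h2 (measure_lt_top _ _),
              ENNReal.mul_lt_top h1 (measure_lt_top _ _)⟩⟩

lemma FiniteEnergy.integrable_potential [IsFiniteMeasure μ] [IsFiniteMeasure ν]
    (h : FiniteEnergy μ ν) : Integrable (potential ν) μ := by
  have := h.2.integral_prod_left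
  simp_rw [log_one_div_abs] at this
  exact this

lemma FiniteEnergy.integrable_logKernel [IsFiniteMeasure μ] [IsFiniteMeasure ν]
    (h : FiniteEnergy μ ν) : ∀ᵐ x ∂μ, Integrable (fun y => -Real.log |x - y|) ν := by
  have := h.2.prod_right_ae
  simp_rw [log_one_div_abs] at this
  exact this

lemma FiniteEnergy.mutualEnergy_eq [IsFiniteMeasure μ] [IsFiniteMeasure ν]
    (h : FiniteEnergy μ ν) : mutualEnergy μ ν = ∫ x, potential ν x ∂μ := by
  rw [mutualEnergy, integral_prod _ h.2]
  simp_rw [log_one_div_abs]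
  rfl

lemma FiniteEnergy.logMoment [IsFiniteMeasure μ] [IsFiniteMeasure ν] [NeZero μ]
    (h : FiniteEnergy μ ν) : LogMoment ν := by
  obtain ⟨x, hx⟩ := h.integrable_logKernel.exists
  refine Integrable.mono' (((integrable_const (Real.log (1 + |x|) + Real.log 2))).add hx.abs)
    (by fun_prop : Measurable fun y : ℝ => Real.log (1 + |y|)).aestronglyMeasurable
    (ae_of_all _ fun y => ?_)
  rw [Real.norm_eq_abs, abs_of_nonneg (log_one_add_abs_nonneg y)]
  simpa using log_one_add_abs_le x y

lemma FiniteEnergy.add_left [IsFiniteMeasure μ] [IsFiniteMeasure ν] [IsFiniteMeasure l]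
    (h : FiniteEnergy μ l) (h' : FiniteEnergy ν l) : FiniteEnergy (μ + ν) l := by
  rw [FiniteEnergy, Measure.add_prod]
  exact ⟨by simp [h.1, h'.1], h.2.add_measure h'.2⟩

lemma FiniteEnergy.smul_left [IsFiniteMeasure l] (h : FiniteEnergy μ l) (c : NNReal) : FiniteEnergy (c • μ) l := by
  rw [FiniteEnergy, Measure.prod_smul_left]
  exact ⟨by simp [h.1], Integrable.smul_measure_nnreal h.2⟩

lemma FiniteEnergy.mutualEnergy_add_left [IsFiniteMeasure μ] [IsFiniteMeasure ν]
    [IsFiniteMeasure l] (h : FiniteEnergy μ l) (h' : FiniteEnergy ν l) :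
    mutualEnergy (μ + ν) l = mutualEnergy μ l + mutualEnergy ν l := by
  rw [mutualEnergy, Measure.add_prod, integral_add_measure h.2 h'.2]
  rfl

lemma mutualEnergy_smul_left (μ l : Measure ℝ) [IsFiniteMeasure l] (c : NNReal) :
    mutualEnergy (c • μ) l = c * mutualEnergy μ l := by
  rw [mutualEnergy, Measure.prod_smul_left, integral_smul_nnreal_measure]
  rfl

lemma FiniteEnergy.mono_left [IsFiniteMeasure ν] [IsFiniteMeasure l] (h : FiniteEnergy ν l)
    (hle : μ ≤ ν) : FiniteEnergy μ l := by
  have := Measure.prod_mono hle (le_refl l)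
  exact ⟨le_antisymm ((this _).trans h.1.le) zero_le, h.2.mono_measure this⟩

lemma FiniteEnergy.mutualEnergy_mix [IsFiniteMeasure μ] [IsFiniteMeasure ν] [IsFiniteMeasure l]
    (h : FiniteEnergy μ l) (h' : FiniteEnergy ν l) (c d : NNReal) :
    mutualEnergy (c • μ + d • ν) l = c * mutualEnergy μ l + d * mutualEnergy ν l := by
  rw [(h.smul_left c).mutualEnergy_add_left (h'.smul_left d), mutualEnergy_smul_left,
    mutualEnergy_smul_left]

lemma FiniteEnergy.mutualEnergy_mix_self [IsFiniteMeasure μ] [IsFiniteMeasure ν]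
    (h : FiniteEnergy μ μ) (h' : FiniteEnergy ν ν) (h'' : FiniteEnergy μ ν) (c d : NNReal) :
    FiniteEnergy (c • μ + d • ν) (c • μ + d • ν) ∧
    mutualEnergy (c • μ + d • ν) (c • μ + d • ν) = c ^ 2 * mutualEnergy μ μ +
      2 * c * d * mutualEnergy μ ν + d ^ 2 * mutualEnergy ν ν := by
  have h1 : FiniteEnergy (c • μ + d • ν) μ := (h.smul_left c).add_left (h''.symm.smul_left d)
  have h2 : FiniteEnergy (c • μ + d • ν) ν := (h''.smul_left c).add_left (h'.smul_left d)
  refine ⟨((h1.symm.smul_left c).add_left (h2.symm.smul_left d)), ?_⟩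
  rw [h1.symm.mutualEnergy_mix h2.symm, mutualEnergy_comm μ, mutualEnergy_comm ν,
    h.mutualEnergy_mix h''.symm, h''.mutualEnergy_mix h', mutualEnergy_comm ν μ]
  ring

/-- A finite energy pair of equal mass with nonpositive energy distance coincides. -/
lemma eq_of_energy_le [IsFiniteMeasure μ] [IsFiniteMeasure ν] (hm : μ univ = ν univ)
    (h : FiniteEnergy μ μ) (h' : FiniteEnergy ν ν) (h'' : FiniteEnergy μ ν)
    (hle : mutualEnergy μ μ + mutualEnergy ν ν - 2 * mutualEnergy μ ν ≤ 0) : μ = ν := by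
  have : ∀ i, IsFiniteMeasure ((![μ, ν] : Fin 2 → Measure ℝ) i) := by
    intro i; fin_cases i <;> assumption
  have key := sum_mutualEnergy_nonneg (![μ, ν] : Fin 2 → Measure ℝ) ![1, -1] (by
    simp [Fin.sum_univ_two, measureReal_def, hm]) (by
    intro i j; fin_cases i <;> fin_cases j <;> simp [h, h', h'', h''.symm])
  simp only [Fin.sum_univ_two, Matrix.cons_val_zero, Matrix.cons_val_one] at key
  have h3 := mutualEnergy_comm μ ν
  refine Measure.ext_of_charFun (funext fun ξ => ?_)
  have := key.2 (by linarith [key.1]) ξ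
  push_cast at this
  linear_combination this

end

section

/-! ### The arcsine law -/

/-- The uniform probability measure on the angles between `0` and `π`. -/
def angle : Measure ℝ := ENNReal.ofReal Real.pi⁻¹ • volume.restrict (Ioo 0 Real.pi)

instance : IsProbabilityMeasure angle := by
  constructor
  rw [angle, Measure.smul_apply, Measure.restrict_apply_univ, Real.volume_Ioo, sub_zero,
    smul_eq_mul, ← ENNReal.ofReal_mul (by positivity), inv_mul_cancel₀ Real.pi_ne_zero,
    ENNReal.ofReal_one]

lemma ae_angle_mem : ∀ᵐ θ ∂angle, θ ∈ Ioo 0 Real.pi :=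
  Measure.ae_smul_measure (ae_restrict_mem measurableSet_Ioo) _

lemma integral_angle (f : ℝ → ℝ) : ∫ θ, f θ ∂angle = Real.pi⁻¹ * ∫ θ in 0..Real.pi, f θ := by
  rw [angle, integral_smul_measure, intervalIntegral.integral_of_le Real.pi_pos.le,
    integral_Ioc_eq_integral_Ioo, ENNReal.toReal_ofReal (by positivity), smul_eq_mul]

lemma integrable_angle {f : ℝ → ℝ} (hf : IntervalIntegrable f volume 0 Real.pi) :
    Integrable f angle := by
  refine Integrable.smul_measure ?_ ENNReal.ofReal_ne_top
  rw [← IntegrableOn, ← integrableOn_Ioc_iff_integrableOn_Ioo]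
  exact (intervalIntegrable_iff_integrableOn_Ioc_of_le Real.pi_pos.le).1 hf

lemma integral_comp_cos_two_pi {g : ℝ → ℝ}
    (hg : IntervalIntegrable (fun θ => g (Real.cos θ)) volume 0 (2 * Real.pi)) :
    ∫ θ in 0..2 * Real.pi, g (Real.cos θ) = 2 * ∫ θ in 0..Real.pi, g (Real.cos θ) := by
  have hp := Real.pi_pos
  have h1 : ∫ θ in Real.pi..2 * Real.pi, g (Real.cos θ) = ∫ θ in 0..Real.pi, g (Real.cos θ) := by
    have := intervalIntegral.integral_comp_sub_left (a := 0) (b := Real.pi)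
      (fun θ => g (Real.cos θ)) (2 * Real.pi)
    rw [sub_zero, show 2 * Real.pi - Real.pi = Real.pi by ring] at this
    rw [← this]
    simp [Real.cos_two_pi_sub]
  rw [← intervalIntegral.integral_add_adjacent_intervals (b := Real.pi), h1]
  · ring
  · exact hg.mono_set (by rw [uIcc_of_le hp.le, uIcc_of_le (by linarith)]
                          exact Icc_subset_Icc le_rfl (by linarith))
  · exact hg.mono_set (by rw [uIcc_of_le (by linarith), uIcc_of_le (by linarith)]
                          exact Icc_subset_Icc hp.le le_rfl)

lemma intervalIntegrable_log_sub_cos (x r u v : ℝ) :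
    IntervalIntegrable (fun θ => Real.log |x - r * Real.cos θ|) volume u v := by
  simp_rw [Real.log_abs]
  have : MeromorphicOn (fun θ : ℝ => x - r * Real.cos θ) (uIcc u v) := fun θ _ =>
    (by fun_prop : AnalyticAt ℝ (fun θ : ℝ => x - r * Real.cos θ) θ).meromorphicAt
  exact this.intervalIntegrable_log

lemma integrable_log_sub_cos (x r : ℝ) :
    Integrable (fun θ => Real.log |x - r * Real.cos θ|) angle :=
  integrable_angle (intervalIntegrable_log_sub_cos x r _ _)

/-- With `z = e^{iθ}` one has `r(z - α)(z - β) = 2(r cos θ - x) z`, and by Jensen's formula the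
circle mean of `log |z - γ|` is `log⁺ |γ|`. -/
lemma integral_log_sub_cos_of_roots {x r : ℝ} (hr : 0 < r) {α β : ℂ} (hs : r * (α + β) = 2 * x)
    (hp : α * β = 1) : ∫ θ, Real.log |x - r * Real.cos θ| ∂angle =
      Real.log (r / 2) + Real.posLog ‖α‖ + Real.posLog ‖β‖ := by
  have h2 := integral_comp_cos_two_pi (g := fun y => Real.log |x - r * y|)
    (intervalIntegrable_log_sub_cos x r 0 (2 * Real.pi))
  have hpi := Real.pi_pos
  have hnorm : ∀ θ : ℝ, |x - r * Real.cos θ| =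
      r / 2 * (‖circleMap 0 1 θ - α‖ * ‖circleMap 0 1 θ - β‖) := by
    intro θ
    set z := circleMap 0 1 θ with hz
    have hz1 : ‖z‖ = 1 := by simp [hz]
    have hcos : z ^ 2 + 1 = 2 * (Real.cos θ : ℂ) * z := by
      have hz' : z = Real.cos θ + Real.sin θ * Complex.I := by
        rw [hz, circleMap_zero, Complex.ofReal_one, one_mul, Complex.exp_mul_I]
        push_cast; rfl
      have hsc : (Real.cos θ : ℂ) ^ 2 + (Real.sin θ : ℂ) ^ 2 = 1 := by
        exact_mod_cast Real.cos_sq_add_sin_sq θ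
      rw [hz']
      linear_combination (Real.sin θ : ℂ) ^ 2 * Complex.I_sq - hsc
    have : (r : ℂ) * ((z - α) * (z - β)) = ((2 * (r * Real.cos θ - x) : ℝ) : ℂ) * z := by
      simp only [Complex.ofReal_mul, Complex.ofReal_sub, Complex.ofReal_ofNat]
      linear_combination (r : ℂ) * hcos - z * hs + (r : ℂ) * hp
    have h3 := congrArg norm this
    rw [norm_mul, norm_mul, norm_mul, hz1, Complex.norm_real, Complex.norm_real, Real.norm_eq_abs,
      Real.norm_eq_abs, abs_of_pos hr, abs_mul, abs_sub_comm] at h3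
    rw [abs_of_pos two_pos] at h3
    linarith
  have hae : ∀ γ : ℂ, ∀ᵐ θ ∂(volume : Measure ℝ), circleMap 0 1 θ ≠ γ := by
    intro γ
    have := (Set.countable_singleton γ).preimage_circleMap (0 : ℂ) (one_ne_zero (α := ℝ))
    exact this.ae_notMem volume
  have hci : ∀ γ : ℂ, IntervalIntegrable (fun θ => Real.log ‖circleMap 0 1 θ - γ‖) volume 0
      (2 * Real.pi) := fun γ => circleIntegrable_log_norm_sub_const (c := 0) (a := γ) 1
  have hav : ∀ γ : ℂ, ∫ θ in 0..2 * Real.pi, Real.log ‖circleMap 0 1 θ - γ‖ =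
      2 * Real.pi * Real.posLog ‖γ‖ := by
    intro γ
    have := circleAverage_log_norm_sub_const_eq_posLog (a := γ)
    rw [Real.circleAverage_def, smul_eq_mul] at this
    rw [← this]; field_simp
  have h4 : ∫ θ in 0..2 * Real.pi, Real.log |x - r * Real.cos θ| =
      ∫ θ in 0..2 * Real.pi, (Real.log (r / 2) + (Real.log ‖circleMap 0 1 θ - α‖ +
        Real.log ‖circleMap 0 1 θ - β‖)) := by
    refine intervalIntegral.integral_congr_ae ?_
    filter_upwards [hae α, hae β] with θ h1 h2 _
    rw [hnorm, Real.log_mul (by positivity), Real.log_mul]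
    · exact norm_ne_zero_iff.2 (sub_ne_zero.2 h1)
    · exact norm_ne_zero_iff.2 (sub_ne_zero.2 h2)
    · exact mul_ne_zero (norm_ne_zero_iff.2 (sub_ne_zero.2 h1))
        (norm_ne_zero_iff.2 (sub_ne_zero.2 h2))
  rw [intervalIntegral.integral_add (by simp) ((hci α).add (hci β)),
    intervalIntegral.integral_add (hci α) (hci β), hav, hav,
    intervalIntegral.integral_const] at h4
  rw [integral_angle, show ∫ θ in 0..Real.pi, Real.log |x - r * Real.cos θ| =
    2⁻¹ * ∫ θ in 0..2 * Real.pi, Real.log |x - r * Real.cos θ| by rw [h2]; ring, h4]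
  simp only [smul_eq_mul]
  field_simp
  ring

/-- The value of the mean of `log |x - r cos θ|`. -/
def arcLog (x r : ℝ) : ℝ := Real.log ((max |x| |r| + √(x ^ 2 - r ^ 2)) / 2)

/-- For `x ≤ r` the roots are conjugate on the unit circle and contribute nothing; for `x ≥ r` they
are real and reciprocal, and only the larger one contributes. -/
lemma integral_log_sub_cos_of_nonneg {x r : ℝ} (hx : 0 ≤ x) (hr : 0 < r) :
    ∫ θ, Real.log |x - r * Real.cos θ| ∂angle = arcLog x r := by
  rw [arcLog, abs_of_nonneg hx, abs_of_pos hr]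
  rcases le_total x r with h | h
  · have hs : 0 ≤ r ^ 2 - x ^ 2 := by nlinarith
    set s := √(r ^ 2 - x ^ 2)
    have hs2 : s ^ 2 = r ^ 2 - x ^ 2 := Real.sq_sqrt hs
    have hr' : (r : ℂ) ≠ 0 := by exact_mod_cast hr.ne'
    have hs2' : (s : ℂ) ^ 2 = r ^ 2 - x ^ 2 := by exact_mod_cast hs2
    have hn : ∀ e : ℝ, e ^ 2 = 1 → ‖(x + (e * s : ℝ) * Complex.I) / (r : ℂ)‖ = 1 := by
      intro e he
      rw [norm_div, Complex.norm_real, Complex.norm_add_mul_I, Real.norm_eq_abs, abs_of_pos hr,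
        show x ^ 2 + (e * s) ^ 2 = r ^ 2 by rw [mul_pow, he, hs2]; ring, Real.sqrt_sq hr.le,
        div_self hr.ne']
    rw [integral_log_sub_cos_of_roots hr (α := (x + (1 * s : ℝ) * Complex.I) / r)
      (β := (x + ((-1) * s : ℝ) * Complex.I) / r), hn 1 (by norm_num), hn (-1) (by norm_num),
      max_eq_right h, Real.sqrt_eq_zero_of_nonpos (by linarith)]
    · simp
    · push_cast; field_simp; ring
    · push_cast
      field_simp
      linear_combination -(s : ℂ) ^ 2 * Complex.I_sq + hs2'
  · have hs : 0 ≤ x ^ 2 - r ^ 2 := by nlinarith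
    set s := √(x ^ 2 - r ^ 2)
    have hs0 : 0 ≤ s := Real.sqrt_nonneg _
    have hs2 : s ^ 2 = x ^ 2 - r ^ 2 := Real.sq_sqrt hs
    have hr' : (r : ℂ) ≠ 0 := by exact_mod_cast hr.ne'
    have hs2' : (s : ℂ) ^ 2 = x ^ 2 - r ^ 2 := by exact_mod_cast hs2
    have hsx : s ≤ x := by nlinarith
    rw [integral_log_sub_cos_of_roots hr (α := (((x + s) / r : ℝ) : ℂ))
      (β := (((x - s) / r : ℝ) : ℂ)), max_eq_left h]
    · rw [Complex.norm_real, Complex.norm_real, Real.norm_eq_abs, Real.norm_eq_abs,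
        abs_of_nonneg (div_nonneg (by linarith) hr.le),
        abs_of_nonneg (div_nonneg (by linarith) hr.le)]
      rw [Real.posLog_eq_log, (Real.posLog_eq_zero_iff _).2, add_zero, ← Real.log_mul]
      · congr 1; field_simp
      · positivity
      · have : 0 < x + s := by linarith
        positivity
      · rw [abs_of_nonneg (div_nonneg (by linarith) hr.le), div_le_one hr]
        nlinarith
      · rw [abs_of_nonneg (div_nonneg (by linarith) hr.le), le_div_iff₀ hr]
        linarith
    · push_cast; field_simp; ring
    · push_cast
      field_simp
      linear_combination - hs2'

lemma integral_angle_reflect (f : ℝ → ℝ) :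
    ∫ θ, f (Real.cos θ) ∂angle = ∫ θ, f (-Real.cos θ) ∂angle := by
  rw [integral_angle, integral_angle]
  have := intervalIntegral.integral_comp_sub_left (a := 0) (b := Real.pi)
      (fun θ => f (Real.cos θ)) Real.pi
  simp only [Real.cos_pi_sub, sub_zero, sub_self] at this
  rw [this]

/-- The logarithmic potential of the arcsine law. -/
lemma integral_log_sub_cos (x r : ℝ) :
    ∫ θ, Real.log |x - r * Real.cos θ| ∂angle = arcLog x r := by
  have h1 : ∀ x r : ℝ, 0 ≤ x → ∫ θ, Real.log |x - r * Real.cos θ| ∂angle = arcLog x r := by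
    intro x r hx
    rcases lt_trichotomy r 0 with hr | rfl | hr
    · rw [integral_angle_reflect (fun c => Real.log |x - r * c|)]
      have := integral_log_sub_cos_of_nonneg hx (neg_pos.2 hr)
      simp only [arcLog, abs_neg, neg_sq] at this ⊢
      rw [← this]
      simp
    · simp [arcLog, Real.sqrt_sq_eq_abs]
    · exact integral_log_sub_cos_of_nonneg hx hr
  rcases le_total 0 x with hx | hx
  · exact h1 x r hx
  · have := h1 (-x) (-r) (by linarith)
    simp only [arcLog, abs_neg, neg_sq] at this ⊢
    rw [← this]
    refine integral_congr_ae (ae_of_all _ fun θ => ?_)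
    simp only
    rw [← abs_neg]; congr 2; ring

end

section

/-! ### The potential of the semicircle law: radial integrals -/

/-- The excess of the arcsine potential of radius `√w` over its value on the support. -/
def arcExcess (x w : ℝ) : ℝ := arcLog x (√w) - (Real.log w / 2 - Real.log 2)

lemma arcExcess_of_ge {x w : ℝ} (hw : 0 < w) (h : x ^ 2 ≤ w) : arcExcess x w = 0 := by
  have h1 : |x| ≤ √w := Real.abs_le_sqrt h
  rw [arcExcess, arcLog, abs_of_nonneg (Real.sqrt_nonneg w), Real.sq_sqrt hw.le, max_eq_right h1,
    Real.sqrt_eq_zero_of_nonpos (x := x ^ 2 - w) (by linarith), add_zero, Real.log_div (Real.sqrt_pos.2 hw).ne'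
    two_ne_zero, Real.log_sqrt hw.le, sub_self]

lemma arcExcess_of_le {x w : ℝ} (hw : 0 < w) (h : w ≤ x ^ 2) :
    arcExcess x w = Real.log (|x| + √(x ^ 2 - w)) - Real.log w / 2 := by
  have h1 : √w ≤ |x| := by
    rw [← Real.sqrt_sq_eq_abs]; exact Real.sqrt_le_sqrt h
  have h2 : 0 < |x| := (Real.sqrt_pos.2 hw).trans_le h1
  rw [arcExcess, arcLog, abs_of_nonneg (Real.sqrt_nonneg w), Real.sq_sqrt hw.le, max_eq_left h1,
    Real.log_div (by positivity) two_ne_zero]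
  ring

lemma arcExcess_nonneg {x w : ℝ} (hw : 0 < w) : 0 ≤ arcExcess x w := by
  rcases le_total w (x ^ 2) with h | h
  · rw [arcExcess_of_le hw h, sub_nonneg, ← Real.log_sqrt hw.le]
    refine Real.log_le_log (Real.sqrt_pos.2 hw) ?_
    have h1 : √w ≤ |x| := by
      rw [← Real.sqrt_sq_eq_abs]; exact Real.sqrt_le_sqrt h
    linarith [Real.sqrt_nonneg (x ^ 2 - w)]
  · rw [arcExcess_of_ge hw h]

lemma hasDerivAt_arcExcess_primitive {x w : ℝ} (hw : 0 < w) (h : w < x ^ 2) :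
    HasDerivAt (fun w => w * Real.log (|x| + √(x ^ 2 - w)) - w * Real.log w / 2 -
      |x| * √(x ^ 2 - w)) (arcExcess x w) w := by
  have hpos : 0 < x ^ 2 - w := by linarith
  have hs : 0 < √(x ^ 2 - w) := Real.sqrt_pos.2 hpos
  have hs2 : √(x ^ 2 - w) ^ 2 = x ^ 2 - w := Real.sq_sqrt hpos.le
  have hA : 0 < |x| + √(x ^ 2 - w) := by positivity
  have h1 : HasDerivAt (fun w => x ^ 2 - w) (-1) w := (hasDerivAt_id w).const_sub _
  have h2 := h1.sqrt hpos.ne'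
  have h3 := (h2.const_add |x|).log hA.ne'
  have h4 := ((hasDerivAt_id w).mul h3).sub
    (((hasDerivAt_id w).mul (Real.hasDerivAt_log hw.ne')).div_const 2) |>.sub (h2.const_mul |x|)
  refine h4.congr_deriv ?_
  rw [arcExcess_of_le hw h.le]
  have hx : |x| ^ 2 = x ^ 2 := sq_abs x
  simp only [id]
  generalize √(x ^ 2 - w) = s at *
  have hw' : w = (|x| - s) * (|x| + s) := by linarith
  field_simp
  rw [show w = (|x| - s) * (|x| + s) from hw']
  ring

/-- The value is exactly `x²`: averaging arcsine laws uniformly in the squared radius therefore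
gives a quadratic potential on the support. -/
lemma integral_arcExcess_full (x : ℝ) :
    IntervalIntegrable (arcExcess x) volume 0 (x ^ 2) ∧ ∫ w in 0..x ^ 2, arcExcess x w = x ^ 2 := by
  have hx2 := sq_nonneg x
  have hcont : ContinuousOn (fun w => w * Real.log (|x| + √(x ^ 2 - w)) - w * Real.log w / 2 -
      |x| * √(x ^ 2 - w)) (Icc 0 (x ^ 2)) := by
    rcases eq_or_ne x 0 with rfl | hx
    · simp
    · have : ∀ w, |x| + √(x ^ 2 - w) ≠ 0 := fun w => by positivity
      refine ((continuous_id.mul (Continuous.log (by fun_prop) this)).sub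
        (Real.continuous_mul_log.div_const 2) |>.sub (by fun_prop)).continuousOn
  have hder : ∀ w ∈ Ioo 0 (x ^ 2), HasDerivAt (fun w => w * Real.log (|x| + √(x ^ 2 - w)) -
      w * Real.log w / 2 - |x| * √(x ^ 2 - w)) (arcExcess x w) w := fun w hw =>
    hasDerivAt_arcExcess_primitive hw.1 hw.2
  have hint : IntervalIntegrable (arcExcess x) volume 0 (x ^ 2) := by
    refine intervalIntegral.intervalIntegrable_deriv_of_nonneg (by rwa [uIcc_of_le hx2]) ?_ ?_
    · rwa [min_eq_left hx2, max_eq_right hx2]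
    · intro w hw
      rw [min_eq_left hx2] at hw
      exact arcExcess_nonneg hw.1
  refine ⟨hint, ?_⟩
  rw [intervalIntegral.integral_eq_sub_of_hasDerivAt_of_le hx2 hcont hder hint]
  simp only [sub_self, Real.sqrt_zero, add_zero, mul_zero, sub_zero, zero_mul, zero_div, zero_sub,
    sub_neg_eq_add, Real.log_abs, Real.log_pow, Real.sqrt_sq_eq_abs]
  push_cast
  rw [abs_mul_abs_self]
  ring

lemma intervalIntegrable_arcExcess (x : ℝ) {S : ℝ} (hS : 0 ≤ S) :
    IntervalIntegrable (arcExcess x) volume 0 S := by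
  have hx2 := sq_nonneg x
  have h := (integral_arcExcess_full x).1
  rcases le_total S (x ^ 2) with hs | hs
  · exact h.mono_set (by rw [uIcc_of_le hS, uIcc_of_le hx2]; exact Icc_subset_Icc le_rfl hs)
  · refine h.trans ((intervalIntegrable_const (c := (0 : ℝ))).congr fun w hw => ?_)
    rw [uIoc_of_le hs] at hw
    exact (arcExcess_of_ge (hx2.trans_lt hw.1) hw.1.le).symm

lemma integral_arcExcess_of_ge {x S : ℝ} (hS : x ^ 2 ≤ S) :
    ∫ w in 0..S, arcExcess x w = x ^ 2 := by
  have hx2 := sq_nonneg x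
  have h0 : ∫ w in x ^ 2..S, arcExcess x w = 0 := by
    rw [intervalIntegral.integral_congr_ae (g := fun _ => 0)]
    · simp
    · refine ae_of_all _ fun w hw => ?_
      rw [uIoc_of_le hS] at hw
      exact arcExcess_of_ge (hx2.trans_lt hw.1) hw.1.le
  have h1 := intervalIntegrable_arcExcess x (hx2.trans hS)
  have h2 := intervalIntegrable_arcExcess x hx2
  rw [← intervalIntegral.integral_add_adjacent_intervals h2 (h2.symm.trans h1), h0, add_zero,
    (integral_arcExcess_full x).2]

lemma integral_arcExcess_nonneg {x S : ℝ} (hS : 0 ≤ S) : 0 ≤ ∫ w in 0..S, arcExcess x w := by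
  rw [intervalIntegral.integral_of_le hS]
  exact setIntegral_nonneg measurableSet_Ioc fun w hw => arcExcess_nonneg hw.1

lemma integral_arcExcess_le {x S : ℝ} (hS : 0 ≤ S) : ∫ w in 0..S, arcExcess x w ≤ x ^ 2 := by
  have hx2 := sq_nonneg x
  rcases le_total S (x ^ 2) with hs | hs
  · have h1 := intervalIntegrable_arcExcess x hS
    have h2 := intervalIntegrable_arcExcess x hx2
    rw [← (integral_arcExcess_full x).2,
      ← intervalIntegral.integral_add_adjacent_intervals h1 (h1.symm.trans h2)]
    have : 0 ≤ ∫ w in S..x ^ 2, arcExcess x w := by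
      rw [intervalIntegral.integral_of_le hs]
      exact setIntegral_nonneg measurableSet_Ioc fun w hw => arcExcess_nonneg (hS.trans_lt hw.1)
    linarith
  · exact (integral_arcExcess_of_ge hs).le

/-- After rescaling `w` by `R²`, the value of the arcsine potential on its own support integrates to
the constant, and the excess gives the dependence on `x`. -/
lemma integral_arcLog {R : ℝ} (hR : 0 < R) (x : ℝ) :
    IntervalIntegrable (fun w => arcLog x (R * √w)) volume 0 1 ∧
    ∫ w in 0..1, arcLog x (R * √w) =
      Real.log R - 1 / 2 - Real.log 2 + (∫ w in 0..R ^ 2, arcExcess x w) / R ^ 2 := by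
  have hR2 : 0 < R ^ 2 := by positivity
  have hfun : ∀ w, arcLog x (R * √w) =
      Real.log (R ^ 2 * w) / 2 - Real.log 2 + arcExcess x (R ^ 2 * w) := by
    intro w
    rw [arcExcess, Real.sqrt_mul hR2.le, Real.sqrt_sq hR.le]
    ring
  simp_rw [hfun]
  have hi1 : IntervalIntegrable (fun w => Real.log w / 2 - Real.log 2) volume 0 (R ^ 2) :=
    (intervalIntegral.intervalIntegrable_log'.div_const 2).sub (by simp)
  have hi2 := intervalIntegrable_arcExcess x hR2.le
  have hi := hi1.add hi2
  constructor
  · have := hi.comp_mul_left (c := R ^ 2)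
    simpa [hR2.ne'] using this
  · rw [intervalIntegral.integral_comp_mul_left
      (fun w => Real.log w / 2 - Real.log 2 + arcExcess x w) hR2.ne', mul_zero, mul_one,
      intervalIntegral.integral_add hi1 hi2, intervalIntegral.integral_sub
        (intervalIntegral.intervalIntegrable_log'.div_const 2) (by simp),
      intervalIntegral.integral_div, integral_log_from_zero_of_pos hR2]
    simp only [intervalIntegral.integral_const, smul_eq_mul, Real.log_pow]
    push_cast
    field_simp
    ring

/-! ### The semicircle law -/

/-- The uniform probability measure on the unit interval. -/
def unitUniform : Measure ℝ := volume.restrict (Ioo 0 1)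

instance : IsProbabilityMeasure unitUniform := ⟨by simp [unitUniform]⟩

lemma integral_unitUniform (f : ℝ → ℝ) : ∫ w, f w ∂unitUniform = ∫ w in 0..1, f w := by
  rw [unitUniform, intervalIntegral.integral_of_le zero_le_one, integral_Ioc_eq_integral_Ioo]

lemma integrable_unitUniform {f : ℝ → ℝ} (hf : IntervalIntegrable f volume 0 1) :
    Integrable f unitUniform := by
  rw [unitUniform, ← IntegrableOn, ← integrableOn_Ioc_iff_integrableOn_Ioo]
  exact (intervalIntegrable_iff_integrableOn_Ioc_of_le zero_le_one).1 hf

/-- The semicircle law with center `m` and radius `R`, as a mixture of arcsine laws. -/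
def semicircle (m R : ℝ) : Measure ℝ :=
  (unitUniform.prod angle).map fun z => m + R * √z.1 * Real.cos z.2

lemma measurable_semicircleMap (m R : ℝ) :
    Measurable fun z : ℝ × ℝ => m + R * √z.1 * Real.cos z.2 := by fun_prop

instance (m R : ℝ) : IsProbabilityMeasure (semicircle m R) :=
  Measure.isProbabilityMeasure_map (measurable_semicircleMap m R).aemeasurable

lemma ae_unitUniform_mem : ∀ᵐ w ∂unitUniform, w ∈ Ioo (0 : ℝ) 1 :=
  ae_restrict_mem measurableSet_Ioo

lemma ae_prod_mem : ∀ᵐ z ∂(unitUniform.prod angle), z.1 ∈ Ioo (0 : ℝ) 1 ∧ z.2 ∈ Ioo 0 Real.pi := by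
  filter_upwards [Measure.quasiMeasurePreserving_fst.ae (ae_unitUniform_mem),
    Measure.quasiMeasurePreserving_snd.ae (ae_angle_mem)] with z h1 h2 using ⟨h1, h2⟩

lemma ae_semicircle_mem {R : ℝ} (hR : 0 < R) (m : ℝ) :
    ∀ᵐ u ∂(semicircle m R), u ∈ Icc (m - R) (m + R) := by
  rw [semicircle, ae_map_iff (p := (· ∈ Icc (m - R) (m + R)))
    (measurable_semicircleMap m R).aemeasurable measurableSet_Icc]
  filter_upwards [ae_prod_mem] with z hz
  have h0 := Real.sqrt_nonneg z.1
  have h1 : √z.1 ≤ 1 := Real.sqrt_le_one.2 hz.1.2.le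
  have h2 := Real.neg_one_le_cos z.2
  have h3 := Real.cos_le_one z.2
  have h4 : |√z.1 * Real.cos z.2| ≤ 1 := by
    rw [abs_mul, abs_of_nonneg h0]
    exact mul_le_one₀ h1 (abs_nonneg _) (abs_le.2 ⟨h2, h3⟩)
  obtain ⟨h5, h6⟩ := abs_le.1 h4
  constructor <;> nlinarith

/-- The bound is affine in `log |t|`, so the explicitly known mean of the logarithm also controls
the mean of its absolute value. -/
lemma abs_log_le {t B : ℝ} (ht : |t| ≤ B) :
    |Real.log (|t|)| ≤ 2 * Real.log (1 + B) - Real.log |t| := by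
  have hB : 0 ≤ B := (abs_nonneg t).trans ht
  have h0 : 0 ≤ Real.log (1 + B) := Real.log_nonneg (by linarith)
  rcases eq_or_ne t 0 with rfl | h
  · simp [h0]
  · have : Real.log |t| ≤ Real.log (1 + B) := Real.log_le_log (abs_pos.2 h) (by linarith)
    rw [abs_le]; constructor <;> linarith

lemma integrable_semicircle_log {R : ℝ} (hR : 0 < R) (m y : ℝ) :
    Integrable (fun z : ℝ × ℝ => Real.log |y - (m + R * √z.1 * Real.cos z.2)|)
      (unitUniform.prod angle) := by
  have hmeas : Measurable fun z : ℝ × ℝ => Real.log |y - (m + R * √z.1 * Real.cos z.2)| := by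
    fun_prop
  have hre : ∀ w θ : ℝ, y - (m + R * √w * Real.cos θ) = (y - m) - R * √w * Real.cos θ := by
    intros; ring
  rw [integrable_prod_iff hmeas.aestronglyMeasurable]
  constructor
  · refine ae_of_all _ fun w => ?_
    simp_rw [hre]
    exact integrable_log_sub_cos _ _
  · refine Integrable.mono' (g := fun w => 2 * Real.log (1 + (|y - m| + R)) -
      arcLog (y - m) (R * √w))
      ((integrable_const _).sub (integrable_unitUniform (integral_arcLog hR (y - m)).1))
      hmeas.aestronglyMeasurable.norm.integral_prod_right' ?_
    filter_upwards [ae_unitUniform_mem] with w hw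
    rw [Real.norm_eq_abs, abs_of_nonneg (integral_nonneg fun θ => norm_nonneg _)]
    simp_rw [hre]
    have hi := integrable_log_sub_cos (y - m) (R * √w)
    calc ∫ θ, ‖Real.log |y - m - R * √w * Real.cos θ|‖ ∂angle
        ≤ ∫ θ, (2 * Real.log (1 + (|y - m| + R)) - Real.log |y - m - R * √w * Real.cos θ|)
            ∂angle := by
          refine integral_mono hi.norm ((integrable_const _).sub hi) fun θ => ?_
          refine abs_log_le ((abs_sub _ _).trans (add_le_add le_rfl ?_))
          have h1 : √w ≤ 1 := Real.sqrt_le_one.2 hw.2.le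
          rw [abs_mul, abs_mul, abs_of_pos hR, abs_of_nonneg (Real.sqrt_nonneg w)]
          have h2 := Real.abs_cos_le_one θ
          have h3 := abs_nonneg (Real.cos θ)
          have h4 := Real.sqrt_nonneg w
          have h5 : √w * |Real.cos θ| ≤ 1 := mul_le_one₀ h1 h3 h2
          nlinarith
      _ = _ := by
          rw [integral_sub (integrable_const _) hi, integral_log_sub_cos]
          simp

lemma potential_semicircle {R : ℝ} (hR : 0 < R) (m y : ℝ) :
    potential (semicircle m R) y = -(Real.log R - 1 / 2 - Real.log 2 +
      (∫ w in 0..R ^ 2, arcExcess (y - m) w) / R ^ 2) := by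
  rw [potential, semicircle, integral_map (measurable_semicircleMap m R).aemeasurable
    (measurable_logKernel_left y).aestronglyMeasurable, integral_neg,
    integral_prod _ (integrable_semicircle_log hR m y), ← (integral_arcLog hR (y - m)).2,
    ← integral_unitUniform]
  congr 1
  refine integral_congr_ae (ae_of_all _ fun w => ?_)
  simp only
  rw [← integral_log_sub_cos]
  refine integral_congr_ae (ae_of_all _ fun θ => ?_)
  simp only
  congr 2; ring

/-- The Robin type constant of the semicircle law. -/
def semicircleConst (R : ℝ) : ℝ := 2 * Real.log 2 + 1 - 2 * Real.log R

/-- Euler–Lagrange inequality of the semicircle in its quadratic field. It holds on the whole line,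
because the truncated integral of the excess never exceeds the full one. -/
lemma semicircleConst_le {R : ℝ} (hR : 0 < R) (m y : ℝ) :
    semicircleConst R ≤ 2 * potential (semicircle m R) y + 2 * (y - m) ^ 2 / R ^ 2 := by
  have h := integral_arcExcess_le (x := y - m) (sq_nonneg R)
  have h' := div_le_div_of_nonneg_right h (sq_nonneg R)
  rw [potential_semicircle hR, semicircleConst, mul_div_assoc]
  linarith

lemma semicircleConst_eq {R : ℝ} (hR : 0 < R) {m y : ℝ} (hy : y ∈ Icc (m - R) (m + R)) :
    2 * potential (semicircle m R) y + 2 * (y - m) ^ 2 / R ^ 2 = semicircleConst R := by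
  have h := integral_arcExcess_of_ge (x := y - m) (S := R ^ 2)
    (sq_le_sq' (by linarith [hy.1]) (by linarith [hy.2]))
  rw [potential_semicircle hR, semicircleConst, mul_div_assoc, h]
  ring

lemma potential_semicircle_le {R : ℝ} (hR : 0 < R) (m y : ℝ) :
    potential (semicircle m R) y ≤ Real.log 2 + 1 / 2 - Real.log R := by
  have h := integral_arcExcess_nonneg (x := y - m) (sq_nonneg R)
  have h' := div_nonneg h (sq_nonneg R)
  rw [potential_semicircle hR]
  linarith

lemma logMoment_of_ae_bounded {μ : Measure ℝ} [IsFiniteMeasure μ] {B : ℝ}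
    (h : ∀ᵐ y ∂μ, |y| ≤ B) : LogMoment μ := by
  refine Integrable.of_bound (C := Real.log (1 + B))
    (by fun_prop : Measurable fun y : ℝ => Real.log (1 + |y|)).aestronglyMeasurable ?_
  filter_upwards [h] with y hy
  rw [Real.norm_eq_abs, abs_of_nonneg (log_one_add_abs_nonneg y)]
  exact Real.log_le_log (by positivity) (by linarith)

lemma logMoment_semicircle {R : ℝ} (hR : 0 < R) (m : ℝ) : LogMoment (semicircle m R) := by
  refine logMoment_of_ae_bounded (B := |m| + R) ?_
  filter_upwards [ae_semicircle_mem hR m] with u hu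
  have := neg_abs_le m
  have := le_abs_self m
  rw [abs_le]; constructor <;> linarith [hu.1, hu.2]

lemma integrable_log_semicircle {R : ℝ} (hR : 0 < R) (m y : ℝ) :
    Integrable (fun u => -Real.log |y - u|) (semicircle m R) := by
  rw [semicircle, integrable_map_measure (measurable_logKernel_left y).aestronglyMeasurable
    (measurable_semicircleMap m R).aemeasurable]
  exact (integrable_semicircle_log hR m y).neg

lemma semicircle_singleton {R : ℝ} (hR : 0 < R) (m y : ℝ) : semicircle m R {y} = 0 := by
  rw [semicircle, Measure.map_apply (measurable_semicircleMap m R) (measurableSet_singleton y),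
    Measure.measure_prod_null ((measurable_semicircleMap m R) (measurableSet_singleton y))]
  filter_upwards [ae_unitUniform_mem] with w hw
  have hr : 0 < R * √w := mul_pos hR (Real.sqrt_pos.2 hw.1)
  have hsub : (Ioo 0 Real.pi ∩ Prod.mk w ⁻¹'
      ((fun z : ℝ × ℝ => m + R * √z.1 * Real.cos z.2) ⁻¹' {y})).Subsingleton := by
    intro θ hθ θ' hθ'
    have h1 : m + R * √w * Real.cos θ = y := hθ.2
    have h2 : m + R * √w * Real.cos θ' = y := hθ'.2
    have h3 : Real.cos θ = Real.cos θ' := mul_left_cancel₀ hr.ne' (by linarith)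
    exact Real.injOn_cos (Ioo_subset_Icc_self hθ.1) (Ioo_subset_Icc_self hθ'.1) h3
  rw [angle, Measure.smul_apply, Measure.restrict_apply' measurableSet_Ioo, inter_comm,
    hsub.measure_zero]
  simp

lemma logRegular_semicircle {R : ℝ} (hR : 0 < R) (m : ℝ) : LogRegular (semicircle m R) where
  noAtoms := ⟨fun y => semicircle_singleton hR m y⟩
  bound := by
    refine ⟨(2 * Real.log (1 + (2 * R + 1)) + (Real.log 2 + 1 / 2 - Real.log R)).toNNReal,
      fun y => ?_⟩
    -- Near the support the kernel plus a constant is nonnegative, so the bound on the potential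
    -- bounds its positive part. Farther away all distances are at least `1` and the positive part
    -- vanishes.
    rcases le_or_gt |y - m| (R + 1) with h | h
    · have hi := integrable_log_semicircle hR m y
      have hB : ∀ᵐ u ∂(semicircle m R), |y - u| ≤ 2 * R + 1 := by
        filter_upwards [ae_semicircle_mem hR m] with u hu
        obtain ⟨h1, h2⟩ := abs_le.1 h
        rw [abs_le]; constructor <;> linarith [hu.1, hu.2]
      calc ∫⁻ u, ENNReal.ofReal (-Real.log |y - u|) ∂(semicircle m R)
          ≤ ∫⁻ u, ENNReal.ofReal (2 * Real.log (1 + (2 * R + 1)) - Real.log |y - u|)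
            ∂(semicircle m R) := by
            refine lintegral_mono fun u => ENNReal.ofReal_le_ofReal ?_
            have : 0 ≤ Real.log (1 + (2 * R + 1)) := Real.log_nonneg (by linarith)
            linarith
        _ = ENNReal.ofReal (∫ u, (2 * Real.log (1 + (2 * R + 1)) + -Real.log |y - u|)
            ∂(semicircle m R)) := by
            rw [ofReal_integral_eq_lintegral_ofReal (f := fun u =>
              2 * Real.log (1 + (2 * R + 1)) + -Real.log |y - u|) ((integrable_const _).add hi)]
            · rfl
            · filter_upwards [hB] with u hu
              have := abs_log_le hu
              have h3 := abs_nonneg (Real.log (|y - u|))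
              change 0 ≤ _
              linarith
        _ ≤ _ := by
            rw [integral_add (integrable_const _) hi, integral_const]
            simp only [probReal_univ, one_smul]
            have hp := potential_semicircle_le hR m y
            rw [potential] at hp
            exact ENNReal.ofReal_le_ofReal (by linarith)
    · rw [lintegral_congr_ae (g := fun _ => 0)]
      · simp
      · filter_upwards [ae_semicircle_mem hR m] with u hu
        refine ENNReal.ofReal_of_nonpos (neg_nonpos.2 (Real.log_nonneg ?_))
        rw [le_abs]
        rcases lt_abs.1 h with h | h
        · left; linarith [hu.2]
        · right; linarith [hu.1]

end

section

/-! ### Support and reciprocal moment of the semicircle law -/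

lemma semicircle_pos_of_isOpen {m R x : ℝ} (hR : 0 < R) (hx : x ∈ Ioo (m - R) (m + R)) {U : Set ℝ}
    (hU : IsOpen U) (hxU : x ∈ U) : 0 < semicircle m R U := by
  have hx1 : |x - m| < R := abs_lt.2 ⟨by linarith [hx.1], by linarith [hx.2]⟩
  set r := |x - m| / R with hr
  have hr0 : 0 ≤ r := by positivity
  have hr1 : r < 1 := (div_lt_one hR).2 hx1
  -- Any `v` strictly between `r` and `1` gives a radius `R v` whose arcsine law has `x` in the
  -- interior of its interval; the midpoint stays positive even when `x = m`.
  set v := (1 + r) / 2 with hv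
  have hv0 : 0 < v := by positivity
  have hc : |(x - m) / (R * v)| < 1 := by
    rw [abs_div, abs_of_pos (mul_pos hR hv0), div_lt_one (mul_pos hR hv0)]
    have : |x - m| = r * R := by rw [hr]; field_simp
    rw [this]; nlinarith
  obtain ⟨hc1, hc2⟩ := abs_lt.1 hc
  set θ := Real.arccos ((x - m) / (R * v))
  have hθ : θ ∈ Ioo 0 Real.pi := ⟨Real.arccos_pos.2 hc2, Real.arccos_lt_pi.2 hc1⟩
  have hcos : Real.cos θ = (x - m) / (R * v) := Real.cos_arccos hc1.le hc2.le
  have hcont : Continuous fun z : ℝ × ℝ => m + R * √z.1 * Real.cos z.2 := by fun_prop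
  have hmem : (v ^ 2, θ) ∈ (fun z : ℝ × ℝ => m + R * √z.1 * Real.cos z.2) ⁻¹' U := by
    change m + R * √(v ^ 2) * Real.cos θ ∈ U
    rw [Real.sqrt_sq hv0.le, hcos, mul_div_cancel₀ _ (mul_pos hR hv0).ne', add_sub_cancel]
    exact hxU
  obtain ⟨A, B, hA, hB, hvA, hθB, hsub⟩ := isOpen_prod_iff.1 (hU.preimage hcont) _ _ hmem
  have hA' : 0 < unitUniform A := by
    rw [unitUniform, Measure.restrict_apply' measurableSet_Ioo]
    exact (hA.inter isOpen_Ioo).measure_pos volume ⟨v ^ 2, hvA, by positivity, by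
      rw [sq_lt_one_iff₀ hv0.le]; linarith⟩
  have hB' : 0 < angle B := by
    rw [angle, Measure.smul_apply, Measure.restrict_apply' measurableSet_Ioo, smul_eq_mul]
    exact ENNReal.mul_pos (ENNReal.ofReal_pos.2 (by positivity)).ne'
      ((hB.inter isOpen_Ioo).measure_pos volume ⟨θ, hθB, hθ⟩).ne'
  rw [semicircle, Measure.map_apply (measurable_semicircleMap m R) hU.measurableSet]
  refine (ENNReal.mul_pos hA'.ne' hB'.ne').trans_le ?_
  rw [← Measure.prod_prod]
  exact measure_mono hsub

/-- With `β = r/(m + s)`, where `s = √(m² - r²)`, the Poisson kernel of the unit disc at `-β` equals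
`s/(m + r cos θ)` on the circle, and a Poisson kernel has mean one. -/
lemma integral_inv_sub_cos {m r : ℝ} (hr : 0 ≤ r) (hm : r < m) :
    ∫ θ, (m + r * Real.cos θ)⁻¹ ∂angle = (√(m ^ 2 - r ^ 2))⁻¹ := by
  have hm0 : 0 < m := hr.trans_lt hm
  have hpos : 0 < m ^ 2 - r ^ 2 := by nlinarith
  set s := √(m ^ 2 - r ^ 2)
  have hs : 0 < s := Real.sqrt_pos.2 hpos
  have hs2 : s ^ 2 = m ^ 2 - r ^ 2 := Real.sq_sqrt hpos.le
  have hden : ∀ θ, 0 < m + r * Real.cos θ := fun θ => by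
    nlinarith [Real.neg_one_le_cos θ]
  set β := r / (m + s) with hβ
  have hβ0 : 0 ≤ β := by positivity
  have hβ1 : β < 1 := by rw [hβ, div_lt_one (by positivity)]; linarith
  have h := DiffContOnCl.circleAverage_poissonKernel_smul' (f := fun _ : ℂ => (1 : ℂ)) (c := 0)
    (R := 1) (w := ((-β : ℝ) : ℂ)) diffContOnCl_const (by
      rw [Metric.mem_ball, dist_zero_right, Complex.norm_real, Real.norm_eq_abs, abs_neg,
        abs_of_nonneg hβ0]
      exact hβ1)
  have hk : ∀ θ : ℝ, (‖circleMap 0 1 θ - 0‖ ^ 2 - ‖((-β : ℝ) : ℂ) - 0‖ ^ 2) /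
      ‖circleMap 0 1 θ - 0 - (((-β : ℝ) : ℂ) - 0)‖ ^ 2 = s * (m + r * Real.cos θ)⁻¹ := by
    intro θ
    have h1 : ‖circleMap 0 1 θ - 0‖ = 1 := by simp
    have h2 : ‖((-β : ℝ) : ℂ) - 0‖ ^ 2 = β ^ 2 := by
      rw [sub_zero, Complex.norm_real, Real.norm_eq_abs, sq_abs, neg_sq]
    have h3 : ‖circleMap 0 1 θ - 0 - (((-β : ℝ) : ℂ) - 0)‖ ^ 2 =
        1 + 2 * β * Real.cos θ + β ^ 2 := by
      have : circleMap 0 1 θ - 0 - (((-β : ℝ) : ℂ) - 0) =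
          ((Real.cos θ + β : ℝ) : ℂ) + (Real.sin θ : ℝ) * Complex.I := by
        rw [circleMap_zero, Complex.ofReal_one, one_mul, Complex.exp_mul_I]
        push_cast; ring
      rw [this, Complex.norm_add_mul_I, Real.sq_sqrt (by positivity)]
      linear_combination Real.sin_sq_add_cos_sq θ
    rw [h1, h2, h3]
    have h4 : 0 < 1 + 2 * β * Real.cos θ + β ^ 2 := by
      have : 0 < (1 - β) ^ 2 := by nlinarith
      nlinarith [Real.neg_one_le_cos θ]
    have hne := (hden θ).ne'
    rw [div_eq_iff h4.ne']
    have hms : 0 < m + s := by positivity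
    have hr2 : r = β * (m + s) := by rw [hβ]; field_simp
    have hmb : m * (1 - β ^ 2) = s * (1 + β ^ 2) := by
      have : (m + s) * (m * (1 - β ^ 2) - s * (1 + β ^ 2)) = 0 := by
        have : r ^ 2 = β ^ 2 * (m + s) ^ 2 := by rw [hr2]; ring
        linear_combination this - hs2
      rcases mul_eq_zero.1 this with h | h
      · exact absurd h hms.ne'
      · linarith
    field_simp
    rw [hr2]
    linear_combination (1 + Real.cos θ * β) * hmb
  have hk' : Real.circleAverage (fun z => ((‖z - 0‖ ^ 2 - ‖((-β : ℝ) : ℂ) - 0‖ ^ 2) /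
      ‖z - 0 - (((-β : ℝ) : ℂ) - 0)‖ ^ 2) • (1 : ℂ)) 0 1 =
      (((2 * Real.pi)⁻¹ * ∫ θ in 0..2 * Real.pi, s * (m + r * Real.cos θ)⁻¹ : ℝ) : ℂ) := by
    rw [Real.circleAverage_def]
    simp_rw [hk]
    rw [intervalIntegral.integral_smul_const]
    simp
  rw [hk'] at h
  have h5 : (2 * Real.pi)⁻¹ * ∫ θ in 0..2 * Real.pi, s * (m + r * Real.cos θ)⁻¹ = 1 := by
    exact_mod_cast h
  have hcont : Continuous fun θ => (m + r * Real.cos θ)⁻¹ :=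
    Continuous.inv₀ (by fun_prop) fun θ => (hden θ).ne'
  rw [intervalIntegral.integral_const_mul,
    integral_comp_cos_two_pi (g := fun c => (m + r * c)⁻¹) (hcont.intervalIntegrable _ _)] at h5
  rw [integral_angle]
  refine eq_inv_of_mul_eq_one_left ?_
  rw [← h5]
  field_simp

lemma integral_inv_semicircle {m R : ℝ} (hR : 0 < R) (hm : R < m) :
    ∫ u, u⁻¹ ∂(semicircle m R) = 2 / R ^ 2 * (m - √(m ^ 2 - R ^ 2)) := by
  have hm0 : 0 < m := hR.trans hm
  have hmeas : Measurable fun u : ℝ => u⁻¹ := measurable_inv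
  have hae : ∀ᵐ z ∂(unitUniform.prod angle), m - R ≤ m + R * √z.1 * Real.cos z.2 := by
    have := ae_semicircle_mem hR m
    rw [semicircle] at this
    filter_upwards [ae_of_ae_map (measurable_semicircleMap m R).aemeasurable this] with z hz
      using hz.1
  have hint : Integrable (fun z : ℝ × ℝ => (m + R * √z.1 * Real.cos z.2)⁻¹)
      (unitUniform.prod angle) := by
    refine Integrable.of_bound (C := (m - R)⁻¹)
      (by fun_prop : Measurable fun z : ℝ × ℝ =>
        (m + R * √z.1 * Real.cos z.2)⁻¹).aestronglyMeasurable ?_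
    filter_upwards [hae] with z hz
    rw [Real.norm_eq_abs, abs_of_nonneg (inv_nonneg.2 (by linarith))]
    exact inv_anti₀ (by linarith) hz
  -- The arcsine law of radius `R√w` has reciprocal moment `(m² - R²w)^{-1/2}`, which is integrated
  -- explicitly in `w`.
  have hder : ∀ w ∈ Ioo (0 : ℝ) 1, HasDerivAt (fun w => -(2 / R ^ 2) * √(m ^ 2 - R ^ 2 * w))
      ((√(m ^ 2 - (R * √w) ^ 2))⁻¹) w := by
    intro w hw
    have hp : 0 < m ^ 2 - R ^ 2 * w := by
      have : R ^ 2 * w < R ^ 2 := by nlinarith [hw.2, sq_pos_of_pos hR]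
      nlinarith
    have h1 : HasDerivAt (fun w => m ^ 2 - R ^ 2 * w) (-(R ^ 2 * 1)) w :=
      ((hasDerivAt_id w).const_mul _).const_sub _
    refine ((h1.sqrt hp.ne').const_mul (-(2 / R ^ 2))).congr_deriv ?_
    rw [mul_pow, Real.sq_sqrt hw.1.le]
    have := (Real.sqrt_pos.2 hp).ne'
    field_simp
  have hcont : ContinuousOn (fun w => -(2 / R ^ 2) * √(m ^ 2 - R ^ 2 * w)) (Icc 0 1) := by
    fun_prop
  have hii : IntervalIntegrable (fun w => (√(m ^ 2 - (R * √w) ^ 2))⁻¹) volume 0 1 := by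
    refine intervalIntegral.intervalIntegrable_deriv_of_nonneg
      (by rwa [uIcc_of_le zero_le_one]) ?_ ?_
    · rwa [min_eq_left zero_le_one, max_eq_right zero_le_one]
    · intro w _; positivity
  have hin : ∫ w, ∫ θ, (m + R * √w * Real.cos θ)⁻¹ ∂angle ∂unitUniform =
      ∫ w, (√(m ^ 2 - (R * √w) ^ 2))⁻¹ ∂unitUniform := by
    refine integral_congr_ae ?_
    filter_upwards [ae_unitUniform_mem] with w hw
    refine integral_inv_sub_cos (by positivity) ?_
    have h1 : √w ≤ 1 := Real.sqrt_le_one.2 hw.2.le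
    nlinarith
  rw [semicircle, integral_map (measurable_semicircleMap m R).aemeasurable
    hmeas.aestronglyMeasurable, integral_prod _ hint, hin,
    integral_unitUniform, intervalIntegral.integral_eq_sub_of_hasDerivAt_of_le zero_le_one
    hcont hder hii]
  rw [mul_one, mul_zero, sub_zero, Real.sqrt_sq hm0.le]
  ring

end

section

/-! ### Regularity of the constraint measures -/

/-- Replacing both arguments by the smaller one adds the exponents to `-3/4`, which is still locally
integrable. Thus a Riesz singularity of order `1/4` can coincide with that of the constraint
density. -/
lemma rpow_mul_inv_sqrt_le {p q : ℝ} (hp : 0 ≤ p) (hq : 0 ≤ q) :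
    p ^ (-(1 / 4) : ℝ) * (1 / √q) ≤ p ^ (-(3 / 4) : ℝ) + q ^ (-(3 / 4) : ℝ) := by
  have h1 : 0 ≤ p ^ (-(3 / 4) : ℝ) := Real.rpow_nonneg hp _
  have h2 : 0 ≤ q ^ (-(3 / 4) : ℝ) := Real.rpow_nonneg hq _
  have hs : 1 / √q = q ^ (-(1 / 2) : ℝ) := by
    rw [Real.sqrt_eq_rpow, Real.rpow_neg hq, one_div]
  rcases hp.eq_or_lt with rfl | hp
  · rw [Real.zero_rpow (by norm_num), zero_mul]; positivity
  rcases hq.eq_or_lt with rfl | hq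
  · simp only [Real.sqrt_zero, div_zero, mul_zero]; positivity
  rw [hs]
  rcases le_total p q with h | h
  · calc p ^ (-(1 / 4) : ℝ) * q ^ (-(1 / 2) : ℝ)
        ≤ p ^ (-(1 / 4) : ℝ) * p ^ (-(1 / 2) : ℝ) :=
          mul_le_mul_of_nonneg_left (Real.rpow_le_rpow_of_nonpos hp h (by norm_num))
            (Real.rpow_nonneg hp.le _)
      _ = p ^ (-(3 / 4) : ℝ) := by rw [← Real.rpow_add hp]; norm_num
      _ ≤ _ := by linarith
  · calc p ^ (-(1 / 4) : ℝ) * q ^ (-(1 / 2) : ℝ)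
        ≤ q ^ (-(1 / 4) : ℝ) * q ^ (-(1 / 2) : ℝ) :=
          mul_le_mul_of_nonneg_right (Real.rpow_le_rpow_of_nonpos hq h (by norm_num))
            (Real.rpow_nonneg hq.le _)
      _ = q ^ (-(3 / 4) : ℝ) := by rw [← Real.rpow_add hq]; norm_num
      _ ≤ _ := by linarith

lemma neg_log_le_rpow {p : ℝ} (hp : 0 ≤ p) : -Real.log p ≤ 4 * p ^ (-(1 / 4) : ℝ) := by
  rcases hp.eq_or_lt with rfl | hp
  · simp [Real.zero_rpow]
  · have h1 : 0 < p ^ (-(1 / 4) : ℝ) := Real.rpow_pos_of_pos hp _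
    have h2 := Real.log_le_sub_one_of_pos h1
    rw [Real.log_rpow hp] at h2
    linarith

lemma lintegral_rpow_near_lt_top :
    ∫⁻ y in Ioo (-1 : ℝ) 1, ENNReal.ofReal (|y| ^ (-(3 / 4) : ℝ)) < ⊤ := by
  have h1 : IntervalIntegrable (fun y : ℝ => y ^ (-(3 / 4) : ℝ)) volume 0 1 :=
    intervalIntegral.intervalIntegrable_rpow' (by norm_num)
  have h2 : IntegrableOn (fun y : ℝ => |y| ^ (-(3 / 4) : ℝ)) (Ioc 0 1) := by
    rw [intervalIntegrable_iff_integrableOn_Ioc_of_le zero_le_one] at h1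
    refine h1.congr_fun (fun y hy => ?_) measurableSet_Ioc
    simp only
    rw [abs_of_pos hy.1]
  have h3 : IntegrableOn (fun y : ℝ => |y| ^ (-(3 / 4) : ℝ)) (Ico (-1) 0) := by
    have := h2.comp_neg
    simpa using this
  have h4 : IntegrableOn (fun y : ℝ => |y| ^ (-(3 / 4) : ℝ)) (Ioo (-1) 1) := by
    refine ((h3.union h2).union (integrableOn_singleton (x := (0 : ℝ)) (hx := by simp))).mono_set ?_
    intro y hy
    rcases lt_trichotomy y 0 with h | h | h
    · exact Or.inl (Or.inl ⟨hy.1.le, h⟩)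
    · exact Or.inr h
    · exact Or.inl (Or.inr ⟨h, hy.2.le⟩)
  have := h4.2
  rwa [hasFiniteIntegral_iff_ofReal (ae_of_all _ fun y => Real.rpow_nonneg (abs_nonneg y) _)] at this

/-- Uniform local bound for the Riesz potential of order `1/4` of a constraint measure. -/
lemma constraint_riesz_bound (c s : ℝ) : ∃ C : NNReal, ∀ x,
    ∫⁻ y in {y | |x - y| < 1}, ENNReal.ofReal (|x - y| ^ (-(1 / 4) : ℝ)) ∂(constraint c s) ≤ C := by
  set K := √c / (Real.pi * s)
  set M := ∫⁻ y in Ioo (-1 : ℝ) 1, ENNReal.ofReal (|y| ^ (-(3 / 4) : ℝ))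
  have hM : M < ⊤ := lintegral_rpow_near_lt_top
  have hset : ∀ x : ℝ, {y : ℝ | |x - y| < 1} = Ioo (x - 1) (x + 1) := by
    intro x; ext y; rw [mem_ofPred_eq, abs_lt]; constructor
    · rintro ⟨h1, h2⟩; constructor <;> linarith
    · rintro ⟨h1, h2⟩; constructor <;> linarith
  have h1 : ∀ x : ℝ, ∫⁻ y in Ioo (x - 1) (x + 1), ENNReal.ofReal (|x - y| ^ (-(3 / 4) : ℝ)) = M := by
    intro x
    have hmp := Measure.measurePreserving_sub_left (volume : Measure ℝ) x
    have := hmp.setLIntegral_comp_preimage (s := Ioo (-1 : ℝ) 1) measurableSet_Ioo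
      (f := fun y => ENNReal.ofReal (|y| ^ (-(3 / 4) : ℝ))) (by fun_prop)
    refine Eq.trans ?_ this
    congr 2
    ext y; simp only [mem_Ioo, mem_preimage]
    constructor <;> rintro ⟨h1, h2⟩ <;> constructor <;> linarith
  -- Outside `(-1, 1)` the integrand is at most `1`, and `2` is the length of the window.
  have h2 : ∀ x : ℝ, ∫⁻ y in Ioo (x - 1) (x + 1), ENNReal.ofReal (|y| ^ (-(3 / 4) : ℝ)) ≤
      M + 2 := by
    intro x
    calc ∫⁻ y in Ioo (x - 1) (x + 1), ENNReal.ofReal (|y| ^ (-(3 / 4) : ℝ))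
        ≤ ∫⁻ y in Ioo (x - 1) (x + 1), ((Ioo (-1 : ℝ) 1).indicator
            (fun y => ENNReal.ofReal (|y| ^ (-(3 / 4) : ℝ))) y + 1) := by
          refine lintegral_mono fun y => ?_
          by_cases hy : y ∈ Ioo (-1 : ℝ) 1
          · rw [indicator_of_mem hy]; exact le_self_add
          · rw [indicator_of_notMem hy, zero_add, ENNReal.ofReal_le_one]
            refine Real.rpow_le_one_of_one_le_of_nonpos ?_ (by norm_num)
            by_contra hlt
            exact hy (abs_lt.1 (not_le.1 hlt))
      _ ≤ M + 2 := by
          rw [lintegral_add_right _ measurable_const, setLIntegral_one, Real.volume_Ioo]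
          refine add_le_add ((setLIntegral_le_lintegral _ _).trans ?_) ?_
          · rw [lintegral_indicator measurableSet_Ioo]
          · rw [show x + 1 - (x - 1) = 2 by ring]; simp
  refine ⟨(ENNReal.ofReal K * (M + (M + 2))).toNNReal, fun x => ?_⟩
  rw [ENNReal.coe_toNNReal (ENNReal.mul_lt_top ENNReal.ofReal_lt_top (ENNReal.add_lt_top.2
    ⟨hM, ENNReal.add_lt_top.2 ⟨hM, ENNReal.ofNat_lt_top⟩⟩)).ne, hset x, constraint,
    restrict_withDensity measurableSet_Ioo, lintegral_withDensity_eq_lintegral_mul _ (by fun_prop)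
    (by fun_prop), Measure.restrict_restrict measurableSet_Ioo]
  calc ∫⁻ y in Ioo (x - 1) (x + 1) ∩ Iic 0, ((fun y => ENNReal.ofReal (K / √|y|)) *
          fun y => ENNReal.ofReal (|x - y| ^ (-(1 / 4) : ℝ))) y
      ≤ ∫⁻ y in Ioo (x - 1) (x + 1), ((fun y => ENNReal.ofReal (K / √|y|)) *
          fun y => ENNReal.ofReal (|x - y| ^ (-(1 / 4) : ℝ))) y :=
        lintegral_mono_set inter_subset_left
    _ ≤ ∫⁻ y in Ioo (x - 1) (x + 1), ENNReal.ofReal K * (ENNReal.ofReal (|x - y| ^ (-(3 / 4) : ℝ)) +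
          ENNReal.ofReal (|y| ^ (-(3 / 4) : ℝ))) := by
        refine lintegral_mono fun y => ?_
        have hx := Real.rpow_nonneg (abs_nonneg (x - y)) (-(3 / 4))
        have hy := Real.rpow_nonneg (abs_nonneg y) (-(3 / 4))
        rw [Pi.mul_apply, ← ENNReal.ofReal_add hx hy, div_eq_mul_one_div,
          ENNReal.ofReal_mul' (by positivity), mul_assoc, ← ENNReal.ofReal_mul (by positivity),
          mul_comm (1 / _)]
        gcongr
        exact rpow_mul_inv_sqrt_le (abs_nonneg _) (abs_nonneg _)
    _ ≤ _ := by
        rw [lintegral_const_mul _ (by fun_prop), lintegral_add_left (by fun_prop), h1]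
        gcongr
        exact h2 x

lemma noAtoms_constraint (c s : ℝ) : NullSingletonClass (constraint c s) := by
  rw [constraint]; infer_instance

lemma logRegular_constraint (c s : ℝ) : LogRegular (constraint c s) where
  noAtoms := noAtoms_constraint c s
  bound := by
    obtain ⟨C, hC⟩ := constraint_riesz_bound c s
    refine ⟨4 * C, fun x => ?_⟩
    have hm : MeasurableSet {y : ℝ | |x - y| < 1} :=
      measurableSet_lt (by fun_prop) measurable_const
    calc ∫⁻ y, ENNReal.ofReal (-Real.log |x - y|) ∂(constraint c s)
        ≤ ∫⁻ y, {y | |x - y| < 1}.indicator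
            (fun y => 4 * ENNReal.ofReal (|x - y| ^ (-(1 / 4) : ℝ))) y ∂(constraint c s) := by
          refine lintegral_mono fun y => ?_
          by_cases hy : |x - y| < 1
          · rw [indicator_of_mem (by exact hy), show (4 : ENNReal) = ENNReal.ofReal 4 by simp,
              ← ENNReal.ofReal_mul (by norm_num)]
            exact ENNReal.ofReal_le_ofReal (neg_log_le_rpow (abs_nonneg _))
          · rw [ENNReal.ofReal_of_nonpos (neg_nonpos.2 (Real.log_nonneg (not_lt.1 hy)))]
            exact zero_le
      _ ≤ _ := by
          rw [lintegral_indicator hm, lintegral_const_mul _ (by fun_prop), ENNReal.coe_mul]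
          exact mul_le_mul_right (hC x) 4

/-- A Hölder estimate of order `1/4` from `log z ≤ 4(z^{1/4} - 1)` and subadditivity of the fourth
root. Its weights are Riesz kernels with uniformly bounded potentials, so the potentials become
Hölder continuous. -/
lemma abs_log_sub_log_le {p q : ℝ} (hp : 0 < p) (hq : 0 < q) :
    |Real.log p - Real.log q| ≤
      4 * |p - q| ^ (1 / 4 : ℝ) * (p ^ (-(1 / 4) : ℝ) + q ^ (-(1 / 4) : ℝ)) := by
  have key : ∀ p q : ℝ, 0 < p → p ≤ q →
      Real.log q - Real.log p ≤ 4 * (q - p) ^ (1 / 4 : ℝ) * p ^ (-(1 / 4) : ℝ) := by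
    intro p q hp hpq
    have hq := hp.trans_le hpq
    have h0 : 0 ≤ q / p - 1 := by rw [sub_nonneg, one_le_div hp]; exact hpq
    have h1 : (q / p) ^ (1 / 4 : ℝ) ≤ (q / p - 1) ^ (1 / 4 : ℝ) + 1 := by
      have := Real.rpow_add_le_add_rpow h0 zero_le_one (p := 1 / 4) (by norm_num) (by norm_num)
      simpa using this
    have h2 := Real.log_le_sub_one_of_pos (Real.rpow_pos_of_pos (div_pos hq hp) (1 / 4 : ℝ))
    rw [Real.log_rpow (div_pos hq hp), Real.log_div hq.ne' hp.ne'] at h2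
    have h3 : (q / p - 1) ^ (1 / 4 : ℝ) = (q - p) ^ (1 / 4 : ℝ) * p ^ (-(1 / 4) : ℝ) := by
      rw [show q / p - 1 = (q - p) / p by field_simp, Real.div_rpow (by linarith) hp.le,
        Real.rpow_neg hp.le, div_eq_mul_inv]
    rw [h3] at h1
    nlinarith
  have hp4 := Real.rpow_nonneg hp.le (-(1 / 4))
  have hq4 := Real.rpow_nonneg hq.le (-(1 / 4))
  have ha := Real.rpow_nonneg (abs_nonneg (p - q)) (1 / 4)
  rcases le_total p q with h | h
  · have hl := Real.log_le_log hp h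
    have := key p q hp h
    rw [abs_sub_comm p q, abs_of_nonneg (sub_nonneg.2 h)] at *
    rw [abs_of_nonpos (by linarith)]
    nlinarith [mul_nonneg ha hq4]
  · have hl := Real.log_le_log hq h
    have := key q p hq h
    rw [abs_of_nonneg (sub_nonneg.2 h)] at *
    rw [abs_of_nonneg (by linarith)]
    nlinarith [mul_nonneg ha hp4]

lemma riesz_bound_of_le_constraint {c s : ℝ} {μ : Measure ℝ} [IsFiniteMeasure μ]
    (h : μ ≤ constraint c s) : ∃ C : ℝ, ∀ x,
      Integrable (fun y => |x - y| ^ (-(1 / 4) : ℝ)) μ ∧ ∫ y, |x - y| ^ (-(1 / 4) : ℝ) ∂μ ≤ C := by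
  obtain ⟨C, hC⟩ := constraint_riesz_bound c s
  have hb : ∀ x, ∫⁻ y, ENNReal.ofReal (|x - y| ^ (-(1 / 4) : ℝ)) ∂μ ≤ C + μ univ := by
    intro x
    have hm : MeasurableSet {y : ℝ | |x - y| < 1} :=
      measurableSet_lt (by fun_prop) measurable_const
    rw [← lintegral_add_compl _ hm]
    refine add_le_add ((lintegral_mono' (Measure.restrict_mono le_rfl h) le_rfl).trans (hC x)) ?_
    calc ∫⁻ y in {y | |x - y| < 1}ᶜ, ENNReal.ofReal (|x - y| ^ (-(1 / 4) : ℝ)) ∂μ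
        ≤ ∫⁻ y in {y | |x - y| < 1}ᶜ, 1 ∂μ := by
          refine setLIntegral_mono' hm.compl fun y hy => ?_
          rw [ENNReal.ofReal_le_one]
          exact Real.rpow_le_one_of_one_le_of_nonpos (not_lt.1 hy) (by norm_num)
      _ ≤ μ univ := by
          rw [setLIntegral_one]; exact measure_mono (subset_univ _)
  have hnn : ∀ x y : ℝ, 0 ≤ |x - y| ^ (-(1 / 4) : ℝ) := fun x y => Real.rpow_nonneg (abs_nonneg _) _
  have hmeas : ∀ x : ℝ, Measurable fun y : ℝ => |x - y| ^ (-(1 / 4) : ℝ) := fun x => by fun_prop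
  have htop : (C : ENNReal) + μ univ < ⊤ :=
    ENNReal.add_lt_top.2 ⟨ENNReal.coe_lt_top, measure_lt_top _ _⟩
  refine ⟨((C : ENNReal) + μ univ).toReal, fun x => ⟨⟨(hmeas x).aestronglyMeasurable, ?_⟩, ?_⟩⟩
  · rw [hasFiniteIntegral_iff_ofReal (ae_of_all _ (hnn x))]
    exact (hb x).trans_lt htop
  · rw [integral_eq_lintegral_of_nonneg_ae (ae_of_all _ (hnn x)) (hmeas x).aestronglyMeasurable]
    exact ENNReal.toReal_mono htop.ne (hb x)

/-- Potentials of measures dominated by a constraint are continuous. -/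
lemma continuous_potential_of_le_constraint {c s : ℝ} {μ : Measure ℝ} [IsFiniteMeasure μ]
    (h : μ ≤ constraint c s) (hm : LogMoment μ) : Continuous (potential μ) := by
  have hreg := (logRegular_constraint c s).mono h
  obtain ⟨C, hC⟩ := riesz_bound_of_le_constraint h
  have hna := hreg.noAtoms
  have hb : ∀ x x' : ℝ, |potential μ x - potential μ x'| ≤ 8 * C * |x - x'| ^ (1 / 4 : ℝ) := by
    intro x x'
    have hi := hreg.integrable_log hm
    rw [potential, potential, ← integral_sub (hi x) (hi x')]
    have hI := ((hC x).1.add (hC x').1).const_mul (4 * |x - x'| ^ (1 / 4 : ℝ))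
    refine (abs_integral_le_integral_abs).trans ((integral_mono_ae ((hi x).sub (hi x')).abs hI
      ?_).trans ?_)
    · have hne : ∀ z : ℝ, ∀ᵐ y ∂μ, y ≠ z := fun z => by
        rw [ae_iff]; simp
      filter_upwards [hne x, hne x'] with y h1 h2
      have hp : 0 < |x - y| := abs_pos.2 (sub_ne_zero.2 h1.symm)
      have hq : 0 < |x' - y| := abs_pos.2 (sub_ne_zero.2 h2.symm)
      have h3 := abs_log_sub_log_le hp hq
      have h4 : |(|x - y| - |x' - y|)| ≤ |x - x'| := by
        have := abs_abs_sub_abs_le_abs_sub (x - y) (x' - y)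
        rwa [sub_sub_sub_cancel_right] at this
      have h5 := Real.rpow_le_rpow (abs_nonneg _) h4 (by norm_num : (0 : ℝ) ≤ 1 / 4)
      have h6 := Real.rpow_nonneg hp.le (-(1 / 4))
      have h7 := Real.rpow_nonneg hq.le (-(1 / 4))
      calc |(-Real.log |x - y|) - (-Real.log |x' - y|)|
          = |Real.log |x - y| - Real.log (|x' - y|)| := by
            rw [← abs_neg]; congr 1; ring
        _ ≤ _ := h3
        _ ≤ _ := by
          simp only [Pi.add_apply]
          gcongr
    · rw [integral_const_mul]
      simp only [Pi.add_apply]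
      rw [integral_add (hC x).1 (hC x').1]
      have ha := Real.rpow_nonneg (abs_nonneg (x - x')) (1 / 4)
      nlinarith [(hC x).2, (hC x').2]
  rw [continuous_iff_continuousAt]
  intro x
  rw [ContinuousAt, tendsto_iff_dist_tendsto_zero]
  have hlim : Tendsto (fun y : ℝ => 8 * C * |y - x| ^ (1 / 4 : ℝ)) (𝓝 x) (𝓝 0) := by
    have : ContinuousAt (fun y : ℝ => 8 * C * |y - x| ^ (1 / 4 : ℝ)) x := by
      refine continuousAt_const.mul (ContinuousAt.rpow_const (by fun_prop) (Or.inr (by norm_num)))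
    have h0 := this.tendsto
    simpa using h0
  exact squeeze_zero (fun _ => dist_nonneg) (fun y => hb y x) hlim

end

section

/-! ### Balayage onto the negative half-line -/

/-- The parametrization of the balayage of the point mass at `u ^ 2` onto `(-∞, 0]`. -/
def balMap (u θ : ℝ) : ℝ := -(u ^ 2 * ((1 - Real.cos θ) / (1 + Real.cos θ)))

/-- The balayage onto `(-∞, 0]` of the image of `σ` under squaring. -/
def balayage (σ : Measure ℝ) : Measure ℝ := (σ.prod angle).map fun z => balMap z.1 z.2

/-- The density of the balayage of the point mass at `u ^ 2`. -/
def balKernel (u x : ℝ) : ℝ := u / (Real.pi * √|x| * (|x| + u ^ 2))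

lemma measurable_balMap : Measurable fun z : ℝ × ℝ => balMap z.1 z.2 := by
  unfold balMap; fun_prop

lemma measurable_balKernel : Measurable fun z : ℝ × ℝ => balKernel z.1 z.2 := by
  unfold balKernel; fun_prop

lemma one_add_cos_pos {θ : ℝ} (h : θ ∈ Ioo 0 Real.pi) : 0 < 1 + Real.cos θ := by
  have := Real.cos_lt_cos_of_nonneg_of_le_pi h.1.le le_rfl h.2
  rw [Real.cos_pi] at this; linarith

lemma one_sub_cos_pos {θ : ℝ} (h : θ ∈ Ioo 0 Real.pi) : 0 < 1 - Real.cos θ := by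
  have := Real.cos_lt_cos_of_nonneg_of_le_pi le_rfl h.2.le h.1
  rw [Real.cos_zero] at this; linarith

lemma balMap_nonpos {u θ : ℝ} (h : θ ∈ Ioo 0 Real.pi) : balMap u θ ≤ 0 := by
  rw [balMap, neg_nonpos]
  have h1 := one_add_cos_pos h
  have h2 := one_sub_cos_pos h
  positivity

lemma hasDerivAt_balMap (u : ℝ) {θ : ℝ} (h : θ ∈ Ioo 0 Real.pi) :
    HasDerivAt (balMap u) (-(2 * u ^ 2 * Real.sin θ / (1 + Real.cos θ) ^ 2)) θ := by
  have h1 := (one_add_cos_pos h).ne'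
  have hc := Real.hasDerivAt_cos θ
  refine (((hc.const_sub 1).div (hc.const_add 1) h1).const_mul (u ^ 2)).neg.congr_deriv ?_
  field_simp
  ring

lemma injOn_balMap {u : ℝ} (hu : 0 < u) : InjOn (balMap u) (Ioo 0 Real.pi) := by
  intro θ hθ θ' hθ' h
  refine Real.injOn_cos (Ioo_subset_Icc_self hθ) (Ioo_subset_Icc_self hθ') ?_
  have h1 := (one_add_cos_pos hθ).ne'
  have h2 := (one_add_cos_pos hθ').ne'
  have h3 := mul_left_cancel₀ (pow_ne_zero 2 hu.ne') (neg_injective h)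
  rw [div_eq_div_iff h1 h2] at h3
  linarith

lemma image_balMap {u : ℝ} (hu : 0 < u) : balMap u '' Ioo 0 Real.pi = Iio 0 := by
  ext x
  constructor
  · rintro ⟨θ, hθ, rfl⟩
    have h1 := one_add_cos_pos hθ
    have h2 := one_sub_cos_pos hθ
    rw [mem_Iio, balMap, neg_lt_zero]
    positivity
  · intro (hx : x < 0)
    have hd : 0 < u ^ 2 - x := by nlinarith
    have hc1 : -1 < (u ^ 2 + x) / (u ^ 2 - x) := by
      rw [lt_div_iff₀ hd]; nlinarith
    have hc2 : (u ^ 2 + x) / (u ^ 2 - x) < 1 := by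
      rw [div_lt_one hd]; linarith
    refine ⟨Real.arccos ((u ^ 2 + x) / (u ^ 2 - x)),
      ⟨Real.arccos_pos.2 hc2, Real.arccos_lt_pi.2 hc1⟩, ?_⟩
    rw [balMap, Real.cos_arccos hc1.le hc2.le]
    have hu' := hu.ne'
    have hd' := hd.ne'
    have h3 : 1 + (u ^ 2 + x) / (u ^ 2 - x) = 2 * u ^ 2 / (u ^ 2 - x) := by
      field_simp; ring
    rw [h3]
    field_simp
    ring

/-- In the parametrization `x = -u² tan²(θ/2)` the kernel times the Jacobian is constant, so the
uniform angle is carried to the density `balKernel u`. -/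
lemma deriv_mul_balKernel {u θ : ℝ} (hu : 0 < u) (h : θ ∈ Ioo 0 Real.pi) :
    |-(2 * u ^ 2 * Real.sin θ / (1 + Real.cos θ) ^ 2)| * balKernel u (balMap u θ) = Real.pi⁻¹ := by
  have h1 := one_add_cos_pos h
  have h2 := one_sub_cos_pos h
  have hs := Real.sin_pos_of_pos_of_lt_pi h.1 h.2
  have habs : |balMap u θ| = u ^ 2 * ((1 - Real.cos θ) / (1 + Real.cos θ)) := by
    rw [balMap, abs_neg, abs_of_pos (by positivity)]
  have hsq : √|balMap u θ| = u * Real.sin θ / (1 + Real.cos θ) := by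
    have hsin : Real.sin θ ^ 2 = (1 - Real.cos θ) * (1 + Real.cos θ) := by
      rw [Real.sin_sq]; ring
    have : u ^ 2 * ((1 - Real.cos θ) / (1 + Real.cos θ)) =
        (u * Real.sin θ / (1 + Real.cos θ)) ^ 2 := by
      rw [div_pow, mul_pow, hsin]; field_simp
    rw [habs, this, Real.sqrt_sq (by positivity)]
  rw [abs_neg, abs_of_pos (by positivity), balKernel, hsq, habs]
  have h3 : u ^ 2 * ((1 - Real.cos θ) / (1 + Real.cos θ)) + u ^ 2 =
      2 * u ^ 2 / (1 + Real.cos θ) := by field_simp; ring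
  rw [h3]
  field_simp

lemma angle_preimage_balMap {u : ℝ} (hu : 0 < u) {A : Set ℝ} (hA : MeasurableSet A) :
    angle (balMap u ⁻¹' A) = ∫⁻ x in Iic 0, A.indicator (fun x => ENNReal.ofReal (balKernel u x)) x := by
  have hm : Measurable (balMap u) := measurable_balMap.comp measurable_prodMk_left
  have hrestr : (volume.restrict (Iic (0 : ℝ))) = volume.restrict (Iio 0) :=
    (Measure.restrict_congr_set Iio_ae_eq_Iic).symm
  rw [hrestr, ← image_balMap hu, lintegral_image_eq_lintegral_abs_deriv_mul measurableSet_Ioo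
    (fun θ hθ => (hasDerivAt_balMap u hθ).hasDerivWithinAt) (injOn_balMap hu)]
  have : ∀ θ ∈ Ioo 0 Real.pi, ENNReal.ofReal |-(2 * u ^ 2 * Real.sin θ / (1 + Real.cos θ) ^ 2)| *
      A.indicator (fun x => ENNReal.ofReal (balKernel u x)) (balMap u θ) =
      (balMap u ⁻¹' A).indicator (fun _ => ENNReal.ofReal Real.pi⁻¹) θ := by
    intro θ hθ
    by_cases hA' : balMap u θ ∈ A
    · rw [indicator_of_mem hA', indicator_of_mem (by exact hA'),
        ← ENNReal.ofReal_mul (abs_nonneg _), deriv_mul_balKernel hu hθ]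
    · rw [indicator_of_notMem hA', indicator_of_notMem (by exact hA'), mul_zero]
  rw [setLIntegral_congr_fun measurableSet_Ioo this, lintegral_indicator_const (hm hA), angle,
    Measure.smul_apply, smul_eq_mul]

variable {σ : Measure ℝ}

lemma balayage_eq_withDensity_lintegral [SFinite σ] (hσ : ∀ᵐ u ∂σ, 0 < u) :
    balayage σ = (volume.restrict (Iic 0)).withDensity
      fun x => ∫⁻ u, ENNReal.ofReal (balKernel u x) ∂σ := by
  ext A hA
  have hmk : Measurable fun z : ℝ × ℝ => ENNReal.ofReal (balKernel z.1 z.2) :=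
    measurable_balKernel.ennreal_ofReal
  rw [balayage, Measure.map_apply measurable_balMap hA,
    Measure.prod_apply (measurable_balMap hA), withDensity_apply _ hA, ← lintegral_indicator hA]
  have h1 : ∫⁻ u, angle (Prod.mk u ⁻¹' ((fun z : ℝ × ℝ => balMap z.1 z.2) ⁻¹' A)) ∂σ =
      ∫⁻ u, (∫⁻ x in Iic 0, A.indicator (fun x => ENNReal.ofReal (balKernel u x)) x) ∂σ := by
    refine lintegral_congr_ae ?_
    filter_upwards [hσ] with u hu
    exact angle_preimage_balMap hu hA
  rw [h1, lintegral_lintegral_swap]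
  · refine lintegral_congr fun x => ?_
    by_cases hx : x ∈ A
    · simp [indicator_of_mem hx]
    · simp [indicator_of_notMem hx]
  · have : (Function.uncurry fun (u x : ℝ) =>
        A.indicator (fun x => ENNReal.ofReal (balKernel u x)) x) =
        (Prod.snd ⁻¹' A).indicator fun z : ℝ × ℝ => ENNReal.ofReal (balKernel z.1 z.2) := by
      ext z
      rfl
    rw [this]
    exact (hmk.indicator (measurable_snd hA)).aemeasurable

/-- The factor `∫ u / (|x| + u²) dσ(u)` in the density of the balayage. -/
def balFactor (σ : Measure ℝ) (x : ℝ) : ℝ := ∫ u, u / (|x| + u ^ 2) ∂σ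

lemma div_add_sq_le_inv {α u : ℝ} (hα : 0 < α) (hu : α ≤ u) (x : ℝ) :
    u / (|x| + u ^ 2) ≤ α⁻¹ := by
  have hu0 := hα.trans_le hu
  rw [div_le_iff₀ (by positivity), inv_mul_eq_div, le_div_iff₀ hα]
  nlinarith [abs_nonneg x]

lemma integrable_balFactor [IsFiniteMeasure σ] {α : ℝ} (hα : 0 < α) (hσ : ∀ᵐ u ∂σ, α ≤ u) (x : ℝ) :
    Integrable (fun u => u / (|x| + u ^ 2)) σ := by
  refine Integrable.of_bound (C := α⁻¹) (by fun_prop : Measurable fun u : ℝ =>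
    u / (|x| + u ^ 2)).aestronglyMeasurable ?_
  filter_upwards [hσ] with u hu
  have hu0 := hα.trans_le hu
  rw [Real.norm_eq_abs, abs_of_nonneg (by positivity)]
  exact div_add_sq_le_inv hα hu x

lemma balFactor_le [IsProbabilityMeasure σ] {α : ℝ} (hα : 0 < α) (hσ : ∀ᵐ u ∂σ, α ≤ u) (x : ℝ) :
    balFactor σ x ≤ α⁻¹ := by
  have := integral_mono_ae (integrable_balFactor hα hσ x) (integrable_const α⁻¹)
    (hσ.mono fun u hu => div_add_sq_le_inv hα hu x)
  simpa [balFactor] using this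

lemma measurable_balFactor [SFinite σ] : Measurable (balFactor σ) := by
  have : StronglyMeasurable (Function.uncurry fun (x u : ℝ) => u / (|x| + u ^ 2)) :=
    (by unfold Function.uncurry; fun_prop : Measurable (Function.uncurry fun (x u : ℝ) =>
      u / (|x| + u ^ 2))).stronglyMeasurable
  exact (StronglyMeasurable.integral_prod_right this).measurable

lemma balayage_eq_withDensity [IsFiniteMeasure σ] {α : ℝ} (hα : 0 < α) (hσ : ∀ᵐ u ∂σ, α ≤ u) :
    balayage σ = (volume.restrict (Iic 0)).withDensity
      fun x => ENNReal.ofReal (balFactor σ x / Real.pi / √|x|) := by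
  rw [balayage_eq_withDensity_lintegral (hσ.mono fun u hu => hα.trans_le hu)]
  congr 1
  ext x
  have hk : ∀ u, balKernel u x = u / (|x| + u ^ 2) * (1 / Real.pi / √|x|) := by
    intro u; rw [balKernel]; simp only [div_eq_mul_inv, mul_inv]; ring
  simp_rw [hk]
  rw [← ofReal_integral_eq_lintegral_ofReal ((integrable_balFactor hα hσ x).mul_const _),
    integral_mul_const]
  · congr 1
    rw [balFactor]; ring
  · filter_upwards [hσ] with u hu
    have hu0 := hα.trans_le hu
    change 0 ≤ _
    positivity

instance [IsProbabilityMeasure σ] : IsProbabilityMeasure (balayage σ) :=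
  Measure.isProbabilityMeasure_map measurable_balMap.aemeasurable

lemma balayage_carrier [SFinite σ] (σ' : Measure ℝ) (h : σ' = balayage σ) : σ' (Iic 0)ᶜ = 0 := by
  rw [h, balayage, Measure.map_apply measurable_balMap measurableSet_Iic.compl, ← nonpos_iff_eq_zero]
  have : ∀ᵐ z ∂(σ.prod angle), balMap z.1 z.2 ∈ Iic (0 : ℝ) := by
    filter_upwards [Measure.quasiMeasurePreserving_snd.ae (ae_angle_mem)] with z hz
      using balMap_nonpos hz
  rw [ae_iff] at this
  exact this.le

/-- A multiple of the balayage is dominated by every constraint with a large enough density. -/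
lemma smul_balayage_le_constraint [IsProbabilityMeasure σ] {α : ℝ} (hα : 0 < α)
    (hσ : ∀ᵐ u ∂σ, α ≤ u) (k : NNReal) {c s : ℝ}
    (h : ∀ x, k * balFactor σ x / Real.pi ≤ √c / (Real.pi * s)) :
    k • balayage σ ≤ constraint c s := by
  rw [balayage_eq_withDensity hα hσ, constraint]
  have : k • (volume.restrict (Iic (0 : ℝ))).withDensity
      (fun x => ENNReal.ofReal (balFactor σ x / Real.pi / √|x|)) =
      (volume.restrict (Iic (0 : ℝ))).withDensity
        ((k : ENNReal) • fun x => ENNReal.ofReal (balFactor σ x / Real.pi / √|x|)) := by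
    rw [withDensity_smul]
    · rfl
    · exact (((measurable_balFactor.div_const _).div (by fun_prop)).ennreal_ofReal)
  rw [this]
  refine withDensity_mono (ae_of_all _ fun x => ?_)
  rw [Pi.smul_apply, smul_eq_mul, ← ENNReal.ofReal_coe_nnreal, ← ENNReal.ofReal_mul (by positivity)]
  refine ENNReal.ofReal_le_ofReal ?_
  rw [← mul_div_assoc, ← mul_div_assoc]
  exact div_le_div_of_nonneg_right (h x) (Real.sqrt_nonneg _)

lemma logRegular_smul_balayage [IsProbabilityMeasure σ] {α : ℝ} (hα : 0 < α)
    (hσ : ∀ᵐ u ∂σ, α ≤ u) (k : NNReal) : LogRegular (k • balayage σ) := by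
  refine (logRegular_constraint ((k * α⁻¹) ^ 2) 1).mono (smul_balayage_le_constraint hα hσ k ?_)
  intro x
  rw [Real.sqrt_sq (by positivity), mul_one]
  gcongr
  exact balFactor_le hα hσ x

/-! ### The potential of the balayage -/

lemma ae_angle_cos_ne (k : ℝ) : ∀ᵐ θ ∂angle, Real.cos θ ≠ k := by
  have hsub : (Ioo 0 Real.pi ∩ {θ | Real.cos θ = k}).Subsingleton := by
    intro θ hθ θ' hθ'
    exact Real.injOn_cos (Ioo_subset_Icc_self hθ.1) (Ioo_subset_Icc_self hθ'.1)
      ((show Real.cos θ = k from hθ.2).trans (show Real.cos θ' = k from hθ'.2).symm)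
  rw [ae_iff, angle, Measure.smul_apply, Measure.restrict_apply' measurableSet_Ioo, inter_comm]
  simp only [ne_eq, not_not]
  rw [hsub.measure_zero]
  simp

/-- Multiplying by `1 + cos θ` makes numerator and denominator affine in `cos θ`, which reduces the
potential of the balayage to two arcsine potentials. The zero of the numerator is a null set of
angles. -/
lemma log_sub_balMap_ae {u : ℝ} (hu : 0 < u) (x : ℝ) :
    (fun θ => Real.log |x - balMap u θ|) =ᵐ[angle] fun θ =>
      Real.log |(x + u ^ 2) - (u ^ 2 - x) * Real.cos θ| - Real.log |1 - (-1) * Real.cos θ| := by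
  filter_upwards [ae_angle_mem, ae_angle_cos_ne ((x + u ^ 2) / (u ^ 2 - x))] with θ hθ hne
  have h1 := one_add_cos_pos hθ
  have hnum : (x + u ^ 2) - (u ^ 2 - x) * Real.cos θ ≠ 0 := by
    intro h0
    rcases eq_or_ne (u ^ 2 - x) 0 with h2 | h2
    · rw [h2, zero_mul, sub_zero] at h0
      have : 0 < u ^ 2 := by positivity
      linarith
    · apply hne
      rw [eq_div_iff h2]; linarith
  rw [show (1 : ℝ) - (-1) * Real.cos θ = 1 + Real.cos θ by ring,
    ← Real.log_div (abs_ne_zero.2 hnum) (abs_ne_zero.2 h1.ne'), ← abs_div]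
  congr 2
  rw [balMap]
  field_simp
  ring

lemma integrable_log_sub_balMap {u : ℝ} (hu : 0 < u) (x : ℝ) :
    Integrable (fun θ => Real.log |x - balMap u θ|) angle :=
  ((integrable_log_sub_cos _ _).sub (integrable_log_sub_cos _ _)).congr (log_sub_balMap_ae hu x).symm

lemma integral_log_sub_balMap {u : ℝ} (hu : 0 < u) (x : ℝ) :
    ∫ θ, Real.log |x - balMap u θ| ∂angle = arcLog (x + u ^ 2) (u ^ 2 - x) - arcLog 1 (-1) := by
  rw [integral_congr_ae (log_sub_balMap_ae hu x),
    integral_sub (integrable_log_sub_cos _ _) (integrable_log_sub_cos _ _), integral_log_sub_cos,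
    integral_log_sub_cos]

lemma arcLog_one_neg_one : arcLog 1 (-1) = Real.log (1 / 2) := by
  simp [arcLog]

lemma integral_log_sub_balMap_of_nonpos {u x : ℝ} (hu : 0 < u) (hx : x ≤ 0) :
    ∫ θ, Real.log |x - balMap u θ| ∂angle = Real.log |x - u ^ 2| := by
  have hu2 : 0 < u ^ 2 := by positivity
  rw [integral_log_sub_balMap hu, arcLog_one_neg_one, arcLog, abs_sub_comm x,
    abs_of_pos (by linarith : 0 < u ^ 2 - x), max_eq_right (abs_le.2 ⟨by linarith, by linarith⟩),
    Real.sqrt_eq_zero_of_nonpos (by nlinarith), add_zero,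
    ← Real.log_div (by linarith) (by norm_num)]
  congr 1; ring

/-- The quantity under the root in `arcLog` is the perfect square `(2yu)²`, which is why the result
is a logarithm of `y + u`. -/
lemma integral_log_sub_balMap_of_nonneg {u y : ℝ} (hu : 0 < u) (hy : 0 ≤ y) :
    ∫ θ, Real.log |y ^ 2 - balMap u θ| ∂angle = 2 * Real.log (y + u) := by
  have hu2 : 0 < u ^ 2 := by positivity
  have hy2 : 0 ≤ y ^ 2 := by positivity
  rw [integral_log_sub_balMap hu, arcLog_one_neg_one, arcLog,
    abs_of_pos (by linarith : 0 < y ^ 2 + u ^ 2), max_eq_left (abs_le.2 ⟨by linarith, by linarith⟩),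
    show (y ^ 2 + u ^ 2) ^ 2 - (u ^ 2 - y ^ 2) ^ 2 = (2 * y * u) ^ 2 by ring,
    Real.sqrt_sq (by positivity), ← Real.log_div (by positivity) (by norm_num),
    show (y ^ 2 + u ^ 2 + 2 * y * u) / 2 / (1 / 2) = (y + u) ^ 2 by ring, Real.log_pow]
  push_cast; ring

/-- On `(-∞, 0]` one has `1 + |x| = |1 - x|`, so the moment is an explicitly known potential at `1`.
-/
lemma logMoment_balayage [IsProbabilityMeasure σ] {α B : ℝ} (hα : 0 < α)
    (hσ : ∀ᵐ u ∂σ, u ∈ Icc α B) : LogMoment (balayage σ) := by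
  have hpos : ∀ᵐ u ∂σ, 0 < u := hσ.mono fun u hu => hα.trans_le hu.1
  have hm : Measurable fun z : ℝ × ℝ => Real.log (1 + |balMap z.1 z.2|) := by
    have := measurable_balMap; fun_prop
  have heq : ∀ u, ∀ᵐ θ ∂angle, Real.log (1 + |balMap u θ|) = Real.log |1 ^ 2 - balMap u θ| := by
    intro u
    filter_upwards [ae_angle_mem] with θ hθ
    have := balMap_nonpos (u := u) hθ
    rw [abs_of_nonpos this, abs_of_nonneg (by linarith)]
    congr 1; ring
  rw [LogMoment, balayage, integrable_map_measure (by fun_prop : Measurable fun y : ℝ =>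
    Real.log (1 + |y|)).aestronglyMeasurable measurable_balMap.aemeasurable]
  refine (integrable_prod_iff hm.aestronglyMeasurable).2 ⟨?_, ?_⟩
  · filter_upwards [hpos] with u hu
    exact (integrable_log_sub_balMap hu _).congr ((heq u).mono fun θ h => h.symm)
  · refine Integrable.of_bound (C := 2 * Real.log (1 + B))
      hm.aestronglyMeasurable.norm.integral_prod_right' ?_
    filter_upwards [hpos, hσ] with u hu huB
    have h1 : ∫ θ, ‖Real.log (1 + |balMap u θ|)‖ ∂angle = 2 * Real.log (1 + u) := by
      rw [← integral_log_sub_balMap_of_nonneg hu zero_le_one]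
      refine integral_congr_ae ?_
      filter_upwards [heq u] with θ h
      rw [Real.norm_eq_abs, abs_of_nonneg (log_one_add_abs_nonneg _), h]
    change ‖∫ θ, ‖Real.log (1 + |balMap u θ|)‖ ∂angle‖ ≤ _
    rw [h1, Real.norm_eq_abs, abs_of_nonneg (mul_nonneg two_pos.le (Real.log_nonneg (by linarith)))]
    gcongr
    exact huB.2

lemma potential_balayage [IsProbabilityMeasure σ] {α B : ℝ} (hα : 0 < α)
    (hσ : ∀ᵐ u ∂σ, u ∈ Icc α B) (x : ℝ) :
    potential (balayage σ) x = -∫ u, ∫ θ, Real.log |x - balMap u θ| ∂angle ∂σ := by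
  have hreg := logRegular_smul_balayage hα (hσ.mono fun u hu => hu.1) 1
  rw [one_smul] at hreg
  have hint := hreg.integrable_log (logMoment_balayage hα hσ) x
  have hme := (measurable_logKernel_left x).aestronglyMeasurable (μ := balayage σ)
  rw [balayage] at hint hme
  rw [potential, balayage, integral_map measurable_balMap.aemeasurable hme,
    integral_prod (fun z : ℝ × ℝ => -Real.log |x - balMap z.1 z.2|)
      ((integrable_map_measure hme measurable_balMap.aemeasurable).1 hint)]
  simp_rw [integral_neg]

/-- On `(-∞, 0]` the potential of the balayage is that of the swept measure. -/
lemma potential_balayage_of_nonpos [IsProbabilityMeasure σ] {α B : ℝ} (hα : 0 < α)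
    (hσ : ∀ᵐ u ∂σ, u ∈ Icc α B) {x : ℝ} (hx : x ≤ 0) :
    potential (balayage σ) x = potential (σ.map fun u => u ^ 2) x := by
  rw [potential_balayage hα hσ, potential, integral_map (by fun_prop)
    (measurable_logKernel_left x).aestronglyMeasurable, integral_neg]
  congr 1
  refine integral_congr_ae ?_
  filter_upwards [hσ] with u hu
  exact integral_log_sub_balMap_of_nonpos (hα.trans_le hu.1) hx

lemma potential_balayage_sq [IsProbabilityMeasure σ] {α B : ℝ} (hα : 0 < α)
    (hσ : ∀ᵐ u ∂σ, u ∈ Icc α B) {y : ℝ} (hy : 0 ≤ y) :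
    potential (balayage σ) (y ^ 2) = -∫ u, 2 * Real.log (y + u) ∂σ := by
  rw [potential_balayage hα hσ]
  congr 1
  refine integral_congr_ae ?_
  filter_upwards [hσ] with u hu
  exact integral_log_sub_balMap_of_nonneg (hα.trans_le hu.1) hy

end

section

/-! ### Images under squaring -/

/-- The image of a measure under squaring. -/
def sqMap (σ : Measure ℝ) : Measure ℝ := σ.map fun u => u ^ 2

lemma measurable_sq : Measurable fun u : ℝ => u ^ 2 := by fun_prop

instance {σ : Measure ℝ} [IsProbabilityMeasure σ] : IsProbabilityMeasure (sqMap σ) :=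
  Measure.isProbabilityMeasure_map measurable_sq.aemeasurable

instance {σ : Measure ℝ} [IsFiniteMeasure σ] : IsFiniteMeasure (sqMap σ) := by
  unfold sqMap; infer_instance

variable {σ l : Measure ℝ}

lemma sq_sqrt_sub_le {u : ℝ} (hu : 0 ≤ u) (x : ℝ) : |√x - u| ^ 2 ≤ |x - u ^ 2| := by
  rcases le_total 0 x with hx | hx
  · have h : |x - u ^ 2| = |√x - u| * (√x + u) := by
      rw [← abs_of_nonneg (add_nonneg (Real.sqrt_nonneg x) hu), ← abs_mul]
      congr 1
      nlinarith [Real.sq_sqrt hx]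
    rw [h, sq]
    refine mul_le_mul_of_nonneg_left ?_ (abs_nonneg _)
    rw [abs_le]
    constructor <;> linarith [Real.sqrt_nonneg x]
  · rw [Real.sqrt_eq_zero_of_nonpos hx, zero_sub, abs_neg, abs_of_nonneg hu,
      abs_of_nonpos (by nlinarith)]
    linarith

lemma LogRegular.sqMap (h : LogRegular σ) (hσ : ∀ᵐ u ∂σ, 0 ≤ u) : LogRegular (sqMap σ) where
  noAtoms := ⟨fun x => by
    have := h.noAtoms
    rw [VectorEquilibrium.sqMap, Measure.map_apply measurable_sq (measurableSet_singleton x)]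
    refine measure_mono_null (t := {√x, -√x}) (fun u (hu : u ^ 2 = x) => ?_) ?_
    · have h1 : |u| = √x := by rw [← hu, Real.sqrt_sq_eq_abs]
      rcases abs_cases u with ⟨h2, _⟩ | ⟨h2, _⟩
      · left; rw [← h1, h2]
      · right; rw [mem_singleton_iff, ← h1, h2, neg_neg]
    · exact ((finite_singleton (-√x)).insert (√x)).measure_zero σ⟩
  bound := by
    have hna := h.noAtoms
    obtain ⟨C, hC⟩ := h.bound
    refine ⟨2 * C, fun x => ?_⟩
    rw [VectorEquilibrium.sqMap, lintegral_map (by fun_prop) measurable_sq]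
    calc ∫⁻ u, ENNReal.ofReal (-Real.log |x - u ^ 2|) ∂σ
        ≤ ∫⁻ u, 2 * ENNReal.ofReal (-Real.log |√x - u|) ∂σ := by
          refine lintegral_mono_ae ?_
          have hne : ∀ᵐ u ∂σ, u ≠ √x := by
            rw [ae_iff]; simp
          filter_upwards [hσ, hne] with u hu hux
          have h1 : 0 < |√x - u| := abs_pos.2 (sub_ne_zero.2 hux.symm)
          have h2 := Real.log_le_log (by positivity) (sq_sqrt_sub_le hu x)
          rw [Real.log_pow] at h2
          push_cast at h2
          rw [show (2 : ENNReal) = ENNReal.ofReal 2 by simp, ← ENNReal.ofReal_mul (by norm_num)]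
          exact ENNReal.ofReal_le_ofReal (by linarith)
      _ ≤ _ := by
          rw [lintegral_const_mul _ (by fun_prop), ENNReal.coe_mul]
          exact mul_le_mul_right (hC _) 2

lemma ae_sqMap_abs_le {B : ℝ} (h : ∀ᵐ u ∂σ, |u| ≤ B) : ∀ᵐ x ∂(sqMap σ), |x| ≤ B ^ 2 := by
  rw [sqMap, ae_map_iff (p := fun x => |x| ≤ B ^ 2) measurable_sq.aemeasurable
    (measurableSet_le (by fun_prop) measurable_const)]
  filter_upwards [h] with u hu
  rw [abs_of_nonneg (sq_nonneg u)]
  exact sq_le_sq' (by linarith [(abs_le.1 hu).1]) (abs_le.1 hu).2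

lemma logMoment_sqMap [IsFiniteMeasure σ] {B : ℝ} (h : ∀ᵐ u ∂σ, |u| ≤ B) : LogMoment (sqMap σ) :=
  logMoment_of_ae_bounded (ae_sqMap_abs_le h)

lemma sqMap_carrier (σ : Measure ℝ) : sqMap σ (Ici 0)ᶜ = 0 := by
  rw [sqMap, Measure.map_apply measurable_sq measurableSet_Ici.compl]
  have : (fun u : ℝ => u ^ 2) ⁻¹' (Ici 0)ᶜ = ∅ := by
    ext u; simp [sq_nonneg]
  rw [this, measure_empty]

lemma sqMap_mono (h : l ≤ σ) : sqMap l ≤ sqMap σ := Measure.map_mono h measurable_sq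

lemma integral_sqMap (f : ℝ → ℝ) (hf : Measurable f) : ∫ x, f x ∂(sqMap σ) = ∫ u, f (u ^ 2) ∂σ :=
  integral_map measurable_sq.aemeasurable hf.aestronglyMeasurable

lemma sq_sub_sq_log {y u : ℝ} (hne : u ≠ y) (h : 0 < y + u) :
    Real.log |y ^ 2 - u ^ 2| = Real.log |y - u| + Real.log (y + u) := by
  rw [sq_sub_sq, abs_mul, abs_of_pos h, mul_comm, Real.log_mul
    (abs_ne_zero.2 (sub_ne_zero.2 hne.symm)) h.ne']

lemma integrable_log_add [IsFiniteMeasure σ] {α B y : ℝ} (hα : 0 < α)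
    (hσ : ∀ᵐ u ∂σ, u ∈ Icc α B) (hy : 0 ≤ y) : Integrable (fun u => Real.log (y + u)) σ := by
  refine Integrable.of_bound (C := |Real.log α| + |Real.log (y + B)|)
    (by fun_prop : Measurable fun u : ℝ => Real.log (y + u)).aestronglyMeasurable ?_
  filter_upwards [hσ] with u hu
  have hu0 := hα.trans_le hu.1
  have h1 : Real.log α ≤ Real.log (y + u) := Real.log_le_log hα (by linarith [hu.1])
  have h2 : Real.log (y + u) ≤ Real.log (y + B) := Real.log_le_log (by linarith) (by linarith [hu.2])
  rw [Real.norm_eq_abs, abs_le]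
  constructor
  · linarith [neg_abs_le (Real.log α), abs_nonneg (Real.log (y + B))]
  · linarith [le_abs_self (Real.log (y + B)), abs_nonneg (Real.log α)]

/-- The combined potential of the swept measure and its balayage, in the square root variable. -/
lemma potential_sqMap_sub_balayage [IsProbabilityMeasure σ] [NullSingletonClass σ] {α B y : ℝ}
    (hα : 0 < α) (hσ : ∀ᵐ u ∂σ, u ∈ Icc α B) (hy : 0 ≤ y)
    (hint : Integrable (fun u => -Real.log |y - u|) σ) :
    2 * potential (sqMap σ) (y ^ 2) - potential (balayage σ) (y ^ 2) = 2 * potential σ y := by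
  have hne : ∀ᵐ u ∂σ, u ≠ y := by rw [ae_iff]; simp
  have h1 : potential (sqMap σ) (y ^ 2) = potential σ y - ∫ u, Real.log (y + u) ∂σ := by
    rw [potential, integral_sqMap _ (measurable_logKernel_left _), potential,
      ← integral_sub hint (integrable_log_add hα hσ hy)]
    refine integral_congr_ae ?_
    filter_upwards [hσ, hne] with u hu hu'
    rw [sq_sub_sq_log hu' (by linarith [hu.1])]
    ring
  rw [h1, potential_balayage_sq hα hσ hy, integral_const_mul]
  ring

/-- The kernels of the image and of `σ` differ by `log (z.1 + z.2)`, which is bounded because the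
support stays away from `0`. -/
lemma finiteEnergy_of_sqMap [IsProbabilityMeasure σ] {α B : ℝ} (hα : 0 < α)
    (hσ : ∀ᵐ u ∂σ, u ∈ Icc α B) (h : FiniteEnergy (sqMap σ) (sqMap σ)) : FiniteEnergy σ σ := by
  have hmap : (sqMap σ).prod (sqMap σ) = (σ.prod σ).map (Prod.map (fun u => u ^ 2) fun u => u ^ 2) :=
    Measure.map_prod_map σ σ measurable_sq measurable_sq
  have hm : Measurable (Prod.map (fun u : ℝ => u ^ 2) fun u : ℝ => u ^ 2) :=
    measurable_sq.prodMap measurable_sq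
  have hdiag : MeasurableSet {z : ℝ × ℝ | z.1 = z.2} :=
    measurableSet_eq_fun measurable_fst measurable_snd
  have h1 : (σ.prod σ) {z | z.1 = z.2} = 0 := by
    have := h.1
    rw [hmap, Measure.map_apply hm hdiag] at this
    refine measure_mono_null (fun z (hz : z.1 = z.2) => ?_) this
    change z.1 ^ 2 = z.2 ^ 2
    rw [hz]
  refine ⟨h1, ?_⟩
  have h2 := h.2
  have hk : Measurable fun z : ℝ × ℝ => Real.log (1 / |z.1 - z.2|) := by fun_prop
  rw [hmap, integrable_map_measure hk.aestronglyMeasurable hm.aemeasurable] at h2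
  have hmem : ∀ᵐ z ∂(σ.prod σ), z.1 ∈ Icc α B ∧ z.2 ∈ Icc α B :=
    (Measure.quasiMeasurePreserving_fst.ae hσ).and (Measure.quasiMeasurePreserving_snd.ae hσ)
  have h3 : Integrable (fun z : ℝ × ℝ => Real.log (z.1 + z.2)) (σ.prod σ) := by
    refine Integrable.of_bound (C := |Real.log (α + α)| + |Real.log (B + B)|)
      (by fun_prop : Measurable fun z : ℝ × ℝ => Real.log (z.1 + z.2)).aestronglyMeasurable ?_
    filter_upwards [hmem] with z hz
    have h4 : Real.log (α + α) ≤ Real.log (z.1 + z.2) :=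
      Real.log_le_log (by linarith) (by linarith [hz.1.1, hz.2.1])
    have h5 : Real.log (z.1 + z.2) ≤ Real.log (B + B) :=
      Real.log_le_log (by linarith [hz.1.1, hz.2.1]) (by linarith [hz.1.2, hz.2.2])
    rw [Real.norm_eq_abs, abs_le]
    constructor
    · linarith [neg_abs_le (Real.log (α + α)), abs_nonneg (Real.log (B + B))]
    · linarith [le_abs_self (Real.log (B + B)), abs_nonneg (Real.log (α + α))]
  have hne : ∀ᵐ z ∂(σ.prod σ), z.1 ≠ z.2 := by rw [ae_iff]; simpa using h1
  refine (h2.add h3).congr ?_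
  filter_upwards [hmem, hne] with z hz hzne
  simp only [Pi.add_apply, Function.comp, Prod.map, log_one_div_abs]
  rw [sq_sub_sq_log hzne.symm (by linarith [hz.1.1, hz.2.1])]
  ring

/-! ### The external field in the square root variable -/

/-- The center of the extremal semicircle law. -/
def center (a b t : ℝ) : ℝ := (1 - t) * √a + t * √b

/-- The radius of the extremal semicircle law. -/
def radius (t : ℝ) : ℝ := √(2 * t * (1 - t))

variable {a b t : ℝ}

lemma radius_pos (ht₀ : 0 < t) (ht₁ : t < 1) : 0 < radius t := by
  have : 0 < 1 - t := by linarith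
  exact Real.sqrt_pos.2 (by positivity)

lemma radius_sq (ht₀ : 0 < t) (ht₁ : t < 1) : radius t ^ 2 = 2 * t * (1 - t) := by
  have : 0 < 1 - t := by linarith
  exact Real.sq_sqrt (by positivity)

/-- For `y ≥ 0` the square roots become linear in `y`, and completing the square explains the choice
of `center` and `radius`. -/
lemma externalField_sq (ha : 0 < a) (hb : 0 < b) (ht₀ : 0 < t) (ht₁ : t < 1) {y : ℝ} (hy : 0 ≤ y) :
    externalField a b t (y ^ 2) =
      2 * (y - center a b t) ^ 2 / radius t ^ 2 - 2 * center a b t ^ 2 / radius t ^ 2 := by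
  have h1 : 1 - t ≠ 0 := by linarith
  rw [externalField, radius_sq ht₀ ht₁, Real.sqrt_mul ha.le, Real.sqrt_mul hb.le,
    Real.sqrt_sq hy, center]
  field_simp
  ring

lemma measurable_externalField : Measurable (externalField a b t) := by
  unfold externalField; fun_prop

lemma continuous_externalField : Continuous (externalField a b t) := by
  unfold externalField; fun_prop

lemma integrable_externalField_of_bounded {μ : Measure ℝ} [IsFiniteMeasure μ] {B : ℝ}
    (h : ∀ᵐ x ∂μ, |x| ≤ B) : Integrable (externalField a b t) μ := by
  obtain ⟨C, hC⟩ := (isCompact_Icc (a := -B) (b := B)).exists_bound_of_continuousOn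
    (continuous_externalField (a := a) (b := b) (t := t)).continuousOn
  refine Integrable.of_bound (C := C) measurable_externalField.aestronglyMeasurable ?_
  filter_upwards [h] with x hx
  exact hC x (abs_le.1 hx)

end

section

/-! ### The deficit between a constraint and half of a balayage -/

/-- Half of the balayage. -/
def halfBal (σ : Measure ℝ) : Measure ℝ := (1 / 2 : NNReal) • balayage σ

variable {σ : Measure ℝ} {α B c s : ℝ}

instance [IsProbabilityMeasure σ] : IsFiniteMeasure (halfBal σ) := by
  unfold halfBal; infer_instance

lemma halfBal_univ [IsProbabilityMeasure σ] : halfBal σ univ = 1 / 2 := by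
  rw [halfBal, Measure.smul_apply, measure_univ, ENNReal.smul_def, smul_eq_mul, mul_one]
  simp

lemma halfBal_carrier [IsProbabilityMeasure σ] : halfBal σ (Iic 0)ᶜ = 0 := by
  rw [halfBal, Measure.smul_apply, balayage_carrier _ rfl, smul_zero]

lemma logRegular_halfBal [IsProbabilityMeasure σ] (hα : 0 < α) (hσ : ∀ᵐ u ∂σ, u ∈ Icc α B) :
    LogRegular (halfBal σ) :=
  logRegular_smul_balayage hα (hσ.mono fun _ hu => hu.1) _

lemma logMoment_halfBal [IsProbabilityMeasure σ] (hα : 0 < α) (hσ : ∀ᵐ u ∂σ, u ∈ Icc α B) :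
    LogMoment (halfBal σ) :=
  (logMoment_balayage hα hσ).smul _

lemma potential_halfBal (x : ℝ) : potential (halfBal σ) x = potential (balayage σ) x / 2 := by
  rw [potential, potential, halfBal, integral_smul_nnreal_measure, NNReal.smul_def]
  push_cast
  rw [smul_eq_mul]; ring

lemma balFactor_zero : balFactor σ 0 = ∫ u, u⁻¹ ∂σ := by
  rw [balFactor]
  congr 1
  ext u
  rw [abs_zero, zero_add]
  rcases eq_or_ne u 0 with rfl | h
  · simp
  · field_simp

/-- Reduces the constraint on the whole half-line to one inequality at the origin. -/
lemma balFactor_le_zero [IsFiniteMeasure σ] (hα : 0 < α) (hσ : ∀ᵐ u ∂σ, α ≤ u) (x : ℝ) :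
    balFactor σ x ≤ balFactor σ 0 := by
  refine integral_mono_ae (integrable_balFactor hα hσ x) (integrable_balFactor hα hσ 0) ?_
  filter_upwards [hσ] with u hu
  have hu0 := hα.trans_le hu
  rw [abs_zero, zero_add]
  gcongr
  linarith [abs_nonneg x]

lemma continuous_balFactor [IsFiniteMeasure σ] (hα : 0 < α) (hσ : ∀ᵐ u ∂σ, α ≤ u) :
    Continuous (balFactor σ) := by
  refine continuous_of_dominated (bound := fun _ => α⁻¹) (fun x =>
    (by fun_prop : Measurable fun u : ℝ => u / (|x| + u ^ 2)).aestronglyMeasurable) (fun x => ?_)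
    (integrable_const _) ?_
  · filter_upwards [hσ] with u hu
    have hu0 := hα.trans_le hu
    rw [Real.norm_eq_abs, abs_of_nonneg (by positivity)]
    exact div_add_sq_le_inv hα hu x
  · filter_upwards [hσ] with u hu
    have hu0 := hα.trans_le hu
    exact continuous_const.div (by fun_prop) fun x => by positivity

lemma halfBal_eq_withDensity [IsProbabilityMeasure σ] (hα : 0 < α) (hσ : ∀ᵐ u ∂σ, α ≤ u) :
    halfBal σ = (volume.restrict (Iic 0)).withDensity
      fun x => ENNReal.ofReal (balFactor σ x / 2 / Real.pi / √|x|) := by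
  rw [halfBal, balayage_eq_withDensity hα hσ]
  have hm : Measurable fun x => ENNReal.ofReal (balFactor σ x / Real.pi / √|x|) :=
    ((measurable_balFactor.div_const _).div (by fun_prop)).ennreal_ofReal
  have h1 : (1 / 2 : NNReal) • (volume.restrict (Iic (0 : ℝ))).withDensity
      (fun x => ENNReal.ofReal (balFactor σ x / Real.pi / √|x|)) =
      ((1 / 2 : NNReal) : ENNReal) • (volume.restrict (Iic (0 : ℝ))).withDensity
      (fun x => ENNReal.ofReal (balFactor σ x / Real.pi / √|x|)) := rfl
  rw [h1, ← withDensity_smul _ hm]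
  congr 1
  ext x
  rw [Pi.smul_apply, smul_eq_mul, ← ENNReal.ofReal_coe_nnreal, ← ENNReal.ofReal_mul (by positivity)]
  congr 1
  push_cast
  ring

/-- The density of the deficit. -/
def deficit (σ : Measure ℝ) (c s x : ℝ) : ℝ := (√c / s - balFactor σ x / 2) / Real.pi / √|x|

lemma measurable_deficit [SFinite σ] : Measurable (deficit σ c s) :=
  (((measurable_balFactor.div_const 2).const_sub _).div_const _).div (by fun_prop)

lemma constraint_eq_add [IsProbabilityMeasure σ] (hα : 0 < α) (hσ : ∀ᵐ u ∂σ, α ≤ u)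
    (h : ∀ x, balFactor σ x / 2 ≤ √c / s) :
    constraint c s = (volume.restrict (Iic 0)).withDensity
      (fun x => ENNReal.ofReal (deficit σ c s x)) + halfBal σ := by
  rw [halfBal_eq_withDensity hα hσ, ← withDensity_add_left measurable_deficit.ennreal_ofReal,
    constraint]
  congr 1
  ext x
  have h1 : 0 ≤ balFactor σ x := by
    refine integral_nonneg_of_ae ?_
    filter_upwards [hσ] with u hu
    have hu0 := hα.trans_le hu
    change 0 ≤ _
    positivity
  have h2 : 0 ≤ √c / s - balFactor σ x / 2 := by linarith [h x]
  rw [Pi.add_apply, ← ENNReal.ofReal_add (by unfold deficit; positivity) (by positivity)]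
  congr 1
  rw [deficit, ← add_div, ← add_div, sub_add_cancel, div_div (√c) s, mul_comm s]

lemma constraint_sub_halfBal [IsProbabilityMeasure σ] (hα : 0 < α) (hσ : ∀ᵐ u ∂σ, α ≤ u)
    (h : ∀ x, balFactor σ x / 2 ≤ √c / s) :
    constraint c s - halfBal σ = (volume.restrict (Iic 0)).withDensity
      (fun x => ENNReal.ofReal (deficit σ c s x)) := by
  rw [constraint_eq_add hα hσ h, Measure.add_sub_cancel]

lemma tendsto_sqrt_mul_deficit [IsProbabilityMeasure σ] (hα : 0 < α) (hσ : ∀ᵐ u ∂σ, α ≤ u) :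
    Tendsto (fun x => √|x| * deficit σ c s x) (𝓝[<] 0)
      (𝓝 ((√c / s - balFactor σ 0 / 2) / Real.pi)) := by
  have hcont : Continuous fun x => (√c / s - balFactor σ x / 2) / Real.pi :=
    ((continuous_const.sub ((continuous_balFactor hα hσ).div_const 2)).div_const _)
  refine ((hcont.tendsto 0).mono_left nhdsWithin_le_nhds).congr' ?_
  filter_upwards [self_mem_nhdsWithin] with x hx
  have : 0 < √|x| := Real.sqrt_pos.2 (abs_pos.2 (ne_of_lt hx))
  rw [deficit]
  field_simp

lemma support_restrict_Iic : ((volume : Measure ℝ).restrict (Iic 0)).support = Iic 0 := by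
  refine Subset.antisymm ?_ ?_
  · exact Measure.support_subset_of_isClosed isClosed_Iic (ae_restrict_mem measurableSet_Iic)
  · have h1 : Iio (0 : ℝ) ⊆ ((volume : Measure ℝ).restrict (Iic 0)).support := by
      have := Measure.interior_inter_support (μ := (volume : Measure ℝ)) (s := Iic (0 : ℝ))
      rwa [interior_Iic, Measure.support_eq_univ, inter_univ] at this
    have h2 := Measure.isClosed_support.closure_subset_iff.2 h1
    rwa [closure_Iio] at h2

lemma support_deficit [IsProbabilityMeasure σ] (hα : 0 < α) (hσ : ∀ᵐ u ∂σ, α ≤ u)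
    (h : balFactor σ 0 / 2 < √c / s) : (constraint c s - halfBal σ).support = Iic 0 := by
  have hx : ∀ x, balFactor σ x / 2 < √c / s := fun x => by
    linarith [balFactor_le_zero hα hσ x]
  rw [constraint_sub_halfBal hα hσ fun x => (hx x).le]
  refine Subset.antisymm ?_ ?_
  · refine Measure.support_subset_of_isClosed isClosed_Iic ?_
    exact (withDensity_absolutelyContinuous _ _).ae_le (ae_restrict_mem measurableSet_Iic)
  · have hm : AEMeasurable (fun x => ENNReal.ofReal (deficit σ c s x))
        (volume.restrict (Iic (0 : ℝ))) := measurable_deficit.ennreal_ofReal.aemeasurable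
    refine support_restrict_Iic.symm.subset.trans
      (Measure.AbsolutelyContinuous.support_mono (withDensity_absolutelyContinuous' hm ?_))
    have hne : ∀ᵐ x ∂(volume.restrict (Iic (0 : ℝ))), x ≠ 0 := by rw [ae_iff]; simp
    filter_upwards [hne] with x hx0
    rw [ENNReal.ofReal_ne_zero_iff]
    have h1 : 0 < √c / s - balFactor σ x / 2 := by linarith [hx x]
    have h2 : 0 < √|x| := Real.sqrt_pos.2 (abs_pos.2 hx0)
    unfold deficit; positivity

lemma invSqrtBlowup_deficit [IsProbabilityMeasure σ] (hα : 0 < α) (hσ : ∀ᵐ u ∂σ, α ≤ u)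
    (h : balFactor σ 0 / 2 < √c / s) : InvSqrtBlowup (constraint c s - halfBal σ) := by
  have hx : ∀ x, balFactor σ x / 2 < √c / s := fun x => by
    linarith [balFactor_le_zero hα hσ x]
  refine ⟨deficit σ c s, measurable_deficit, fun x => ?_, constraint_sub_halfBal hα hσ fun x =>
    (hx x).le, _, ?_, tendsto_sqrt_mul_deficit hα hσ⟩
  · have h1 : 0 < √c / s - balFactor σ x / 2 := by linarith [hx x]
    unfold deficit; positivity
  · exact div_pos (by linarith) Real.pi_pos

/-- Any density of the difference agrees almost everywhere with `deficit`, so its blow-up constant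
is that of `deficit`; positivity of the constant is the strict inequality. -/
lemma lt_of_invSqrtBlowup [IsProbabilityMeasure σ] (hα : 0 < α) (hσ : ∀ᵐ u ∂σ, α ≤ u)
    (hle : halfBal σ ≤ constraint c s) (hs : 0 < s)
    (h : InvSqrtBlowup (constraint c s - halfBal σ)) : balFactor σ 0 / 2 < √c / s := by
  obtain ⟨g, hg, hg0, hgσ, C, hC, hlim⟩ := h
  have hbm : Measurable fun x => ENNReal.ofReal (balFactor σ x / 2 / Real.pi / √|x|) :=
    (((measurable_balFactor.div_const 2).div_const _).div (by fun_prop)).ennreal_ofReal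
  have hb0 : ∀ x, 0 ≤ balFactor σ x := fun x => by
    refine integral_nonneg_of_ae ?_
    filter_upwards [hσ] with u hu
    have hu0 := hα.trans_le hu
    change 0 ≤ _
    positivity
  have heq : (volume.restrict (Iic (0 : ℝ))).withDensity
      (fun x => ENNReal.ofReal (√c / (Real.pi * s) / √|x|)) =
      (volume.restrict (Iic (0 : ℝ))).withDensity
        ((fun x => ENNReal.ofReal (g x)) +
          fun x => ENNReal.ofReal (balFactor σ x / 2 / Real.pi / √|x|)) := by
    rw [withDensity_add_left hg.ennreal_ofReal, ← hgσ, ← halfBal_eq_withDensity hα hσ,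
      Measure.sub_add_cancel_of_le hle]
    rfl
  have hae := (withDensity_eq_iff_of_sigmaFinite (by fun_prop)
    (hg.ennreal_ofReal.add hbm).aemeasurable).1 heq
  have hae' : ∀ᵐ x ∂(volume.restrict (Iio (0 : ℝ))), g x = deficit σ c s x := by
    have h1 : ∀ᵐ x ∂(volume.restrict (Iio (0 : ℝ))), ENNReal.ofReal (√c / (Real.pi * s) / √|x|) =
        ((fun x => ENNReal.ofReal (g x)) +
          fun x => ENNReal.ofReal (balFactor σ x / 2 / Real.pi / √|x|)) x :=
      ae_mono (Measure.restrict_mono Iio_subset_Iic_self le_rfl) hae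
    filter_upwards [h1] with x hx
    have hbx := hb0 x
    rw [Pi.add_apply, ← ENNReal.ofReal_add (hg0 x) (by positivity),
      ENNReal.ofReal_eq_ofReal_iff (by positivity) (add_nonneg (hg0 x) (by positivity))] at hx
    rw [deficit, sub_div, sub_div, div_div (√c), mul_comm s, hx]
    ring
  have hlim2 := tendsto_sqrt_mul_deficit (c := c) (s := s) hα hσ
  -- Almost everywhere equality yields points of equality in every left neighbourhood of `0`, which
  -- is enough to identify two existing limits.
  have hfreq : ∃ᶠ x in 𝓝[<] (0 : ℝ), g x = deficit σ c s x := by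
    intro hev
    rw [eventually_iff, mem_nhdsLT_iff_exists_Ioo_subset] at hev
    obtain ⟨l, hl, hsub⟩ := hev
    have h0 : (volume.restrict (Iio (0 : ℝ))) {x | ¬ g x = deficit σ c s x} = 0 := hae'
    have h1 : (volume.restrict (Iio (0 : ℝ))) (Ioo l 0) = 0 := measure_mono_null hsub h0
    rw [Measure.restrict_apply measurableSet_Ioo,
      inter_eq_left.2 (Ioo_subset_Iio_self (a := l) (b := (0 : ℝ))), Real.volume_Ioo,
      ENNReal.ofReal_eq_zero] at h1
    have : l < 0 := hl
    linarith
  have hCeq : C = (√c / s - balFactor σ 0 / 2) / Real.pi := by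
    by_contra hne
    have hd := hlim.sub hlim2
    have hne0 : C - (√c / s - balFactor σ 0 / 2) / Real.pi ≠ 0 := sub_ne_zero.2 hne
    have hev := hd.eventually_ne hne0
    obtain ⟨x, hx1, hx2⟩ := (hfreq.and_eventually hev).exists
    rw [hx1, sub_self] at hx2
    exact hx2 rfl
  rw [hCeq] at hC
  have := (div_pos_iff_of_pos_right Real.pi_pos).1 hC
  linarith

/-! ### Algebra of the phase condition -/

variable {a b t : ℝ}

lemma center_pos (ha : 0 < a) (hb : 0 < b) (ht₀ : 0 < t) (ht₁ : t < 1) : 0 < center a b t := by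
  have h1 := Real.sqrt_pos.2 ha
  have h2 := Real.sqrt_pos.2 hb
  have : 0 < 1 - t := by linarith
  unfold center; positivity

lemma quarter_lt_iff (ha : 0 < a) : 1 / 4 < a * b ↔ 1 / 2 < √a * √b := by
  rw [← Real.sqrt_mul ha.le, Real.lt_sqrt (by norm_num)]
  norm_num

/-- By the arithmetic–geometric mean inequality `m² ≥ 4t(1 - t)√(ab)`, which exceeds `R² = 2t(1 -
t)`. -/
lemma radius_lt_center (ha : 0 < a) (hb : 0 < b) (ht₀ : 0 < t) (ht₁ : t < 1)
    (h : 1 / 4 < a * b) : radius t < center a b t := by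
  have h' := (quarter_lt_iff ha).1 h
  have hu : 0 < 1 - t := by linarith
  refine lt_of_pow_lt_pow_left₀ 2 (center_pos ha hb ht₀ ht₁).le ?_
  rw [radius_sq ht₀ ht₁, center]
  have h3 : 0 < t * (1 - t) := mul_pos ht₀ hu
  nlinarith [sq_nonneg ((1 - t) * √a - t * √b)]

/-- The two inequalities bound `t√b - (1 - t)√a` above and below by `±√(m² - R²)`. Squaring merges
them into one condition, in which `t` survives only as a positive factor. -/
lemma phase_condition (ha : 0 < a) (ht₀ : 0 < t) (ht₁ : t < 1)
    (hR : radius t < center a b t) :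
    (balFactor (semicircle (center a b t) (radius t)) 0 / 2 < √a / t ∧
      balFactor (semicircle (center a b t) (radius t)) 0 / 2 < √b / (1 - t)) ↔ 1 / 4 < a * b := by
  have hR0 := radius_pos ht₀ ht₁
  have hu : 0 < 1 - t := by linarith
  have htu : 0 < t * (1 - t) := mul_pos ht₀ hu
  rw [balFactor_zero, integral_inv_semicircle hR0 hR, radius_sq ht₀ ht₁, quarter_lt_iff ha]
  have hpos : 0 < center a b t ^ 2 - 2 * t * (1 - t) := by
    rw [← radius_sq ht₀ ht₁]; nlinarith
  set r := √(center a b t ^ 2 - 2 * t * (1 - t)) with hr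
  have hr0 : 0 < r := Real.sqrt_pos.2 hpos
  have hr2 : r ^ 2 = center a b t ^ 2 - 2 * t * (1 - t) := Real.sq_sqrt hpos.le
  have e1 : 2 / (2 * t * (1 - t)) * (center a b t - r) / 2 =
      (center a b t - r) / (2 * (1 - t)) / t := by field_simp
  have e2 : 2 / (2 * t * (1 - t)) * (center a b t - r) / 2 =
      (center a b t - r) / (2 * t) / (1 - t) := by field_simp
  have h1 : 2 / (2 * t * (1 - t)) * (center a b t - r) / 2 < √a / t ↔
      t * √b - (1 - t) * √a < r := by
    rw [e1, div_lt_div_iff_of_pos_right ht₀, div_lt_iff₀ (by positivity), center]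
    constructor <;> intro h <;> linarith
  have h2 : 2 / (2 * t * (1 - t)) * (center a b t - r) / 2 < √b / (1 - t) ↔
      (1 - t) * √a - t * √b < r := by
    rw [e2, div_lt_div_iff_of_pos_right hu, div_lt_iff₀ (by positivity), center]
    constructor <;> intro h <;> linarith
  rw [h1, h2]
  have h3 : r ^ 2 - (t * √b - (1 - t) * √a) ^ 2 = 4 * (t * (1 - t)) * (√a * √b - 1 / 2) := by
    rw [hr2, center]; ring
  constructor
  · rintro ⟨h4, h5⟩
    have h6 : (t * √b - (1 - t) * √a) ^ 2 < r ^ 2 := sq_lt_sq' (by linarith) h4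
    by_contra hle
    have h7 : √a * √b - 1 / 2 ≤ 0 := by linarith
    have := mul_nonpos_of_nonneg_of_nonpos (by positivity : 0 ≤ 4 * (t * (1 - t))) h7
    linarith
  · intro h4
    have h7 : 0 < √a * √b - 1 / 2 := by linarith
    have := mul_pos (by positivity : 0 < 4 * (t * (1 - t))) h7
    have h8 := abs_lt_of_sq_lt_sq (by linarith : (t * √b - (1 - t) * √a) ^ 2 < r ^ 2) hr0.le
    obtain ⟨h9, h10⟩ := abs_lt.1 h8
    exact ⟨h10, by linarith⟩

end

section

/-! ### The explicit minimizer -/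

variable {a b t : ℝ} {σ l : Measure ℝ} {α B : ℝ}

lemma ae_mem_of_carrier {μ : Measure ℝ} {S : Set ℝ} (h : μ Sᶜ = 0) : ∀ᵐ x ∂μ, x ∈ S := h

lemma ae_abs_le_of_mem_Icc (hα : 0 < α) (hσ : ∀ᵐ u ∂σ, u ∈ Icc α B) : ∀ᵐ u ∂σ, |u| ≤ B := by
  filter_upwards [hσ] with u hu
  rw [abs_of_nonneg (hα.le.trans hu.1)]
  exact hu.2

/-- Measures on `(-∞, 0]` do not distinguish a measure from its balayage. -/
lemma mutualEnergy_halfBal [IsProbabilityMeasure σ] [IsFiniteMeasure l] (hα : 0 < α)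
    (hσ : ∀ᵐ u ∂σ, u ∈ Icc α B) (hl : l (Iic 0)ᶜ = 0) (h1 : FiniteEnergy l (halfBal σ))
    (h2 : FiniteEnergy l (sqMap σ)) :
    2 * mutualEnergy l (halfBal σ) = mutualEnergy l (sqMap σ) := by
  rw [h1.mutualEnergy_eq, h2.mutualEnergy_eq, ← integral_const_mul]
  refine integral_congr_ae ?_
  filter_upwards [ae_mem_of_carrier hl] with x hx
  rw [potential_halfBal, potential_balayage_of_nonpos hα hσ hx, mul_div_cancel₀ _ two_ne_zero]
  rfl

/-- The total field acting on the second measure when the outer measures are the half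
balayages of `sqMap σ`. -/
def totalField (a b t : ℝ) (σ : Measure ℝ) (x : ℝ) : ℝ :=
  2 * potential (sqMap σ) x - potential (balayage σ) x + externalField a b t x

lemma integrable_totalField [IsProbabilityMeasure σ] [IsFiniteMeasure l]
    (h1 : FiniteEnergy l (halfBal σ)) (h2 : FiniteEnergy l (sqMap σ))
    (h3 : Integrable (externalField a b t) l) : Integrable (totalField a b t σ) l := by
  have h4 := h1.integrable_potential.const_mul 2
  simp_rw [potential_halfBal, mul_div_cancel₀ _ (two_ne_zero (α := ℝ))] at h4
  exact ((h2.integrable_potential.const_mul 2).sub h4).add h3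

lemma integral_totalField [IsProbabilityMeasure σ] [IsFiniteMeasure l]
    (h1 : FiniteEnergy l (halfBal σ)) (h2 : FiniteEnergy l (sqMap σ))
    (h3 : Integrable (externalField a b t) l) :
    ∫ x, totalField a b t σ x ∂l = 2 * mutualEnergy l (sqMap σ) - 2 * mutualEnergy l (halfBal σ) +
      ∫ x, externalField a b t x ∂l := by
  have h4 := h1.integrable_potential.const_mul 2
  rw [h1.mutualEnergy_eq, h2.mutualEnergy_eq, ← integral_const_mul, ← integral_const_mul]
  simp_rw [potential_halfBal, mul_div_cancel₀ _ (two_ne_zero (α := ℝ))] at h4 ⊢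
  rw [← integral_sub (h2.integrable_potential.const_mul 2) h4]
  exact integral_add ((h2.integrable_potential.const_mul 2).sub h4) h3

lemma totalField_sq [IsProbabilityMeasure σ] [NullSingletonClass σ] (ha : 0 < a) (hb : 0 < b)
    (ht₀ : 0 < t) (ht₁ : t < 1) {y : ℝ} (hα : 0 < α) (hσ : ∀ᵐ u ∂σ, u ∈ Icc α B) (hy : 0 ≤ y)
    (hint : Integrable (fun u => -Real.log |y - u|) σ) :
    totalField a b t σ (y ^ 2) = 2 * potential σ y + 2 * (y - center a b t) ^ 2 / radius t ^ 2 -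
      2 * center a b t ^ 2 / radius t ^ 2 := by
  rw [totalField, potential_sqMap_sub_balayage hα hσ hy hint, externalField_sq ha hb ht₀ ht₁ hy]
  ring

/-- The semicircle law of the extremal problem. -/
def extremal (a b t : ℝ) : Measure ℝ := semicircle (center a b t) (radius t)

instance : IsProbabilityMeasure (extremal a b t) := by unfold extremal; infer_instance

lemma extremal_ae_mem (ht₀ : 0 < t) (ht₁ : t < 1) : ∀ᵐ u ∂(extremal a b t),
    u ∈ Icc (center a b t - radius t) (center a b t + radius t) :=
  ae_semicircle_mem (radius_pos ht₀ ht₁) _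

lemma extremal_nullSingleton (ht₀ : 0 < t) (ht₁ : t < 1) : NullSingletonClass (extremal a b t) :=
  (logRegular_semicircle (radius_pos ht₀ ht₁) _).noAtoms

lemma totalField_extremal_ge (ha : 0 < a) (hb : 0 < b) (ht₀ : 0 < t) (ht₁ : t < 1)
    (hR : radius t < center a b t) {x : ℝ} (hx : 0 ≤ x) :
    semicircleConst (radius t) - 2 * center a b t ^ 2 / radius t ^ 2 ≤
      totalField a b t (extremal a b t) x := by
  have hR0 := radius_pos ht₀ ht₁
  have := extremal_nullSingleton (a := a) (b := b) ht₀ ht₁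
  rw [← Real.sq_sqrt hx, totalField_sq ha hb ht₀ ht₁ (sub_pos.2 hR) (extremal_ae_mem ht₀ ht₁)
    (Real.sqrt_nonneg x) (integrable_log_semicircle hR0 _ _)]
  exact sub_le_sub_right (semicircleConst_le hR0 _ _) _

lemma totalField_extremal_eq (ha : 0 < a) (hb : 0 < b) (ht₀ : 0 < t) (ht₁ : t < 1)
    (hR : radius t < center a b t) {y : ℝ}
    (hy : y ∈ Icc (center a b t - radius t) (center a b t + radius t)) :
    totalField a b t (extremal a b t) (y ^ 2) =
      semicircleConst (radius t) - 2 * center a b t ^ 2 / radius t ^ 2 := by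
  have hR0 := radius_pos ht₀ ht₁
  have := extremal_nullSingleton (a := a) (b := b) ht₀ ht₁
  rw [totalField_sq ha hb ht₀ ht₁ (sub_pos.2 hR) (extremal_ae_mem ht₀ ht₁)
    (by linarith [hy.1]) (integrable_log_semicircle hR0 _ _), extremal,
    semicircleConst_eq hR0 hy]

/-! ### Finite mass and logarithmic moments of competitors. -/

section Admissible

variable {ν₁ ν₂ ν₃ : Measure ℝ}

lemma Admissible.isFiniteMeasure₁ (h : Admissible a b t ν₁ ν₂ ν₃) : IsFiniteMeasure ν₁ :=
  ⟨by rw [h.mass₁]; simp⟩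

lemma Admissible.isProbabilityMeasure₂ (h : Admissible a b t ν₁ ν₂ ν₃) :
    IsProbabilityMeasure ν₂ := ⟨h.mass₂⟩

lemma Admissible.isFiniteMeasure₃ (h : Admissible a b t ν₁ ν₂ ν₃) : IsFiniteMeasure ν₃ :=
  ⟨by rw [h.mass₃]; simp⟩

lemma Admissible.logMoment₂ (h : Admissible a b t ν₁ ν₂ ν₃) : LogMoment ν₂ := by
  have := h.isProbabilityMeasure₂
  exact h.finite₂₂.logMoment

lemma Admissible.logMoment₁ (h : Admissible a b t ν₁ ν₂ ν₃) : LogMoment ν₁ := by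
  have := h.isFiniteMeasure₁
  have := h.isProbabilityMeasure₂
  exact h.finite₁₂.symm.logMoment

lemma Admissible.logMoment₃ (h : Admissible a b t ν₁ ν₂ ν₃) : LogMoment ν₃ := by
  have := h.isFiniteMeasure₃
  have := h.isProbabilityMeasure₂
  exact h.finite₂₃.logMoment

end Admissible

lemma logRegular_sqMap_extremal (ht₀ : 0 < t) (ht₁ : t < 1) (hR : radius t < center a b t) :
    LogRegular (sqMap (extremal a b t)) :=
  (logRegular_semicircle (radius_pos ht₀ ht₁) _).sqMap
    ((extremal_ae_mem ht₀ ht₁).mono fun u hu => by linarith [hu.1])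

lemma logMoment_sqMap_extremal (ht₀ : 0 < t) (ht₁ : t < 1) (hR : radius t < center a b t) :
    LogMoment (sqMap (extremal a b t)) :=
  logMoment_sqMap (ae_abs_le_of_mem_Icc (sub_pos.2 hR) (extremal_ae_mem ht₀ ht₁))

lemma halfBal_le_constraint [IsProbabilityMeasure σ] {c s : ℝ} (hα : 0 < α)
    (hσ : ∀ᵐ u ∂σ, α ≤ u) (h : balFactor σ 0 / 2 < √c / s) : halfBal σ ≤ constraint c s := by
  rw [constraint_eq_add hα hσ fun x => by linarith [balFactor_le_zero hα hσ x]]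
  exact Measure.le_add_left le_rfl

lemma admissible_extremal (ha : 0 < a) (ht₀ : 0 < t) (ht₁ : t < 1)
    (hR : radius t < center a b t) (hab : 1 / 4 < a * b) :
    Admissible a b t (halfBal (extremal a b t)) (sqMap (extremal a b t))
      (halfBal (extremal a b t)) := by
  have hα := sub_pos.2 hR
  have hσ := extremal_ae_mem (a := a) (b := b) ht₀ ht₁
  have hσ' : ∀ᵐ u ∂(extremal a b t), center a b t - radius t ≤ u := hσ.mono fun u hu => hu.1
  have hp := (phase_condition ha ht₀ ht₁ hR).2 hab
  have r1 := logRegular_halfBal hα hσ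
  have r2 := logRegular_sqMap_extremal ht₀ ht₁ hR
  have m1 := logMoment_halfBal hα hσ
  have m2 := logMoment_sqMap_extremal ht₀ ht₁ hR
  exact
    { carrier₁ := halfBal_carrier
      mass₁ := halfBal_univ
      le₁ := halfBal_le_constraint hα hσ' hp.1
      carrier₂ := sqMap_carrier _
      mass₂ := measure_univ
      carrier₃ := halfBal_carrier
      mass₃ := halfBal_univ
      le₃ := halfBal_le_constraint hα hσ' hp.2
      finite₁₁ := r1.finiteEnergy m1 m1
      finite₂₂ := r2.finiteEnergy m2 m2
      finite₃₃ := r1.finiteEnergy m1 m1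
      finite₁₂ := r2.finiteEnergy m1 m2
      finite₂₃ := r1.finiteEnergy m2 m1
      finite_field := integrable_externalField_of_bounded
        (ae_sqMap_abs_le (ae_abs_le_of_mem_Icc hα hσ)) }

/-- Positivity of the energy of `(ν - ν') - (l - l') / 2`. -/
lemma energy_half_nonneg {ν ν' l l' : Measure ℝ} [IsFiniteMeasure ν] [IsFiniteMeasure ν']
    [IsFiniteMeasure l] [IsFiniteMeasure l'] (hν : ν univ = ν' univ) (hl : l univ = l' univ)
    (h1 : FiniteEnergy ν ν) (h2 : FiniteEnergy ν' ν') (h3 : FiniteEnergy l l)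
    (h4 : FiniteEnergy l' l') (h5 : FiniteEnergy ν ν') (h6 : FiniteEnergy ν l)
    (h7 : FiniteEnergy ν l') (h8 : FiniteEnergy ν' l) (h9 : FiniteEnergy ν' l')
    (h10 : FiniteEnergy l l') (D : ℝ) (hD : D = mutualEnergy ν ν + mutualEnergy ν' ν' - 2 * mutualEnergy ν ν' +
      (mutualEnergy l l + mutualEnergy l' l' - 2 * mutualEnergy l l') / 4 -
      (mutualEnergy ν l - mutualEnergy ν l' - mutualEnergy ν' l + mutualEnergy ν' l')) :
    0 ≤ D ∧ (D = 0 → l = l' → ν = ν') := by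
  have : ∀ i, IsFiniteMeasure ((![ν, ν', l, l'] : Fin 4 → Measure ℝ) i) := by
    intro i; fin_cases i <;> assumption
  have key := sum_mutualEnergy_nonneg (![ν, ν', l, l'] : Fin 4 → Measure ℝ)
    ![1, -1, -(1 / 2), 1 / 2] (by
      simp [Fin.sum_univ_four, measureReal_def, hν, hl]) (by
      intro i j; fin_cases i <;> fin_cases j <;>
        simp [h1, h2, h3, h4, h5, h6, h7, h8, h9, h10, h5.symm, h6.symm, h7.symm, h8.symm, h9.symm,
          h10.symm])
  simp only [Fin.sum_univ_four, Matrix.cons_val_zero, Matrix.cons_val_one, Matrix.cons_val] at key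
  rw [mutualEnergy_comm ν' ν, mutualEnergy_comm l ν, mutualEnergy_comm l' ν, mutualEnergy_comm l ν',
    mutualEnergy_comm l' ν', mutualEnergy_comm l' l] at key
  refine ⟨by linarith [key.1], fun hD0 hll => ?_⟩
  subst hll
  refine Measure.ext_of_charFun (funext fun ξ => ?_)
  have := key.2 (by linarith) ξ
  push_cast at this
  linear_combination this

/-- For `a b > 1 / 4` every minimizer is the explicit one. -/
theorem eq_extremal_of_isMinimizer (ha : 0 < a) (hb : 0 < b) (ht₀ : 0 < t) (ht₁ : t < 1)
    (hR : radius t < center a b t) (hab : 1 / 4 < a * b) {ν₁ ν₂ ν₃ : Measure ℝ}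
    (h : IsMinimizer a b t ν₁ ν₂ ν₃) :
    ν₁ = halfBal (extremal a b t) ∧ ν₂ = sqMap (extremal a b t) ∧
      ν₃ = halfBal (extremal a b t) := by
  have hα := sub_pos.2 hR
  have hσ := extremal_ae_mem (a := a) (b := b) ht₀ ht₁
  have hadm := admissible_extremal ha ht₀ ht₁ hR hab
  have r1 := logRegular_halfBal hα hσ
  have r2 := logRegular_sqMap_extremal ht₀ ht₁ hR
  have m1 := logMoment_halfBal hα hσ
  have m2 := logMoment_sqMap_extremal ht₀ ht₁ hR
  have hE := h.2 _ _ _ hadm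
  have hν := h.1
  have := hν.isFiniteMeasure₁
  have := hν.isProbabilityMeasure₂
  have := hν.isFiniteMeasure₃
  have n1 := hν.logMoment₁
  have n2 := hν.logMoment₂
  have n3 := hν.logMoment₃
  have hge : semicircleConst (radius t) - 2 * center a b t ^ 2 / radius t ^ 2 ≤
      ∫ x, totalField a b t (extremal a b t) x ∂ν₂ := by
    have hi := integrable_totalField (r1.finiteEnergy n2 m1) (r2.finiteEnergy n2 m2) hν.finite_field
    have := integral_mono_ae (integrable_const _) hi
      ((ae_mem_of_carrier hν.carrier₂).mono fun x hx =>
        totalField_extremal_ge ha hb ht₀ ht₁ hR hx)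
    simpa using this
  have heq : ∫ x, totalField a b t (extremal a b t) x ∂(sqMap (extremal a b t)) =
      semicircleConst (radius t) - 2 * center a b t ^ 2 / radius t ^ 2 := by
    have hi := integrable_totalField (r1.finiteEnergy m2 m1) (r2.finiteEnergy m2 m2)
      hadm.finite_field
    have : ∀ᵐ x ∂(sqMap (extremal a b t)), totalField a b t (extremal a b t) x =
        semicircleConst (radius t) - 2 * center a b t ^ 2 / radius t ^ 2 := by
      have hc : sqMap (extremal a b t)
          (Icc ((center a b t - radius t) ^ 2) ((center a b t + radius t) ^ 2))ᶜ = 0 := by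
        have hR0 := radius_pos ht₀ ht₁
        rw [sqMap, Measure.map_apply measurable_sq measurableSet_Icc.compl]
        refine measure_mono_null (fun u hu => ?_) hσ
        intro (hu' : u ∈ Icc _ _)
        exact hu ⟨pow_le_pow_left₀ hα.le hu'.1 2, pow_le_pow_left₀ (by linarith [hu'.1]) hu'.2 2⟩
      filter_upwards [ae_mem_of_carrier hc] with x hx
      have hx0 : 0 ≤ x := (sq_nonneg _).trans hx.1
      have hR0 := radius_pos ht₀ ht₁
      rw [← Real.sq_sqrt hx0]
      refine totalField_extremal_eq ha hb ht₀ ht₁ hR ⟨Real.le_sqrt_of_sq_le hx.1, ?_⟩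
      exact (Real.sqrt_le_left (by linarith)).2 hx.2
    rw [integral_congr_ae this]
    simp
  rw [integral_totalField (r1.finiteEnergy n2 m1) (r2.finiteEnergy n2 m2) hν.finite_field] at hge
  rw [integral_totalField (r1.finiteEnergy m2 m1) (r2.finiteEnergy m2 m2) hadm.finite_field] at heq
  -- By the balayage identity the linear terms of the outer measures in the energy difference
  -- vanish.
  have f1 := mutualEnergy_halfBal hα hσ hν.carrier₁ (r1.finiteEnergy n1 m1) (r2.finiteEnergy n1 m2)
  have f3 := mutualEnergy_halfBal hα hσ hν.carrier₃ (r1.finiteEnergy n3 m1) (r2.finiteEnergy n3 m2)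
  have f2 := mutualEnergy_halfBal hα hσ halfBal_carrier (r1.finiteEnergy m1 m1)
    (r2.finiteEnergy m1 m2)
  -- The quadratic part of the energy difference is `D1 + D3 + D2 / 2`. The third use takes `l =
  -- l'`, which leaves the energy of `ν₂` minus the extremal measure. Minimality forces all three to
  -- vanish.
  have D1 := energy_half_nonneg (hν.mass₁.trans halfBal_univ.symm)
    (hν.mass₂.trans hadm.mass₂.symm) hν.finite₁₁ hadm.finite₁₁ hν.finite₂₂ hadm.finite₂₂
    (r1.finiteEnergy n1 m1) hν.finite₁₂ (r2.finiteEnergy n1 m2) (r1.finiteEnergy n2 m1).symm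
    hadm.finite₁₂ (r2.finiteEnergy n2 m2) _ rfl
  have D3 := energy_half_nonneg (hν.mass₃.trans halfBal_univ.symm)
    (hν.mass₂.trans hadm.mass₂.symm) hν.finite₃₃ hadm.finite₁₁ hν.finite₂₂ hadm.finite₂₂
    (r1.finiteEnergy n3 m1) hν.finite₂₃.symm (r2.finiteEnergy n3 m2) (r1.finiteEnergy n2 m1).symm
    hadm.finite₁₂ (r2.finiteEnergy n2 m2) _ rfl
  have D2 := energy_half_nonneg (hν.mass₂.trans hadm.mass₂.symm)
    (hadm.mass₂.trans hadm.mass₂.symm) hν.finite₂₂ hadm.finite₂₂ hadm.finite₂₂ hadm.finite₂₂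
    (r2.finiteEnergy n2 m2) (r2.finiteEnergy n2 m2) (r2.finiteEnergy n2 m2) hadm.finite₂₂
    hadm.finite₂₂ hadm.finite₂₂ _ rfl
  unfold energy at hE
  rw [mutualEnergy_comm ν₂ ν₃] at hE
  rw [mutualEnergy_comm (sqMap (extremal a b t)) (halfBal (extremal a b t))] at hE heq
  rw [mutualEnergy_comm ν₂ (halfBal (extremal a b t))] at hge
  have e2 : ν₂ = sqMap (extremal a b t) := D2.2 (by linarith [D1.1, D2.1, D3.1]) rfl
  exact ⟨D1.2 (by linarith [D1.1, D2.1, D3.1]) e2, e2, D3.2 (by linarith [D1.1, D2.1, D3.1]) e2⟩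

lemma support_sqMap_extremal (ht₀ : 0 < t) (ht₁ : t < 1) (hR : radius t < center a b t) :
    (sqMap (extremal a b t)).support =
      Icc ((center a b t - radius t) ^ 2) ((center a b t + radius t) ^ 2) := by
  have hR0 := radius_pos ht₀ ht₁
  have hα := sub_pos.2 hR
  refine Subset.antisymm (Measure.support_subset_of_isClosed isClosed_Icc ?_) ?_
  · have hmem : ∀ᵐ u ∂(extremal a b t),
        u ^ 2 ∈ Icc ((center a b t - radius t) ^ 2) ((center a b t + radius t) ^ 2) := by
      filter_upwards [extremal_ae_mem ht₀ ht₁] with u hu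
      exact ⟨pow_le_pow_left₀ hα.le hu.1 2, pow_le_pow_left₀ (hα.le.trans hu.1) hu.2 2⟩
    exact (ae_map_iff measurable_sq.aemeasurable measurableSet_Icc).2 hmem
  · have hIoo : Ioo ((center a b t - radius t) ^ 2) ((center a b t + radius t) ^ 2) ⊆
        (sqMap (extremal a b t)).support := by
      intro x hx
      have hx0 : 0 ≤ x := (sq_nonneg _).trans hx.1.le
      rw [Measure.support_eq_forall_isOpen]
      intro U hxU hU
      rw [sqMap, Measure.map_apply measurable_sq hU.measurableSet]
      refine semicircle_pos_of_isOpen hR0 (x := √x) ⟨Real.lt_sqrt_of_sq_lt hx.1, ?_⟩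
        (hU.preimage (by fun_prop)) ?_
      · exact (Real.sqrt_lt' (by linarith)).2 hx.2
      · change √x ^ 2 ∈ U
        rwa [Real.sq_sqrt hx0]
    have hlt : (center a b t - radius t) ^ 2 < (center a b t + radius t) ^ 2 := by nlinarith
    rw [← closure_Ioo hlt.ne]
    exact Measure.isClosed_support.closure_subset_iff.2 hIoo

/-- For `a b > 1 / 4` every minimizer is in Case I. -/
theorem isCaseI_of_quarter_lt (ha : 0 < a) (hb : 0 < b) (ht₀ : 0 < t) (ht₁ : t < 1)
    (hab : 1 / 4 < a * b) {ν₁ ν₂ ν₃ : Measure ℝ} (h : IsMinimizer a b t ν₁ ν₂ ν₃) :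
    IsCaseI a b t ν₁ ν₂ ν₃ := by
  have hR := radius_lt_center ha hb ht₀ ht₁ hab
  have hR0 := radius_pos ht₀ ht₁
  obtain ⟨rfl, rfl, rfl⟩ := eq_extremal_of_isMinimizer ha hb ht₀ ht₁ hR hab h
  have hα := sub_pos.2 hR
  have hσ' : ∀ᵐ u ∂(extremal a b t), center a b t - radius t ≤ u :=
    (extremal_ae_mem ht₀ ht₁).mono fun u hu => hu.1
  have hp := (phase_condition ha ht₀ ht₁ hR).2 hab
  exact ⟨support_deficit hα hσ' hp.1, support_deficit hα hσ' hp.2,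
    ⟨_, _, by positivity, by nlinarith, support_sqMap_extremal ht₀ ht₁ hR⟩,
    invSqrtBlowup_deficit hα hσ' hp.1, invSqrtBlowup_deficit hα hσ' hp.2⟩

end

section

/-! ### Variations of a minimizer -/

lemma nonneg_of_forall_quadratic {L Q ε₀ : ℝ} (h₀ : 0 < ε₀)
    (h : ∀ ε, 0 < ε → ε ≤ ε₀ → 0 ≤ ε * L + ε ^ 2 * Q) : 0 ≤ L := by
  by_contra! hL
  set ε := min ε₀ (-L / (2 * (|Q| + 1))) with hε
  have hQ : 0 < |Q| + 1 := by positivity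
  have h1 : 0 < ε := lt_min h₀ (div_pos (by linarith) (by linarith))
  have h2 : ε * (|Q| + 1) ≤ -L / 2 := by
    have : ε ≤ -L / (2 * (|Q| + 1)) := min_le_right _ _
    rw [le_div_iff₀ (by linarith)] at this
    linarith
  have h3 := h ε h1 (min_le_left _ _)
  have h4 : 0 ≤ L + ε * Q := by
    have : 0 ≤ ε * (L + ε * Q) := by linarith
    exact nonneg_of_mul_nonneg_right this h1
  have h5 := mul_le_mul_of_nonneg_left (le_abs_self Q) h1.le
  linarith

/-- First order condition for a quadratic functional `ν ↦ I(ν, ν) + F ν` with `F` affine along the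
variation. -/
lemma first_variation {μ κ : Measure ℝ} [IsFiniteMeasure μ] [IsFiniteMeasure κ]
    (h1 : FiniteEnergy μ μ) (h2 : FiniteEnergy κ κ) (h3 : FiniteEnergy μ κ) {r : NNReal} {F G : ℝ}
    (h : ∀ ε : NNReal, ε ≤ 1 → ε * r ≤ 1 → mutualEnergy μ μ + F ≤
      mutualEnergy ((1 - ε) • μ + (ε * r) • κ) ((1 - ε) • μ + (ε * r) • κ) +
        ((1 - ε : NNReal) * F + ((ε * r : NNReal) : ℝ) * G)) :
    2 * mutualEnergy μ μ + F ≤ r * (2 * mutualEnergy μ κ + G) := by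
  have hr : 0 ≤ (r : ℝ) := r.2
  suffices 0 ≤ r * (2 * mutualEnergy μ κ + G) - (2 * mutualEnergy μ μ + F) by linarith
  -- For `ε ≤ 1/(1 + r)` both `ε ≤ 1` and `ε r ≤ 1` hold, so the perturbation is allowed.
  refine nonneg_of_forall_quadratic (ε₀ := 1 / (1 + r)) (by positivity)
    (Q := mutualEnergy μ μ - 2 * r * mutualEnergy μ κ + r ^ 2 * mutualEnergy κ κ) fun ε h0 hε => ?_
  rw [le_div_iff₀ (by positivity)] at hε
  have hr' : 0 ≤ ε * r := by positivity
  lift ε to NNReal using h0.le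
  have hε1 : ε ≤ 1 := by
    rw [← NNReal.coe_le_coe]; push_cast; linarith
  have := h ε hε1 (by rw [← NNReal.coe_le_coe]; push_cast; linarith)
  rw [(h1.mutualEnergy_mix_self h2 h3 _ _).2, NNReal.coe_sub hε1] at this
  push_cast at this
  linarith

/-- When `κ` fits into the unused part of the constraint, the perturbed outer measure remains
admissible. -/
lemma mix_le {μ κ ρ : Measure ℝ} {c d : NNReal} (h : κ + μ ≤ ρ) (hc : c ≤ 1) (hd : d ≤ 1) :
    c • μ + d • κ ≤ ρ := by
  refine le_trans (add_le_add ?_ ?_) ((add_comm μ κ).trans_le h)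
  · refine Measure.le_iff.2 fun s _ => ?_
    rw [Measure.smul_apply, ENNReal.smul_def, smul_eq_mul]
    exact mul_le_of_le_one_left zero_le (by exact_mod_cast hc)
  · refine Measure.le_iff.2 fun s _ => ?_
    rw [Measure.smul_apply, ENNReal.smul_def, smul_eq_mul]
    exact mul_le_of_le_one_left zero_le (by exact_mod_cast hd)

/-- The variation keeps the mass. -/
lemma mix_univ {μ κ : Measure ℝ} [IsFiniteMeasure μ] [IsFiniteMeasure κ] {ε r : NNReal} (hε : ε ≤ 1)
    (hr : r * κ univ = μ univ) : ((1 - ε) • μ + (ε * r) • κ) univ = μ univ := by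
  rw [Measure.add_apply, Measure.smul_apply, Measure.smul_apply, ENNReal.smul_def, ENNReal.smul_def,
    smul_eq_mul, smul_eq_mul, ENNReal.coe_mul, mul_assoc, hr, ← add_mul, ← ENNReal.coe_add,
    tsub_add_cancel_of_le hε, ENNReal.coe_one, one_mul]

lemma exists_scale {μ κ : Measure ℝ} [IsFiniteMeasure μ] [IsFiniteMeasure κ] (h : κ univ ≠ 0) :
    ∃ r : NNReal, r * κ univ = μ univ ∧ r * κ.real univ = μ.real univ := by
  have hm : (κ univ).toNNReal ≠ 0 := (ENNReal.toNNReal_pos h (measure_ne_top _ _)).ne'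
  have key : ((μ univ).toNNReal / (κ univ).toNNReal : NNReal) * κ univ = μ univ := by
    conv_lhs => rw [← ENNReal.coe_toNNReal (measure_ne_top κ univ)]
    rw [← ENNReal.coe_mul, ENNReal.toNNReal_coe, div_mul_cancel₀ _ hm,
      ENNReal.coe_toNNReal (measure_ne_top μ univ)]
  refine ⟨_, key, ?_⟩
  have := congrArg ENNReal.toReal key
  rwa [ENNReal.toReal_mul, ENNReal.coe_toReal] at this

lemma constraint_carrier (c s : ℝ) : constraint c s (Iic 0)ᶜ = 0 := by
  refine (withDensity_absolutelyContinuous _ _) ?_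
  rw [Measure.restrict_apply measurableSet_Iic.compl, compl_inter_self, measure_empty]

/-- On the unit ball the Riesz kernel is at least `1` off its center, so its potential bounds the
mass. -/
lemma constraint_ball_lt_top (c s x : ℝ) : constraint c s (Metric.ball x 1) < ⊤ := by
  obtain ⟨C, hC⟩ := constraint_riesz_bound c s
  have hna := noAtoms_constraint c s
  have hset : {y | |x - y| < 1} = Metric.ball x 1 := by
    ext y; rw [Metric.mem_ball, Real.dist_eq, abs_sub_comm]; rfl
  have := hC x
  rw [hset] at this
  refine lt_of_le_of_lt ?_ (this.trans_lt ENNReal.coe_lt_top)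
  rw [← setLIntegral_one]
  refine lintegral_mono_ae ?_
  have hne : ∀ᵐ y ∂((constraint c s).restrict (Metric.ball x 1)), y ≠ x := by rw [ae_iff]; simp
  filter_upwards [hne, ae_restrict_mem measurableSet_ball] with y hy hy1
  rw [Metric.mem_ball, Real.dist_eq, abs_sub_comm] at hy1
  rw [ENNReal.one_le_ofReal]
  exact Real.one_le_rpow_of_pos_of_le_one_of_nonpos (abs_pos.2 (sub_ne_zero.2 hy.symm)) hy1.le
    (by norm_num)

/-- The minimization problem for one of the outer measures, the measure on the half line being
`sqMap σ`. -/
structure IsOuterMinimizer (c s : ℝ) (σ μ : Measure ℝ) : Prop where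
  carrier : μ (Iic 0)ᶜ = 0
  mass : μ univ = 1 / 2
  le : μ ≤ constraint c s
  logMoment : LogMoment μ
  isMin : ∀ ν : Measure ℝ, ν (Iic 0)ᶜ = 0 → ν univ = 1 / 2 → ν ≤ constraint c s →
    LogMoment ν → mutualEnergy μ μ - mutualEnergy μ (sqMap σ) ≤
      mutualEnergy ν ν - mutualEnergy ν (sqMap σ)

variable {σ μ κ : Measure ℝ} {α B c s : ℝ}

/-- First variation along `(1 - ε)μ + εrκ`, with `r` equalizing the masses. The factor `2` on the
mass of `κ` comes from `μ` having mass `1/2`. -/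
lemma IsOuterMinimizer.variation [IsProbabilityMeasure σ] [IsFiniteMeasure μ] [IsFiniteMeasure κ]
    (h : IsOuterMinimizer c s σ μ) (hs : LogMoment (sqMap σ)) (hκ : κ ≤ constraint c s - μ)
    (hκ0 : κ univ ≠ 0) (hκm : LogMoment κ) :
    (∫ x, (2 * potential μ x - potential (sqMap σ) x) ∂μ) * (2 * κ.real univ) ≤
      ∫ x, (2 * potential μ x - potential (sqMap σ) x) ∂κ := by
  have hreg := (logRegular_constraint c s).mono h.le
  have hadd : κ + μ ≤ constraint c s := by
    rw [← Measure.sub_add_cancel_of_le h.le]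
    exact add_le_add hκ le_rfl
  have hκle : κ ≤ constraint c s := le_trans (Measure.le_add_right le_rfl) hadd
  have hκreg := (logRegular_constraint c s).mono hκle
  have i1 := hreg.finiteEnergy h.logMoment h.logMoment
  have i2 := (hreg.finiteEnergy hs h.logMoment).symm
  have i3 := hreg.finiteEnergy hκm h.logMoment
  have i4 := (hκreg.finiteEnergy hs hκm).symm
  have hm : 0 < κ.real univ := ENNReal.toReal_pos hκ0 (measure_ne_top _ _)
  obtain ⟨r, hrm, hrm'⟩ := exists_scale (μ := μ) hκ0
  have hmass : μ.real univ = 1 / 2 := by rw [measureReal_def, h.mass]; simp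
  have key := first_variation i1 (hκreg.finiteEnergy hκm hκm) i3.symm (r := r)
    (F := -mutualEnergy μ (sqMap σ)) (G := -mutualEnergy κ (sqMap σ)) fun ε h1 h2 => by
      have hle := mix_le hadd (c := 1 - ε) (d := ε * r) tsub_le_self h2
      have hc := constraint_carrier c s
      have := h.isMin ((1 - ε) • μ + (ε * r) • κ) (le_antisymm ((hle _).trans hc.le) zero_le)
        ((mix_univ h1 hrm).trans h.mass) hle
        ((h.logMoment.smul _).add_measure (hκm.smul _))
      rw [i2.mutualEnergy_mix i4] at this
      linarith
  have e : ∀ l : Measure ℝ, [IsFiniteMeasure l] → FiniteEnergy l μ → FiniteEnergy l (sqMap σ) →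
      ∫ x, (2 * potential μ x - potential (sqMap σ) x) ∂l =
        2 * mutualEnergy l μ - mutualEnergy l (sqMap σ) := by
    intro l _ j1 j2
    rw [integral_sub (j1.integrable_potential.const_mul 2) j2.integrable_potential,
      integral_const_mul, j1.mutualEnergy_eq, j2.mutualEnergy_eq]
  rw [e μ i1 i2, e κ i3 i4, mutualEnergy_comm κ μ]
  have hrr : (r : ℝ) * (2 * κ.real univ) = 1 := by
    linarith
  have h2 := mul_le_mul_of_nonneg_right key (by positivity : 0 ≤ 2 * κ.real univ)
  have h3 : (r : ℝ) * (2 * mutualEnergy μ κ + -mutualEnergy κ (sqMap σ)) * (2 * κ.real univ) =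
      (r * (2 * κ.real univ)) * (2 * mutualEnergy μ κ + -mutualEnergy κ (sqMap σ)) := by ring
  rw [h3, hrr, one_mul] at h2
  linarith

/-- On `(-∞, 0]` this potential is that of the balayage. A sufficiently large constraint dominates
half of the balayage, which makes its potential continuous. -/
lemma continuousOn_potential_sqMap [IsProbabilityMeasure σ] (hα : 0 < α)
    (hσ : ∀ᵐ u ∂σ, u ∈ Icc α B) : ContinuousOn (potential (sqMap σ)) (Iic 0) := by
  have hσ' : ∀ᵐ u ∂σ, α ≤ u := hσ.mono fun u hu => hu.1
  have h0 : 0 ≤ balFactor σ 0 := by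
    rw [balFactor_zero]
    exact integral_nonneg_of_ae (hσ'.mono fun u hu => inv_nonneg.2 (hα.le.trans hu))
  have hle : halfBal σ ≤ constraint ((balFactor σ 0 / 2 + 1) ^ 2) 1 := by
    refine halfBal_le_constraint hα hσ' ?_
    rw [Real.sqrt_sq (by linarith)]
    linarith
  have hc := continuous_potential_of_le_constraint hle (logMoment_halfBal hα hσ)
  refine (hc.const_mul 2).continuousOn.congr fun x hx => ?_
  change potential (sqMap σ) x = 2 * potential (halfBal σ) x
  rw [potential_halfBal, potential_balayage_of_nonpos hα hσ hx, mul_div_cancel₀ _ two_ne_zero]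
  rfl

/-- The Euler--Lagrange inequality on the support of the unused constraint. -/
lemma IsOuterMinimizer.le_field [IsProbabilityMeasure σ] [IsFiniteMeasure μ]
    (h : IsOuterMinimizer c s σ μ) (hα : 0 < α) (hσ : ∀ᵐ u ∂σ, u ∈ Icc α B)
    (hsupp : (constraint c s - μ).support = Iic 0) {x₀ : ℝ} (hx₀ : x₀ ≤ 0) :
    2 * ∫ x, (2 * potential μ x - potential (sqMap σ) x) ∂μ ≤
      2 * potential μ x₀ - potential (sqMap σ) x₀ := by
  have hs := logMoment_sqMap (ae_abs_le_of_mem_Icc hα hσ)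
  set f := fun x => 2 * potential μ x - potential (sqMap σ) x with hf
  set A := ∫ x, f x ∂μ with hA
  change 2 * A ≤ f x₀
  have hcont : ContinuousOn f (Iic 0) :=
    ((continuous_potential_of_le_constraint h.le h.logMoment).const_mul 2).continuousOn.sub
      (continuousOn_potential_sqMap hα hσ)
  by_contra! hlt
  obtain ⟨e, he1, he2⟩ := exists_between hlt
  have hev : ∀ᶠ x in 𝓝[Iic 0] x₀, f x < e := (hcont x₀ hx₀).eventually_lt_const he1
  obtain ⟨δ, hδ, hball⟩ := Metric.mem_nhdsWithin_iff.1 hev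
  set U := Metric.ball x₀ (min δ 1) with hU
  -- The test measure is the unused constraint near `x₀`: its mass is positive because `x₀` lies in
  -- the support, and finite because the ball has radius at most `1`.
  set κ := (constraint c s - μ).restrict U with hκ
  have hκle : κ ≤ constraint c s - μ := Measure.restrict_le_self
  have hsub : constraint c s - μ ≤ constraint c s := Measure.sub_le
  have hfin : IsFiniteMeasure κ := ⟨by
    rw [hκ, Measure.restrict_apply_univ]
    exact ((hsub U).trans (measure_mono (Metric.ball_subset_ball (min_le_right _ _)))).trans_lt
      (constraint_ball_lt_top c s x₀)⟩
  have hpos : κ univ ≠ 0 := by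
    rw [hκ, Measure.restrict_apply_univ]
    have hmem : x₀ ∈ (constraint c s - μ).support := hsupp ▸ hx₀
    rw [Measure.support_eq_forall_isOpen] at hmem
    exact (hmem U (Metric.mem_ball_self (lt_min hδ one_pos)) Metric.isOpen_ball).ne'
  have hmemU : ∀ᵐ x ∂κ, x ∈ U := ae_restrict_mem measurableSet_ball
  have hκm : LogMoment κ := logMoment_of_ae_bounded (B := |x₀| + 1) (hmemU.mono fun x hx => by
    have h1 : |x - x₀| < min δ 1 := hx
    have h2 := abs_sub_abs_le_abs_sub x x₀
    linarith [min_le_right δ 1])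
  have hneg : ∀ᵐ x ∂κ, x ∈ Iic (0 : ℝ) :=
    ae_mem_of_carrier (le_antisymm (((hκle.trans hsub) _).trans (constraint_carrier c s).le) zero_le)
  have hvar := h.variation hs hκle hpos hκm
  have hreg := (logRegular_constraint c s).mono h.le
  have hκreg := (logRegular_constraint c s).mono (hκle.trans hsub)
  have hi : Integrable f κ :=
    (((hreg.finiteEnergy hκm h.logMoment).integrable_potential).const_mul 2).sub
      ((hκreg.finiteEnergy hs hκm).symm.integrable_potential)
  have hub : ∫ x, f x ∂κ ≤ e * κ.real univ := by
    have := integral_mono_ae hi (integrable_const e) (by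
      filter_upwards [hmemU, hneg] with x hx hx0
      exact (hball ⟨Metric.ball_subset_ball (min_le_left _ _) hx, hx0⟩).le)
    rwa [integral_const, smul_eq_mul, mul_comm] at this
  have hm : 0 < κ.real univ := ENNReal.toReal_pos hpos (measure_ne_top _ _)
  have h1 : 2 * A * κ.real univ ≤ e * κ.real univ := by
    calc 2 * A * κ.real univ = A * (2 * κ.real univ) := by ring
      _ ≤ _ := hvar.trans hub
  exact absurd (le_of_mul_le_mul_right h1 hm) (not_le.2 he2)

/-- If the constraint is nowhere saturated, the outer measure is half a balayage. -/
theorem IsOuterMinimizer.eq_halfBal [IsProbabilityMeasure σ] [IsFiniteMeasure μ]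
    (h : IsOuterMinimizer c s σ μ) (hα : 0 < α) (hσ : ∀ᵐ u ∂σ, u ∈ Icc α B)
    (hsupp : (constraint c s - μ).support = Iic 0) : μ = halfBal σ := by
  have hs := logMoment_sqMap (ae_abs_le_of_mem_Icc hα hσ)
  have r1 := logRegular_halfBal hα hσ
  have m1 := logMoment_halfBal hα hσ
  have hreg := (logRegular_constraint c s).mono h.le
  have i1 := hreg.finiteEnergy h.logMoment h.logMoment
  have i2 := (hreg.finiteEnergy hs h.logMoment).symm
  have i3 := hreg.finiteEnergy m1 h.logMoment
  have i4 := (r1.finiteEnergy hs m1).symm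
  have i5 := r1.finiteEnergy m1 m1
  refine eq_of_energy_le (h.mass.trans halfBal_univ.symm) i1 i5 i3.symm ?_
  have e : ∀ l : Measure ℝ, [IsFiniteMeasure l] → FiniteEnergy l μ → FiniteEnergy l (sqMap σ) →
      ∫ x, (2 * potential μ x - potential (sqMap σ) x) ∂l =
        2 * mutualEnergy l μ - mutualEnergy l (sqMap σ) := by
    intro l _ j1 j2
    rw [integral_sub (j1.integrable_potential.const_mul 2) j2.integrable_potential,
      integral_const_mul, j1.mutualEnergy_eq, j2.mutualEnergy_eq]
  -- Integrating the Euler–Lagrange inequality against the half balayage and replacing `sqMap σ` by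
  -- twice `halfBal σ` in the energies shows that the energy distance is nonpositive.
  have hle := integral_mono_ae (integrable_const _)
    ((i3.integrable_potential.const_mul 2).sub i4.integrable_potential)
    ((ae_mem_of_carrier (halfBal_carrier (σ := σ))).mono fun x hx => h.le_field hα hσ hsupp hx)
  have hmass : (halfBal σ).real univ = 1 / 2 := by rw [measureReal_def, halfBal_univ]; simp
  rw [integral_const, hmass, smul_eq_mul] at hle
  have e1 := e μ i1 i2
  have e2 := e (halfBal σ) i3 i4
  have f1 := mutualEnergy_halfBal hα hσ h.carrier i3.symm i2
  have f2 := mutualEnergy_halfBal hα hσ halfBal_carrier i5 i4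
  have f3 := mutualEnergy_comm μ (halfBal σ)
  simp only [Pi.sub_apply] at hle
  linarith

end

section

/-! ### The measure on the half line -/

variable {a b t α B B' : ℝ} {σ l : Measure ℝ}

/-- The effective field of `σ` after the quadratic substitution. -/
def lineField (a b t : ℝ) (σ : Measure ℝ) (y : ℝ) : ℝ :=
  2 * potential σ y + 2 * (y - center a b t) ^ 2 / radius t ^ 2

lemma integrable_quadratic [IsFiniteMeasure l] (hl : ∀ᵐ y ∂l, |y| ≤ B') :
    Integrable (fun y => 2 * (y - center a b t) ^ 2 / radius t ^ 2) l := by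
  have hc : Continuous fun y : ℝ => 2 * (y - center a b t) ^ 2 / radius t ^ 2 := by fun_prop
  obtain ⟨C, hC⟩ := (isCompact_Icc (a := -B') (b := B')).exists_bound_of_continuousOn hc.continuousOn
  refine Integrable.of_bound (C := C) hc.measurable.aestronglyMeasurable ?_
  filter_upwards [hl] with y hy
  exact hC y (abs_le.1 hy)

lemma integrable_lineField [IsFiniteMeasure σ] [IsFiniteMeasure l] (h : FiniteEnergy l σ)
    (hl : ∀ᵐ y ∂l, |y| ≤ B') : Integrable (lineField a b t σ) l :=
  (h.integrable_potential.const_mul 2).add (integrable_quadratic hl)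

lemma integral_lineField [IsFiniteMeasure σ] [IsFiniteMeasure l] (h : FiniteEnergy l σ)
    (hl : ∀ᵐ y ∂l, |y| ≤ B') : ∫ y, lineField a b t σ y ∂l =
      2 * mutualEnergy l σ + ∫ y, 2 * (y - center a b t) ^ 2 / radius t ^ 2 ∂l := by
  rw [h.mutualEnergy_eq, ← integral_const_mul]
  exact integral_add (h.integrable_potential.const_mul 2) (integrable_quadratic hl)

lemma integral_totalField_sqMap [IsProbabilityMeasure σ] [NullSingletonClass σ] [IsFiniteMeasure l]
    (ha : 0 < a) (hb : 0 < b) (ht₀ : 0 < t) (ht₁ : t < 1) (hα : 0 < α) (hσ : ∀ᵐ u ∂σ, u ∈ Icc α B)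
    (hl : ∀ᵐ y ∂l, y ∈ Icc 0 B') (h : FiniteEnergy l σ) (h' : FiniteEnergy (sqMap l) (sqMap σ)) :
    ∫ x, totalField a b t σ x ∂(sqMap l) = ∫ y, lineField a b t σ y ∂l -
      2 * center a b t ^ 2 / radius t ^ 2 * l.real univ := by
  have hl' : ∀ᵐ y ∂l, |y| ≤ B' := hl.mono fun y hy => by rw [abs_of_nonneg hy.1]; exact hy.2
  have hm := logMoment_sqMap hl'
  have r1 := logRegular_halfBal hα hσ
  have m1 := logMoment_halfBal hα hσ
  have hi := integrable_totalField (a := a) (b := b) (t := t) (r1.finiteEnergy hm m1) h'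
    (integrable_externalField_of_bounded (ae_sqMap_abs_le hl'))
  rw [sqMap, integral_map measurable_sq.aemeasurable hi.aestronglyMeasurable]
  have : ∫ y, totalField a b t σ (y ^ 2) ∂l =
      ∫ y, (lineField a b t σ y - 2 * center a b t ^ 2 / radius t ^ 2) ∂l := by
    refine integral_congr_ae ?_
    filter_upwards [hl, h.integrable_logKernel] with y hy hint
    exact totalField_sq ha hb ht₀ ht₁ hα hσ hy.1 hint
  rw [this, integral_sub (integrable_lineField h hl') (integrable_const _), integral_const,
    smul_eq_mul, mul_comm (l.real univ)]

/-- Only the middle measure is varied, with both outer measures frozen. Their interaction with it is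
linear and enters the first variation together with the external field. -/
lemma totalField_variation [IsProbabilityMeasure σ] [IsFiniteMeasure l]
    (h : IsMinimizer a b t (halfBal σ) (sqMap σ) (halfBal σ)) (hα : 0 < α)
    (hσ : ∀ᵐ u ∂σ, u ∈ Icc α B) (hl : ∀ᵐ y ∂l, y ∈ Icc 0 B')
    (h1 : FiniteEnergy (sqMap l) (sqMap l)) (h2 : FiniteEnergy (sqMap l) (sqMap σ)) :
    (∫ x, totalField a b t σ x ∂(sqMap σ)) * (sqMap l).real univ ≤
      ∫ x, totalField a b t σ x ∂(sqMap l) := by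
  by_cases h0 : sqMap l univ = 0
  · rw [Measure.measure_univ_eq_zero.1 h0]
    simp
  have hl' : ∀ᵐ y ∂l, |y| ≤ B' := hl.mono fun y hy => by rw [abs_of_nonneg hy.1]; exact hy.2
  have m := logMoment_sqMap hl'
  have m2 := h.1.logMoment₂
  have r1 := logRegular_halfBal hα hσ
  have m1 := logMoment_halfBal hα hσ
  have hV := integrable_externalField_of_bounded (a := a) (b := b) (t := t) (ae_sqMap_abs_le hl')
  obtain ⟨r, hr, hr'⟩ := exists_scale (μ := sqMap σ) h0
  have key := first_variation h.1.finite₂₂ h1 h2.symm (r := r)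
    (F := -2 * mutualEnergy (sqMap σ) (halfBal σ) + ∫ x, externalField a b t x ∂(sqMap σ))
    (G := -2 * mutualEnergy (sqMap l) (halfBal σ) + ∫ x, externalField a b t x ∂(sqMap l))
    fun ε e1 e2 => by
      have hVint : Integrable (externalField a b t) ((1 - ε) • sqMap σ + (ε * r) • sqMap l) :=
        (Integrable.smul_measure_nnreal h.1.finite_field).add_measure
          (Integrable.smul_measure_nnreal hV)
      have mm : LogMoment ((1 - ε) • sqMap σ + (ε * r) • sqMap l) :=
        (m2.smul _).add_measure (m.smul _)
      have i := r1.finiteEnergy mm m1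
      have hE := h.2 (halfBal σ) ((1 - ε) • sqMap σ + (ε * r) • sqMap l) (halfBal σ)
        { h.1 with
          carrier₂ := by
            rw [Measure.add_apply, Measure.smul_apply, Measure.smul_apply, sqMap_carrier,
              sqMap_carrier, smul_zero, smul_zero, add_zero]
          mass₂ := (mix_univ e1 hr).trans h.1.mass₂
          finite₂₂ := (h.1.finite₂₂.mutualEnergy_mix_self h1 h2.symm _ _).1
          finite₁₂ := i.symm
          finite₂₃ := i
          finite_field := hVint }
      unfold energy at hE
      rw [mutualEnergy_comm (halfBal σ) (sqMap σ), mutualEnergy_comm (halfBal σ) (_ + _),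
        (r1.finiteEnergy m2 m1).mutualEnergy_mix (r1.finiteEnergy m m1),
        integral_add_measure (Integrable.smul_measure_nnreal h.1.finite_field)
          (Integrable.smul_measure_nnreal hV), integral_smul_nnreal_measure,
        integral_smul_nnreal_measure, NNReal.smul_def, NNReal.smul_def, smul_eq_mul,
        smul_eq_mul] at hE
      linarith
  rw [integral_totalField (r1.finiteEnergy m2 m1) h.1.finite₂₂ h.1.finite_field,
    integral_totalField (r1.finiteEnergy m m1) h2 hV]
  have h3 := mul_le_mul_of_nonneg_right key (measureReal_nonneg (μ := sqMap l) (s := univ))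
  rw [probReal_univ (μ := sqMap σ)] at hr'
  have h4 : ∀ z : ℝ, r * z * (sqMap l).real univ = (r * (sqMap l).real univ) * z := fun z => by ring
  rw [h4, hr', one_mul, mutualEnergy_comm (sqMap σ) (sqMap l)] at h3
  linarith

/-- The weak Euler--Lagrange inequality for the measure on the half line. -/
lemma lineField_variation [IsProbabilityMeasure σ] [NullSingletonClass σ] [IsFiniteMeasure l]
    (ha : 0 < a) (hb : 0 < b) (ht₀ : 0 < t) (ht₁ : t < 1)
    (h : IsMinimizer a b t (halfBal σ) (sqMap σ) (halfBal σ)) (hα : 0 < α)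
    (hσ : ∀ᵐ u ∂σ, u ∈ Icc α B) (hl : ∀ᵐ y ∂l, y ∈ Icc 0 B')
    (h1 : FiniteEnergy (sqMap l) (sqMap l)) (h2 : FiniteEnergy (sqMap l) (sqMap σ))
    (h3 : FiniteEnergy l σ) :
    (∫ y, lineField a b t σ y ∂σ) * l.real univ ≤ ∫ y, lineField a b t σ y ∂l := by
  have hσ' : ∀ᵐ u ∂σ, u ∈ Icc 0 B := hσ.mono fun u hu => ⟨hα.le.trans hu.1, hu.2⟩
  have key := totalField_variation h hα hσ hl h1 h2
  have hm : (sqMap l).real univ = l.real univ := by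
    rw [sqMap, measureReal_def, Measure.map_apply measurable_sq MeasurableSet.univ]
    rfl
  rw [integral_totalField_sqMap ha hb ht₀ ht₁ hα hσ hl h3 h2, integral_totalField_sqMap ha hb ht₀ ht₁
    hα hσ hσ' (finiteEnergy_of_sqMap hα hσ h.1.finite₂₂) h.1.finite₂₂, hm, probReal_univ] at key
  linarith

lemma lineField_variation_of_logRegular [IsProbabilityMeasure σ] [NullSingletonClass σ]
    [IsFiniteMeasure l] (ha : 0 < a) (hb : 0 < b) (ht₀ : 0 < t) (ht₁ : t < 1)
    (h : IsMinimizer a b t (halfBal σ) (sqMap σ) (halfBal σ)) (hα : 0 < α)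
    (hσ : ∀ᵐ u ∂σ, u ∈ Icc α B) (hl : ∀ᵐ y ∂l, y ∈ Icc 0 B') (hr : LogRegular l) :
    (∫ y, lineField a b t σ y ∂σ) * l.real univ ≤ ∫ y, lineField a b t σ y ∂l := by
  have hl' : ∀ᵐ y ∂l, |y| ≤ B' := hl.mono fun y hy => by rw [abs_of_nonneg hy.1]; exact hy.2
  have r2 := hr.sqMap (hl.mono fun y hy => hy.1)
  have m2 := logMoment_sqMap hl'
  exact lineField_variation ha hb ht₀ ht₁ h hα hσ hl (r2.finiteEnergy m2 m2)
    (r2.finiteEnergy h.1.logMoment₂ m2).symm (hr.finiteEnergy (logMoment_of_ae_bounded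
      (ae_abs_le_of_mem_Icc hα hσ)) (logMoment_of_ae_bounded hl')).symm

/-- Pieces of `σ` need no regularity, since they inherit finite energy from `σ`. -/
lemma lineField_variation_of_le [IsProbabilityMeasure σ] [NullSingletonClass σ]
    (ha : 0 < a) (hb : 0 < b) (ht₀ : 0 < t) (ht₁ : t < 1)
    (h : IsMinimizer a b t (halfBal σ) (sqMap σ) (halfBal σ)) (hα : 0 < α)
    (hσ : ∀ᵐ u ∂σ, u ∈ Icc α B) (hl : l ≤ σ) :
    (∫ y, lineField a b t σ y ∂σ) * l.real univ ≤ ∫ y, lineField a b t σ y ∂l := by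
  have : IsFiniteMeasure l := ⟨(hl univ).trans_lt (measure_lt_top σ univ)⟩
  have hσ' : ∀ᵐ u ∂σ, u ∈ Icc 0 B := hσ.mono fun u hu => ⟨hα.le.trans hu.1, hu.2⟩
  have hl2 := sqMap_mono hl
  have h2 := h.1.finite₂₂.mono_left hl2
  exact lineField_variation ha hb ht₀ ht₁ h hα hσ (hσ'.filter_mono (ae_mono hl))
    (h2.symm.mono_left hl2) h2 ((finiteEnergy_of_sqMap hα hσ h.1.finite₂₂).mono_left hl)

/-! ### The field on the negative half line -/

lemma integrable_log_of_lt [IsFiniteMeasure σ] (hσ : ∀ᵐ u ∂σ, u ∈ Icc α B) {y : ℝ} (hy : y < α) :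
    Integrable (fun u => -Real.log |y - u|) σ := by
  refine Integrable.of_bound (C := |Real.log (α - y)| + |Real.log (B - y)|)
    (measurable_logKernel_left y).aestronglyMeasurable ?_
  filter_upwards [hσ] with u hu
  have h1 : Real.log (α - y) ≤ Real.log (u - y) := Real.log_le_log (by linarith) (by linarith [hu.1])
  have h2 : Real.log (u - y) ≤ Real.log (B - y) :=
    Real.log_le_log (by linarith [hu.1]) (by linarith [hu.2])
  rw [norm_neg, Real.norm_eq_abs, abs_sub_comm, abs_of_pos (by linarith [hu.1] : 0 < u - y), abs_le]
  constructor
  · linarith [neg_abs_le (Real.log (α - y)), abs_nonneg (Real.log (B - y))]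
  · linarith [le_abs_self (Real.log (B - y)), abs_nonneg (Real.log (α - y))]

lemma convexOn_potential [IsFiniteMeasure σ] (hσ : ∀ᵐ u ∂σ, u ∈ Icc α B) :
    ConvexOn ℝ (Iio α) (potential σ) := by
  refine ⟨convex_Iio α, fun x hx y hy p q hp hq hpq => ?_⟩
  have hxy : p • x + q • y < α := (convex_Iio α) hx hy hp hq hpq
  have ix := (integrable_log_of_lt hσ hx).const_mul p
  have iy := (integrable_log_of_lt hσ hy).const_mul q
  simp only [potential, smul_eq_mul] at hxy ⊢
  rw [← integral_const_mul, ← integral_const_mul, ← integral_add ix iy]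
  refine integral_mono_ae (integrable_log_of_lt hσ hxy) (ix.add iy) ?_
  filter_upwards [hσ] with u hu
  have hx' : 0 < u - x := by linarith [hu.1, mem_Iio.1 hx]
  have hy' : 0 < u - y := by linarith [hu.1, mem_Iio.1 hy]
  have hc := strictConcaveOn_log_Ioi.concaveOn.2 hx' hy' hp hq hpq
  simp only [smul_eq_mul] at hc
  have e : p * (u - x) + q * (u - y) = u - (p * x + q * y) := by linear_combination u * hpq
  rw [e] at hc
  rw [abs_sub_comm, abs_of_pos (by linarith [hu.1]), abs_sub_comm x, abs_sub_comm y,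
    abs_of_pos hx', abs_of_pos hy']
  linarith

lemma convexOn_lineField [IsFiniteMeasure σ] (hσ : ∀ᵐ u ∂σ, u ∈ Icc α B) :
    ConvexOn ℝ (Iio α) (lineField a b t σ) := by
  refine ⟨convex_Iio α, fun x hx y hy p q hp hq hpq => ?_⟩
  have h1 := (convexOn_potential hσ).2 hx hy hp hq hpq
  simp only [lineField, smul_eq_mul] at h1 ⊢
  have h2 : (p * x + q * y - center a b t) ^ 2 ≤
      p * (x - center a b t) ^ 2 + q * (y - center a b t) ^ 2 := by
    have hq' : q = 1 - p := by linarith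
    subst hq'
    nlinarith [mul_nonneg (mul_nonneg hp hq) (sq_nonneg (x - y))]
  have h3 : 2 * (p * x + q * y - center a b t) ^ 2 / radius t ^ 2 ≤
      2 * (p * (x - center a b t) ^ 2 + q * (y - center a b t) ^ 2) / radius t ^ 2 := by gcongr
  have h4 : 2 * (p * (x - center a b t) ^ 2 + q * (y - center a b t) ^ 2) / radius t ^ 2 =
      p * (2 * (x - center a b t) ^ 2 / radius t ^ 2) +
        q * (2 * (y - center a b t) ^ 2 / radius t ^ 2) := by ring
  linarith

/-- Every `u ≥ α` is at least as far from `α - δ` as from `x`. This replaces continuity of the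
potential at the left end of the support, which is not known. -/
lemma potential_le_of_le [IsFiniteMeasure σ] [NullSingletonClass σ] (hσ : ∀ᵐ u ∂σ, u ∈ Icc α B)
    {x δ : ℝ} (hδ : 0 < δ) (hx : x ∈ Ico α (α + δ))
    (hint : Integrable (fun u => -Real.log |x - u|) σ) : potential σ (α - δ) ≤ potential σ x := by
  refine integral_mono_ae (integrable_log_of_lt hσ (by linarith)) hint ?_
  have hne : ∀ᵐ u ∂σ, u ≠ x := by rw [ae_iff]; simp
  filter_upwards [hσ, hne] with u hu hux
  refine neg_le_neg (Real.log_le_log (abs_pos.2 (sub_ne_zero.2 hux.symm)) ?_)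
  rw [abs_sub_comm (α - δ), abs_of_pos (by linarith [hu.1] : 0 < u - (α - δ)), abs_le]
  constructor <;> linarith [hu.1, hx.1, hx.2]

end

section

/-! ### Case I forces `a b > 1 / 4` -/

variable {a b t α B : ℝ} {σ : Measure ℝ}

lemma FiniteEnergy.nullSingletonClass [IsFiniteMeasure σ] (h : FiniteEnergy σ σ) :
    NullSingletonClass σ := ⟨fun x => by
  have h1 : (σ.prod σ) ({x} ×ˢ {x}) = 0 := measure_mono_null (fun z hz => by
    rw [mem_prod] at hz
    exact (mem_singleton_iff.1 hz.1).trans (mem_singleton_iff.1 hz.2).symm) h.1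
  rw [Measure.prod_prod] at h1
  exact mul_self_eq_zero.1 h1⟩

/-! ### Identification of the measure on the half line. -/

section

variable [IsProbabilityMeasure σ] [NullSingletonClass σ]

/-- Testing with a semicircle law on `[0, α/2]` gives the inequality on average, hence at some
point. -/
lemma exists_lineField_ge (ha : 0 < a) (hb : 0 < b) (ht₀ : 0 < t)
    (ht₁ : t < 1) (h : IsMinimizer a b t (halfBal σ) (sqMap σ) (halfBal σ)) (hα : 0 < α)
    (hσ : ∀ᵐ u ∂σ, u ∈ Icc α B) :
    ∃ y ∈ Icc 0 (α / 2), ∫ u, lineField a b t σ u ∂σ ≤ lineField a b t σ y := by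
  have hα4 : 0 < α / 4 := by positivity
  have hmem : ∀ᵐ y ∂(semicircle (α / 4) (α / 4)), y ∈ Icc 0 (α / 2) := by
    filter_upwards [ae_semicircle_mem hα4 (α / 4)] with y hy
    exact ⟨by linarith [hy.1], by linarith [hy.2]⟩
  have hreg := logRegular_semicircle hα4 (α / 4)
  have key := lineField_variation_of_logRegular ha hb ht₀ ht₁ h hα hσ hmem hreg
  rw [probReal_univ, mul_one] at key
  by_contra! hlt
  have habs : ∀ᵐ y ∂(semicircle (α / 4) (α / 4)), |y| ≤ α / 2 :=
    hmem.mono fun y hy => by rw [abs_of_nonneg hy.1]; exact hy.2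
  have hi := integrable_lineField (a := a) (b := b) (t := t) (hreg.finiteEnergy
    (logMoment_of_ae_bounded (ae_abs_le_of_mem_Icc hα hσ)) (logMoment_of_ae_bounded habs)).symm habs
  obtain ⟨y, hy1, hy2⟩ := exists_notMem_null_integral_le hi (N := {y | y ∉ Icc 0 (α / 2)}) hmem
  exact absurd (hlt y (not_not.1 hy1)) (not_lt.2 (key.trans hy2))

/-- Testing with `σ` away from its left end shows that the field averages at least its total mean
there, so near the left end it averages at most that mean. -/
lemma exists_lineField_le (ha : 0 < a) (hb : 0 < b) (ht₀ : 0 < t)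
    (ht₁ : t < 1) (h : IsMinimizer a b t (halfBal σ) (sqMap σ) (halfBal σ)) (hα : 0 < α)
    (hσ : ∀ᵐ u ∂σ, u ∈ Icc α B) (hpos : ∀ δ > 0, 0 < σ (Iio (α + δ))) {δ : ℝ} (hδ : 0 < δ) :
    ∃ x ∈ Ico α (α + δ), Integrable (fun u => -Real.log |x - u|) σ ∧
      lineField a b t σ x ≤ ∫ u, lineField a b t σ u ∂σ := by
  have hF := finiteEnergy_of_sqMap hα hσ h.1.finite₂₂
  have hi := integrable_lineField (a := a) (b := b) (t := t) hF (ae_abs_le_of_mem_Icc hα hσ)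
  have key := lineField_variation_of_le ha hb ht₀ ht₁ h hα hσ
    (Measure.restrict_le_self (μ := σ) (s := (Iio (α + δ))ᶜ))
  rw [measureReal_restrict_apply_univ, probReal_compl_eq_one_sub measurableSet_Iio] at key
  have hsplit := integral_add_compl (measurableSet_Iio (a := α + δ)) hi
  have hw : 0 < σ.real (Iio (α + δ)) := ENNReal.toReal_pos (hpos δ hδ).ne' (measure_ne_top _ _)
  have hN : σ.restrict (Iio (α + δ)) {x | ¬ (x ∈ Ico α (α + δ) ∧
      Integrable (fun u => -Real.log |x - u|) σ)} = 0 := by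
    filter_upwards [ae_restrict_of_ae hσ, ae_restrict_of_ae hF.integrable_logKernel,
      ae_restrict_mem measurableSet_Iio] with x h1 h2 h3 using ⟨⟨h1.1, h3⟩, h2⟩
  obtain ⟨x, hx1, hx2⟩ := exists_notMem_null_le_average
    (Measure.restrict_eq_zero.not.2 (hpos δ hδ).ne') hi.restrict hN
  simp only [mem_ofPred_eq, not_not] at hx1
  refine ⟨x, hx1.1, hx1.2, hx2.trans ?_⟩
  rw [setAverage_eq, smul_eq_mul, ← div_eq_inv_mul, div_le_iff₀ hw]
  linarith

/-- The Euler--Lagrange inequality extends to the negative half line. -/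
lemma le_lineField_of_neg (ha : 0 < a) (hb : 0 < b) (ht₀ : 0 < t)
    (ht₁ : t < 1) (h : IsMinimizer a b t (halfBal σ) (sqMap σ) (halfBal σ)) (hα : 0 < α)
    (hσ : ∀ᵐ u ∂σ, u ∈ Icc α B) (hpos : ∀ δ > 0, 0 < σ (Iio (α + δ))) {y : ℝ} (hy : y < 0) :
    ∫ u, lineField a b t σ u ∂σ ≤ lineField a b t σ y := by
  obtain ⟨y₀, hy₀, hge⟩ := exists_lineField_ge ha hb ht₀ ht₁ h hα hσ
  set A := ∫ u, lineField a b t σ u ∂σ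
  by_contra! hlt
  have hyy : 0 < y₀ - y := by linarith [hy₀.1]
  -- A value below `A` at `y` would give a positive slope up to `y₀`. By convexity the field would
  -- exceed `A` by at least `kα/4` at `α - δ`, contradicting values at most `A` just right of `α`.
  set k := (lineField a b t σ y₀ - lineField a b t σ y) / (y₀ - y) with hk
  have hk0 : 0 < k := div_pos (by linarith) hyy
  have hq : Continuous fun x : ℝ => 2 * (x - center a b t) ^ 2 / radius t ^ 2 := by fun_prop
  -- The quadratic term is compared at `α - δ` and at `x`, both through `α`; each comparison may
  -- cost half of the gain `kα/4`.
  obtain ⟨η, hη, hclose⟩ := Metric.continuous_iff.1 hq α (k * (α / 4) / 2) (by positivity)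
  set δ := min (η / 2) (α / 4) with hδ
  have hδ0 : 0 < δ := lt_min (by positivity) (by positivity)
  have hδ1 : δ ≤ α / 4 := min_le_right _ _
  have hδ2 : δ ≤ η / 2 := min_le_left _ _
  obtain ⟨x, hx, hint, hxle⟩ := exists_lineField_le ha hb ht₀ ht₁ h hα hσ hpos hδ0
  have hpot := potential_le_of_le hσ hδ0 hx hint
  have hq1 := hclose (α - δ) (by rw [Real.dist_eq, abs_lt]; constructor <;> linarith)
  have hq2 := hclose x (by rw [Real.dist_eq, abs_lt]; constructor <;> linarith [hx.1, hx.2])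
  rw [Real.dist_eq, abs_lt] at hq1 hq2
  have hslope := (convexOn_lineField (a := a) (b := b) (t := t) hσ).slope_mono_adjacent
    (x := y) (y := y₀) (z := α - δ) (by rw [mem_Iio]; linarith) (by rw [mem_Iio]; linarith)
    (by linarith) (by linarith [hy₀.2])
  have h1 : 0 < α - δ - y₀ := by linarith [hy₀.2]
  rw [← hk, le_div_iff₀ h1] at hslope
  have h2 : k * (α / 4) ≤ k * (α - δ - y₀) :=
    mul_le_mul_of_nonneg_left (by linarith [hy₀.2]) hk0.le
  have e1 : lineField a b t σ (α - δ) = 2 * potential σ (α - δ) +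
    2 * (α - δ - center a b t) ^ 2 / radius t ^ 2 := rfl
  have e2 : lineField a b t σ x = 2 * potential σ x +
    2 * (x - center a b t) ^ 2 / radius t ^ 2 := rfl
  linarith [hq1.2, hq2.1]

/-- The measure on the half line is the image of the semicircle law. -/
theorem eq_extremal (ha : 0 < a) (hb : 0 < b) (ht₀ : 0 < t)
    (ht₁ : t < 1) (h : IsMinimizer a b t (halfBal σ) (sqMap σ) (halfBal σ)) (hα : 0 < α)
    (hσ : ∀ᵐ u ∂σ, u ∈ Icc α B) (hpos : ∀ δ > 0, 0 < σ (Iio (α + δ))) :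
    σ = extremal a b t := by
  have hR := radius_pos ht₀ ht₁
  have hF := finiteEnergy_of_sqMap hα hσ h.1.finite₂₂
  have hσb := ae_abs_le_of_mem_Icc hα hσ
  have hreg : LogRegular (extremal a b t) := logRegular_semicircle hR _
  have hm : LogMoment (extremal a b t) := logMoment_semicircle hR _
  have hσm : LogMoment σ := logMoment_of_ae_bounded hσb
  have hx := hreg.finiteEnergy hσm hm
  have hxx := hreg.finiteEnergy hm hm
  set B' := |center a b t| + radius t with hB'
  have hxb : ∀ᵐ y ∂(extremal a b t), |y| ≤ B' := by
    filter_upwards [extremal_ae_mem ht₀ ht₁] with y hy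
    rw [abs_le]
    constructor <;>
      linarith [hy.1, hy.2, le_abs_self (center a b t), neg_abs_le (center a b t)]
  have hxi := integrable_lineField (a := a) (b := b) (t := t) hx.symm hxb
  -- Here `R < m` is not yet known and the semicircle may charge the negative axis. The variational
  -- inequality covers `[0, ∞)`, the convexity argument covers the rest.
  have hkey : ∫ u, lineField a b t σ u ∂σ ≤ ∫ u, lineField a b t σ u ∂(extremal a b t) := by
    set A := ∫ u, lineField a b t σ u ∂σ with hA
    have hmem : ∀ᵐ y ∂((extremal a b t).restrict (Ici 0)), y ∈ Icc 0 B' := by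
      filter_upwards [ae_restrict_mem measurableSet_Ici, ae_restrict_of_ae hxb] with y h1 h2
      exact ⟨h1, (le_abs_self y).trans h2⟩
    have h1 := lineField_variation_of_logRegular ha hb ht₀ ht₁ h hα hσ hmem
      (hreg.mono Measure.restrict_le_self)
    rw [measureReal_restrict_apply_univ, ← hA] at h1
    have h2 : A * (extremal a b t).real (Ici 0)ᶜ ≤
        ∫ y in (Ici 0)ᶜ, lineField a b t σ y ∂(extremal a b t) := by
      have := setIntegral_mono_on (integrableOn_const (measure_ne_top _ _)) hxi.integrableOn
        measurableSet_Ici.compl fun y hy =>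
          le_lineField_of_neg ha hb ht₀ ht₁ h hα hσ hpos (not_le.1 hy)
      rwa [setIntegral_const, smul_eq_mul, mul_comm] at this
    have h3 := integral_add_compl (measurableSet_Ici (a := (0 : ℝ))) hxi
    have h4 := probReal_add_probReal_compl (μ := extremal a b t) (measurableSet_Ici (a := (0 : ℝ)))
    have h5 : A * (extremal a b t).real (Ici 0) + A * (extremal a b t).real (Ici 0)ᶜ = A := by
      rw [← mul_add, h4, mul_one]
    linarith
  -- The reverse comparison uses the Euler–Lagrange conditions of the semicircle. Adding the two
  -- cancels the quadratic field and leaves a nonpositive energy distance.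
  have hle : semicircleConst (radius t) ≤ ∫ y, lineField a b t (extremal a b t) y ∂σ := by
    have := integral_mono (integrable_const _)
      (integrable_lineField (a := a) (b := b) (t := t) hx hσb)
      fun y => semicircleConst_le hR (center a b t) y
    simpa using this
  have heq : ∫ y, lineField a b t (extremal a b t) y ∂(extremal a b t) =
      semicircleConst (radius t) := by
    have : ∀ᵐ y ∂(extremal a b t), lineField a b t (extremal a b t) y = semicircleConst (radius t) :=
      (extremal_ae_mem ht₀ ht₁).mono fun y hy => semicircleConst_eq hR hy
    rw [integral_congr_ae this]
    simp
  rw [integral_lineField hF hσb, integral_lineField hx.symm hxb,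
    mutualEnergy_comm (extremal a b t)] at hkey
  rw [integral_lineField hx hσb] at hle
  rw [integral_lineField hxx hxb] at heq
  exact eq_of_energy_le (measure_univ.trans measure_univ.symm) hF hxx hx (by linarith)

/-- A semicircle law charges every open set meeting the interior of its interval, so it cannot
extend below `α`. -/
lemma radius_lt_center_of_extremal (ht₀ : 0 < t) (ht₁ : t < 1) (hα : 0 < α)
    (hσ : ∀ᵐ u ∂(extremal a b t), u ∈ Icc α B) : radius t < center a b t := by
  have hR := radius_pos ht₀ ht₁
  by_contra! hle
  obtain ⟨x, hx1, hx2⟩ := exists_between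
    (lt_min (by linarith : center a b t - radius t < α)
      (by linarith : center a b t - radius t < center a b t + radius t))
  have hpos := semicircle_pos_of_isOpen hR ⟨hx1, hx2.trans_le (min_le_right _ _)⟩
    (isOpen_Iio (a := α)) (hx2.trans_le (min_le_left _ _))
  refine hpos.ne' (measure_mono_null (fun u (hu : u < α) => ?_) hσ)
  exact fun hu' : u ∈ Icc α B => absurd hu'.1 (not_le.2 hu)

end

/-! ### From a Case I minimizer to its square root measure. -/

section CaseI

variable {μ₁ μ₂ μ₃ : Measure ℝ}

/-- A measure with support `[p, q]`, `p > 0`, is the image of a measure on `[√p, √q]` under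
squaring. -/
lemma exists_eq_sqMap {p q : ℝ} [IsProbabilityMeasure μ₂] (hp : 0 < p) (hpq : p < q)
    (hs : μ₂.support = Icc p q) : ∃ σ : Measure ℝ, IsProbabilityMeasure σ ∧ μ₂ = sqMap σ ∧
      (∀ᵐ u ∂σ, u ∈ Icc (√p) (√q)) ∧ ∀ δ > 0, 0 < σ (Iio (√p + δ)) := by
  have hmem : ∀ᵐ x ∂μ₂, x ∈ Icc p q := by
    rw [← hs]; exact Measure.support_mem_ae
  have hmeas : Measurable Real.sqrt := by fun_prop
  refine ⟨μ₂.map Real.sqrt, Measure.isProbabilityMeasure_map hmeas.aemeasurable, ?_, ?_,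
    fun δ hδ => ?_⟩
  · rw [sqMap, Measure.map_map measurable_sq hmeas]
    conv_lhs => rw [← Measure.map_id (μ := μ₂)]
    refine Measure.map_congr (hmem.mono fun x hx => ?_)
    exact (Real.sq_sqrt (hp.le.trans hx.1)).symm
  · rw [ae_map_iff (p := (· ∈ Icc (√p) (√q))) hmeas.aemeasurable measurableSet_Icc]
    exact hmem.mono fun x hx => ⟨Real.sqrt_le_sqrt hx.1, Real.sqrt_le_sqrt hx.2⟩
  · rw [Measure.map_apply hmeas measurableSet_Iio]
    have hps : p ∈ μ₂.support := hs ▸ left_mem_Icc.2 hpq.le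
    rw [Measure.support_eq_forall_isOpen] at hps
    exact hps _ (lt_add_of_pos_right _ hδ) (isOpen_Iio.preimage Real.continuous_sqrt)

/-- Below the constraint, a logarithmic moment already implies all the required finite energies, so
the outer problem asks for nothing more. -/
lemma IsMinimizer.isOuterMinimizer₁ {σ : Measure ℝ} [IsProbabilityMeasure σ]
    (h : IsMinimizer a b t μ₁ (sqMap σ) μ₃) : IsOuterMinimizer a t σ μ₁ where
  carrier := h.1.carrier₁
  mass := h.1.mass₁
  le := h.1.le₁
  logMoment := h.1.logMoment₁
  isMin := fun ν h1 h2 h3 h4 => by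
    have : IsFiniteMeasure ν := ⟨by rw [h2]; simp⟩
    have hreg := (logRegular_constraint a t).mono h3
    have := h.2 ν (sqMap σ) μ₃
      { h.1 with
        carrier₁ := h1
        mass₁ := h2
        le₁ := h3
        finite₁₁ := hreg.finiteEnergy h4 h4
        finite₁₂ := (hreg.finiteEnergy h.1.logMoment₂ h4).symm }
    unfold energy at this
    linarith

lemma IsMinimizer.isOuterMinimizer₃ {σ : Measure ℝ} [IsProbabilityMeasure σ]
    (h : IsMinimizer a b t μ₁ (sqMap σ) μ₃) : IsOuterMinimizer b (1 - t) σ μ₃ where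
  carrier := h.1.carrier₃
  mass := h.1.mass₃
  le := h.1.le₃
  logMoment := h.1.logMoment₃
  isMin := fun ν h1 h2 h3 h4 => by
    have : IsFiniteMeasure ν := ⟨by rw [h2]; simp⟩
    have := h.1.isFiniteMeasure₃
    have hreg := (logRegular_constraint b (1 - t)).mono h3
    have := h.2 μ₁ (sqMap σ) ν
      { h.1 with
        carrier₃ := h1
        mass₃ := h2
        le₃ := h3
        finite₃₃ := hreg.finiteEnergy h4 h4
        finite₂₃ := hreg.finiteEnergy h.1.logMoment₂ h4 }
    unfold energy at this
    rw [mutualEnergy_comm (sqMap σ) μ₃, mutualEnergy_comm (sqMap σ) ν] at this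
    linarith

/-- A minimizer in Case I exists only for `a b > 1 / 4`. -/
theorem quarter_lt_of_isCaseI (ha : 0 < a) (hb : 0 < b) (ht₀ : 0 < t) (ht₁ : t < 1)
    (h : IsMinimizer a b t μ₁ μ₂ μ₃) (hI : IsCaseI a b t μ₁ μ₂ μ₃) : 1 / 4 < a * b := by
  obtain ⟨hs1, hs3, ⟨p, q, hp, hpq, hs2⟩, hB1, hB3⟩ := hI
  have := h.1.isFiniteMeasure₁
  have := h.1.isProbabilityMeasure₂
  have := h.1.isFiniteMeasure₃
  obtain ⟨σ, hprob, rfl, hσ, hpos⟩ := exists_eq_sqMap hp hpq hs2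
  have hα : 0 < √p := Real.sqrt_pos.2 hp
  obtain rfl := h.isOuterMinimizer₁.eq_halfBal hα hσ hs1
  obtain rfl := h.isOuterMinimizer₃.eq_halfBal hα hσ hs3
  have hF := finiteEnergy_of_sqMap hα hσ h.1.finite₂₂
  have hna : NullSingletonClass σ := hF.nullSingletonClass
  obtain rfl := eq_extremal ha hb ht₀ ht₁ h hα hσ hpos
  have hR := radius_lt_center_of_extremal ht₀ ht₁ hα hσ
  have hσ' := hσ.mono fun u hu => hu.1
  exact (phase_condition ha ht₀ ht₁ hR).1 ⟨lt_of_invSqrtBlowup hα hσ' h.1.le₁ ht₀ hB1,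
    lt_of_invSqrtBlowup hα hσ' h.1.le₃ (by linarith) hB3⟩

end CaseI

end

end VectorEquilibrium

end

theorem mainTheorem6 (a b t : ℝ) (ha : 0 < a) (hb : 0 < b) (ht₀ : 0 < t) (ht₁ : t < 1)
    (μ₁ μ₂ μ₃ : MeasureTheory.Measure ℝ)
    (hμ : VectorEquilibrium.IsMinimizer a b t μ₁ μ₂ μ₃) :
    VectorEquilibrium.IsCaseI a b t μ₁ μ₂ μ₃ ↔ 1 / 4 < a * b := by
  exact ⟨VectorEquilibrium.quarter_lt_of_isCaseI ha hb ht₀ ht₁ hμ,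
    fun hab => VectorEquilibrium.isCaseI_of_quarter_lt ha hb ht₀ ht₁ hab hμ⟩
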